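/- **Theorem 3.1.** Let $A$ be a (not necessarily unital) $C^*$-algebra. Here an *ideal* is a closed two-sided ideal; an *ideal-quotient* of $A$ is an ideal $J$ of a quotient $A/I$ by an ideal $I\subseteq A$; a *hereditary sub-$C^*$-algebra* of $A$ is a norm-closed $*$-subalgebra $B\subseteq A$ such that $0\le a\le b$, $a\in A$, $b\in B$ imply $a\in B$; a *representation* of a $C^*$-algebra $B$ is a $*$-homomorphism $\pi\colon B\to\mathcal B(H)$ on a complex Hilbert space $H$, and it is *irreducible* if $\{0\}$ and $H$ are the only closed $\pi(B)$-invariant subspaces of $H$; $\mathcal K(H)$ denotes the compact operators on $H$. A positive element $a$ of a $C^*$-algebra $B$ is *abelian* if $\overline{aBa}$ is commutative. A $C^*$-algebra is *antiliminal* if it contains no nonzero abelian positive element, *type $\mathrm I$* if each of its nonzero quotients contains a nonzero abelian positive element, *scattered* if each of its states is atomic, that is, a countable weighted sum (with nonnegative weights) of pure states, and *elementary* if it is isomorphic to $\mathcal K(H)$ for some Hilbert space $H$. Then the following are equivalent: 1. $A$ is nowhere scattered, that is, no quotient $A/I$ contains a minimal open projection, by which we mean a nonzero projection $p\in A/I$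 with $p(A/I)p=\mathbb C p$; 2. every quotient of $A$ is antiliminal; 3. $A$ has no nonzero ideal-quotients of type $\mathrm I$; 4. $A$ has no nonzero scattered ideal-quotients; 5. $A$ has no nonzero elementary ideal-quotients; 6. $A$ has no nonzero irreducible representation $\pi\colon A\to\mathcal B(H)$ that is GCR, that is, with $\pi(A)\cap\mathcal K(H)\neq\{0\}$; 7. no hereditary sub-$C^*$-algebra of $A$ admits a nonzero finite-dimensional irreducible representation; 8. no hereditary sub-$C^*$-algebra of $A$ admits a nonzero one-dimensional irreducible representation. -/

import Mathlib

open Filter Topology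

universe u

/-- An ideal in a C⋆-algebra: a norm-closed, two-sided ideal (not assumed to be self-adjoint). -/
structure ClosedIdeal (A : Type u) [NonUnitalCStarAlgebra A] extends Submodule ℂ A where
  mul_mem_left' : ∀ (a : A) {x : A}, x ∈ carrier → a * x ∈ carrier
  mul_mem_right' : ∀ (a : A) {x : A}, x ∈ carrier → x * a ∈ carrier
  isClosed' : IsClosed carrier

namespace ClosedIdeal

section Basic

variable {A : Type u} [NonUnitalCStarAlgebra A]

instance : SetLike (ClosedIdeal A) A where
  coe I := I.carrier
  coe_injective := by
    rintro ⟨I, _, _, _⟩ ⟨J, _, _, _⟩ h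
    have : I = J := SetLike.coe_injective h
    subst this
    rfl

theorem mul_mem_left (I : ClosedIdeal A) (a : A) {x : A} (hx : x ∈ I) : a * x ∈ I :=
  I.mul_mem_left' a hx

theorem mul_mem_right (I : ClosedIdeal A) (a : A) {x : A} (hx : x ∈ I) : x * a ∈ I :=
  I.mul_mem_right' a hx

theorem mem_toSubmodule {I : ClosedIdeal A} {x : A} : x ∈ I.toSubmodule ↔ x ∈ I := Iff.rfl

instance : NonUnitalSubringClass (ClosedIdeal A) A where
  add_mem {I} _ _ ha hb := I.toSubmodule.add_mem ha hb
  zero_mem I := I.toSubmodule.zero_mem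
  neg_mem {I} _ ha := I.toSubmodule.neg_mem ha
  mul_mem {I} a _ _ hb := I.mul_mem_left a hb

instance : SMulMemClass (ClosedIdeal A) ℂ A where
  smul_mem {I} c _ ha := I.toSubmodule.smul_mem c ha

instance isClosed_coe (I : ClosedIdeal A) : IsClosed (I : Set A) := I.isClosed'

instance isClosed_toSubmodule (I : ClosedIdeal A) : IsClosed (I.toSubmodule : Set A) :=
  I.isClosed'

/-- The C⋆-subalgebra `I ∩ I⋆`. -/
def selfAdjointPart (I : ClosedIdeal A) : NonUnitalStarSubalgebra ℂ A where
  carrier := {x | x ∈ I ∧ star x ∈ I}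
  add_mem' := fun ha hb => ⟨add_mem ha.1 hb.1, by rw [star_add]; exact add_mem ha.2 hb.2⟩
  zero_mem' := ⟨zero_mem I, by rw [star_zero]; exact zero_mem I⟩
  mul_mem' := fun ha hb => ⟨mul_mem ha.1 hb.1, by rw [star_mul]; exact mul_mem hb.2 ha.2⟩
  smul_mem' := fun c x hx =>
    ⟨SMulMemClass.smul_mem c hx.1, by rw [star_smul]; exact SMulMemClass.smul_mem _ hx.2⟩
  star_mem' := fun hx => ⟨hx.2, by rw [star_star]; exact hx.1⟩

theorem isClosed_selfAdjointPart (I : ClosedIdeal A) :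
    IsClosed (I.selfAdjointPart : Set A) :=
  (isClosed_coe I).inter ((isClosed_coe I).preimage continuous_star)

theorem norm_sub_mul_le {b : A} (hb : ‖star b * b‖ ≤ 1) (x : A) :
    ‖x - star b * b * x‖ ≤ ‖x‖ := by
  let := CStarAlgebra.spectralOrder A
  have := CStarAlgebra.spectralOrderedRing A
  refine CStarAlgebra.norm_sub_mul_self_le_of_inr x le_rfl (star_mul_self_nonneg b) hb
    (norm_nonneg x) ?_
  simp only [Unitization.inr_zero, sub_zero, mul_one]
  rw [CStarRing.norm_star_mul_self, Unitization.norm_inr, sq]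

/-- `I ∩ I⋆` contains an approximate unit of self-adjoint contractions. -/
theorem exists_approximateUnit (I : ClosedIdeal A) :
    ∃ l : Filter A, l.NeBot ∧ (∀ᶠ e in l, e ∈ I ∧ star e = e ∧ ‖e‖ ≤ 1 ∧
        ∀ x : A, ‖x - e * x‖ ≤ ‖x‖) ∧
      ∀ x ∈ I.selfAdjointPart, Tendsto (fun e => x * e) l (𝓝 x) ∧
        Tendsto (fun e => e * x) l (𝓝 x) := by
  have := I.isClosed_selfAdjointPart
  let : NonUnitalCStarAlgebra I.selfAdjointPart :=
    NonUnitalStarSubalgebra.nonUnitalCStarAlgebra I.selfAdjointPart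
  let := CStarAlgebra.spectralOrder I.selfAdjointPart
  have := CStarAlgebra.spectralOrderedRing I.selfAdjointPart
  have h := CStarAlgebra.increasingApproximateUnit I.selfAdjointPart
  refine ⟨(CStarAlgebra.approximateUnit I.selfAdjointPart).map Subtype.val, inferInstance, ?_, ?_⟩
  · rw [eventually_map]
    filter_upwards [h.eventually_norm, h.eventually_star_eq, h.eventually_nonneg]
      with e he1 he2 he3
    obtain ⟨b, hb⟩ := CStarAlgebra.nonneg_iff_eq_star_mul_self.1 he3
    have hb' : (e : A) = star (b : A) * b := congrArg Subtype.val hb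
    have he1' : ‖(e : A)‖ ≤ 1 := he1
    refine ⟨e.2.1, congrArg Subtype.val he2, he1', fun x => ?_⟩
    rw [hb'] at he1' ⊢
    exact norm_sub_mul_le he1' x
  · intro x hx
    constructor
    · exact tendsto_map'_iff.2
        ((continuous_subtype_val.tendsto _).comp (h.tendsto_mul_left ⟨x, hx⟩))
    · exact tendsto_map'_iff.2
        ((continuous_subtype_val.tendsto _).comp (h.tendsto_mul_right ⟨x, hx⟩))

/-- Closed two-sided ideals of C⋆-algebras are self-adjoint. -/
theorem star_mem_of_mem (I : ClosedIdeal A) {a : A} (ha : a ∈ I) : star a ∈ I := by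
  obtain ⟨l, hl, he, hx⟩ := I.exists_approximateUnit
  have hmem : a * star a ∈ I.selfAdjointPart :=
    ⟨I.mul_mem_right _ ha, by rw [star_mul, star_star]; exact I.mul_mem_right _ ha⟩
  obtain ⟨h1, h2⟩ := hx _ hmem
  have h3 : Tendsto (fun e => e * (a * star a) * e) l (𝓝 (a * star a)) := by
    have h4 : Tendsto (fun e => e * (a * star a * e - a * star a) + e * (a * star a)) l
        (𝓝 (a * star a)) := by
      have h5 : Tendsto (fun e => e * (a * star a * e - a * star a)) l (𝓝 0) := by
        have h6 : Tendsto (fun e => ‖a * star a * e - a * star a‖) l (𝓝 0) :=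
          tendsto_iff_norm_sub_tendsto_zero.1 h1
        refine squeeze_zero_norm' ?_ h6
        filter_upwards [he] with e h
        calc ‖e * (a * star a * e - a * star a)‖
            ≤ ‖e‖ * ‖a * star a * e - a * star a‖ := norm_mul_le _ _
          _ ≤ 1 * ‖a * star a * e - a * star a‖ := by gcongr; exact h.2.2.1
          _ = _ := one_mul _
      simpa using h5.add h2
    refine h4.congr fun e => ?_
    noncomm_ring
  have key : Tendsto (fun e => star a * e) l (𝓝 (star a)) := by
    rw [tendsto_iff_norm_sub_tendsto_zero]
    have h7 : Tendsto (fun e => ‖e * (a * star a) * e - e * (a * star a) - a * star a * e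
        + a * star a‖) l (𝓝 0) := by
      have := (((h3.sub h2).sub h1).add_const (a * star a)).norm
      simpa using this
    have h8 : Tendsto (fun e => ‖star a * e - star a‖ * ‖star a * e - star a‖) l (𝓝 0) := by
      refine h7.congr' ?_
      filter_upwards [he] with e h
      rw [← CStarRing.norm_star_mul_self, star_sub, star_mul, star_star, h.2.1]
      congr 1
      noncomm_ring
    have h9 := h8.sqrt
    simpa [Real.sqrt_mul_self] using h9
  refine (isClosed_coe I).mem_of_tendsto key ?_
  filter_upwards [he] with e h
  exact I.mul_mem_left _ h.1

instance : StarMemClass (ClosedIdeal A) A where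
  star_mem {I} _ ha := I.star_mem_of_mem ha

/-- A closed ideal is itself a C⋆-algebra. -/
noncomputable instance (I : ClosedIdeal A) : NonUnitalCStarAlgebra I :=
  NonUnitalStarSubalgebra.nonUnitalCStarAlgebra I

/-- The quotient `A / I`, with the quotient norm and the induced operations. -/
def Quotient (I : ClosedIdeal A) : Type u := A ⧸ I.toSubmodule

/-- The quotient map `A → A / I`. -/
def proj (I : ClosedIdeal A) (a : A) : I.Quotient := Submodule.Quotient.mk a

noncomputable instance (I : ClosedIdeal A) : NormedAddCommGroup I.Quotient :=
  inferInstanceAs (NormedAddCommGroup (A ⧸ I.toSubmodule))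

noncomputable instance (I : ClosedIdeal A) : NormedSpace ℂ I.Quotient :=
  inferInstanceAs (NormedSpace ℂ (A ⧸ I.toSubmodule))

instance (I : ClosedIdeal A) : CompleteSpace I.Quotient :=
  inferInstanceAs (CompleteSpace (A ⧸ I.toSubmodule))

theorem proj_surjective (I : ClosedIdeal A) : Function.Surjective I.proj :=
  Submodule.Quotient.mk_surjective _

theorem proj_eq_proj (I : ClosedIdeal A) {a b : A} : I.proj a = I.proj b ↔ a - b ∈ I :=
  Submodule.Quotient.eq _

theorem proj_add (I : ClosedIdeal A) (a b : A) : I.proj (a + b) = I.proj a + I.proj b := rfl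

theorem proj_smul (I : ClosedIdeal A) (c : ℂ) (a : A) : I.proj (c • a) = c • I.proj a := rfl

theorem proj_zero (I : ClosedIdeal A) : I.proj 0 = 0 := rfl

theorem norm_proj_le (I : ClosedIdeal A) (a : A) : ‖I.proj a‖ ≤ ‖a‖ :=
  Submodule.Quotient.norm_mk_le I.toSubmodule a

theorem exists_norm_lt (I : ClosedIdeal A) (x : I.Quotient) {ε : ℝ} (hε : 0 < ε) :
    ∃ a, I.proj a = x ∧ ‖a‖ < ‖x‖ + ε :=
  Submodule.Quotient.norm_mk_lt (S := I.toSubmodule) x hε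

instance (I : ClosedIdeal A) : Mul I.Quotient where
  mul := Quotient.map₂ (· * ·) (by
    intro a b hab c d hcd
    have h1 : a - b ∈ I := (Submodule.quotientRel_def _).1 hab
    have h2 : c - d ∈ I := (Submodule.quotientRel_def _).1 hcd
    refine (Submodule.quotientRel_def _).2 ?_
    have : a * c - b * d = (a - b) * c + b * (c - d) := by noncomm_ring
    rw [mem_toSubmodule, this]
    exact add_mem (I.mul_mem_right _ h1) (I.mul_mem_left _ h2))

instance (I : ClosedIdeal A) : Star I.Quotient where
  star := Quotient.map star (by
    intro a b hab
    have h1 : a - b ∈ I := (Submodule.quotientRel_def _).1 hab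
    refine (Submodule.quotientRel_def _).2 ?_
    rw [mem_toSubmodule, ← star_sub]
    exact I.star_mem_of_mem h1)

theorem proj_mul (I : ClosedIdeal A) (a b : A) : I.proj (a * b) = I.proj a * I.proj b := rfl

theorem proj_star (I : ClosedIdeal A) (a : A) : I.proj (star a) = star (I.proj a) := rfl

noncomputable instance (I : ClosedIdeal A) : NonUnitalNormedRing I.Quotient where
  __ := (inferInstance : NormedAddCommGroup I.Quotient)
  left_distrib x y z := by
    obtain ⟨a, rfl⟩ := I.proj_surjective x
    obtain ⟨b, rfl⟩ := I.proj_surjective y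
    obtain ⟨c, rfl⟩ := I.proj_surjective z
    exact congrArg I.proj (mul_add a b c)
  right_distrib x y z := by
    obtain ⟨a, rfl⟩ := I.proj_surjective x
    obtain ⟨b, rfl⟩ := I.proj_surjective y
    obtain ⟨c, rfl⟩ := I.proj_surjective z
    exact congrArg I.proj (add_mul a b c)
  zero_mul x := by
    obtain ⟨a, rfl⟩ := I.proj_surjective x
    exact congrArg I.proj (zero_mul a)
  mul_zero x := by
    obtain ⟨a, rfl⟩ := I.proj_surjective x
    exact congrArg I.proj (mul_zero a)
  mul_assoc x y z := by
    obtain ⟨a, rfl⟩ := I.proj_surjective x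
    obtain ⟨b, rfl⟩ := I.proj_surjective y
    obtain ⟨c, rfl⟩ := I.proj_surjective z
    exact congrArg I.proj (mul_assoc a b c)
  norm_mul_le x y := by
    refine le_of_forall_gt_imp_ge_of_dense fun r hr => ?_
    have hcont : Tendsto (fun ε : ℝ => (‖x‖ + ε) * (‖y‖ + ε)) (𝓝[>] 0) (𝓝 (‖x‖ * ‖y‖)) := by
      have : Continuous fun ε : ℝ => (‖x‖ + ε) * (‖y‖ + ε) := by fun_prop
      simpa using (this.tendsto 0).mono_left nhdsWithin_le_nhds
    obtain ⟨ε, hε, hε0⟩ := ((hcont.eventually_lt_const hr).and self_mem_nhdsWithin).exists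
    obtain ⟨a, rfl, ha⟩ := I.exists_norm_lt x hε0
    obtain ⟨b, rfl, hb⟩ := I.exists_norm_lt y hε0
    calc ‖I.proj a * I.proj b‖ = ‖I.proj (a * b)‖ := rfl
      _ ≤ ‖a * b‖ := I.norm_proj_le _
      _ ≤ ‖a‖ * ‖b‖ := norm_mul_le _ _
      _ ≤ (‖I.proj a‖ + ε) * (‖I.proj b‖ + ε) := by gcongr
      _ ≤ r := hε.le

noncomputable instance (I : ClosedIdeal A) : StarRing I.Quotient where
  star_involutive x := by
    obtain ⟨a, rfl⟩ := I.proj_surjective x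
    exact congrArg I.proj (star_star a)
  star_mul x y := by
    obtain ⟨a, rfl⟩ := I.proj_surjective x
    obtain ⟨b, rfl⟩ := I.proj_surjective y
    exact congrArg I.proj (star_mul a b)
  star_add x y := by
    obtain ⟨a, rfl⟩ := I.proj_surjective x
    obtain ⟨b, rfl⟩ := I.proj_surjective y
    exact congrArg I.proj (star_add a b)

/-- The C⋆-inequality for the quotient norm. -/
theorem norm_proj_mul_self_le (I : ClosedIdeal A) (x : I.Quotient) :
    ‖x‖ * ‖x‖ ≤ ‖star x * x‖ := by
  suffices h : ∀ a : A, ‖I.proj (star a)‖ * ‖I.proj (star a)‖ ≤ ‖I.proj (a * star a)‖ by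
    obtain ⟨a, rfl⟩ := I.proj_surjective x
    have := h (star a)
    rwa [star_star] at this
  intro a
  refine le_of_forall_pos_le_add fun ε hε => ?_
  obtain ⟨c, hc, hcn⟩ := I.exists_norm_lt (I.proj (a * star a)) (half_pos hε)
  have hi : a * star a - c ∈ I := I.proj_eq_proj.1 hc.symm
  obtain ⟨l, hl, he, hx⟩ := I.exists_approximateUnit
  have h1 := (hx _ (⟨hi, I.star_mem_of_mem hi⟩ : a * star a - c ∈ I.selfAdjointPart)).2
  have h2 : ∀ᶠ e in l, ‖e * (a * star a - c) - (a * star a - c)‖ < ε / 2 :=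
    (tendsto_iff_norm_sub_tendsto_zero.1 h1).eventually_lt_const (half_pos hε)
  obtain ⟨e, ⟨heI, hes, -, hen⟩, hlt⟩ := (he.and h2).exists
  have hen' : ∀ x : A, ‖x - x * e‖ ≤ ‖x‖ := fun x => by
    have := hen (star x)
    rwa [← norm_star, star_sub, star_mul, star_star, hes, norm_star] at this
  have hp : I.proj (star a - star a * e) = I.proj (star a) := by
    rw [I.proj_eq_proj, sub_sub_cancel_left]
    exact neg_mem (I.mul_mem_left _ heI)
  have h3 : star (star a - star a * e) * (star a - star a * e)
      = (a * star a - e * (a * star a)) - (a * star a - e * (a * star a)) * e := by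
    rw [star_sub, star_mul, star_star, hes]
    noncomm_ring
  calc ‖I.proj (star a)‖ * ‖I.proj (star a)‖
      = ‖I.proj (star a - star a * e)‖ * ‖I.proj (star a - star a * e)‖ := by rw [hp]
    _ ≤ ‖star a - star a * e‖ * ‖star a - star a * e‖ := by
        gcongr <;> exact I.norm_proj_le _
    _ = ‖(a * star a - e * (a * star a)) - (a * star a - e * (a * star a)) * e‖ := by
        rw [← CStarRing.norm_star_mul_self, h3]
    _ ≤ ‖a * star a - e * (a * star a)‖ := hen' _
    _ = ‖(c - e * c) - (e * (a * star a - c) - (a * star a - c))‖ := by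
        congr 1
        noncomm_ring
    _ ≤ ‖c - e * c‖ + ‖e * (a * star a - c) - (a * star a - c)‖ := norm_sub_le _ _
    _ ≤ (‖I.proj (a * star a)‖ + ε / 2) + ε / 2 := by
        gcongr
        exact (hen c).trans hcn.le
    _ = ‖I.proj (a * star a)‖ + ε := by ring

/-- The quotient of a C⋆-algebra by a closed ideal is a C⋆-algebra. -/
noncomputable instance (I : ClosedIdeal A) : NonUnitalCStarAlgebra I.Quotient where
  toCompleteSpace := inferInstance
  norm_mul_self_le := I.norm_proj_mul_self_le
  toNormedSpace := inferInstance
  smul_assoc c x y := by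
    obtain ⟨a, rfl⟩ := I.proj_surjective x
    obtain ⟨b, rfl⟩ := I.proj_surjective y
    exact congrArg I.proj (smul_mul_assoc c a b)
  smul_comm c x y := by
    obtain ⟨a, rfl⟩ := I.proj_surjective x
    obtain ⟨b, rfl⟩ := I.proj_surjective y
    exact congrArg I.proj (mul_smul_comm c a b).symm
  star_smul c x := by
    obtain ⟨a, rfl⟩ := I.proj_surjective x
    exact congrArg I.proj (star_smul c a)

end Basic

/-- The ideal `K(H)` of compact operators in `B(H)`. -/
def compactOperators (H : Type u) [NormedAddCommGroup H] [InnerProductSpace ℂ H]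
    [CompleteSpace H] : ClosedIdeal (H →L[ℂ] H) where
  toSubmodule := compactOperator (RingHom.id ℂ) H H
  mul_mem_left' a _ hx := IsCompactOperator.clm_comp hx a
  mul_mem_right' a _ hx := IsCompactOperator.comp_clm hx a
  isClosed' := isClosed_setOfPred_isCompactOperator

end ClosedIdeal

section Notions

variable {A : Type u} [NonUnitalCStarAlgebra A]

/-- Positive elements of a C⋆-algebra: those of the form `b⋆ b`. -/
def IsPositiveElement (a : A) : Prop := ∃ b : A, a = star b * b

/-- A positive element `a` is abelian if the hereditary C⋆-subalgebra `closure (a A a)` is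
commutative. -/
def IsAbelianElement (a : A) : Prop :=
  IsPositiveElement a ∧
    ∀ x ∈ closure (Set.range fun z : A => a * z * a),
      ∀ y ∈ closure (Set.range fun z : A => a * z * a), x * y = y * x

/-- A minimal open projection in `A`: a nonzero projection `p ∈ A` with `p A p = ℂ p`. -/
def IsMinimalOpenProjection (p : A) : Prop :=
  p ≠ 0 ∧ IsStarProjection p ∧
    (Set.range fun a : A => p * a * p) = Set.range fun c : ℂ => c • p

/-- A hereditary C⋆-subalgebra: a norm-closed ⋆-subalgebra `B` such that `0 ≤ a ≤ b` and
`b ∈ B` imply `a ∈ B`. -/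
def IsHereditary (B : NonUnitalStarSubalgebra ℂ A) : Prop :=
  IsClosed (B : Set A) ∧
    ∀ a b : A, IsPositiveElement a → IsPositiveElement (b - a) → b ∈ B → a ∈ B

variable (A)

/-- The states of `A`: the positive linear functionals of norm one. -/
def stateSpace : Set (A →L[ℂ] ℂ) :=
  {φ | (∀ a : A, 0 ≤ (φ (star a * a)).re ∧ (φ (star a * a)).im = 0) ∧ ‖φ‖ = 1}

/-- The pure states of `A`: the extreme points of the state space. -/
def pureStates : Set (A →L[ℂ] ℂ) := Set.extremePoints ℝ (stateSpace A)

variable {A} in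
/-- A functional is atomic if it is a countable weighted sum of pure states (finite sums are
included, since weights may vanish). -/
def IsAtomicFunctional (φ : A →L[ℂ] ℂ) : Prop :=
  ∃ (w : ℕ → ℝ) (ψ : ℕ → A →L[ℂ] ℂ),
    (∀ n, 0 ≤ w n) ∧ (∀ n, ψ n ∈ pureStates A) ∧ HasSum (fun n => w n • ψ n) φ

/-- `A` is scattered if each of its states is atomic. -/
def IsScattered : Prop := ∀ φ ∈ stateSpace A, IsAtomicFunctional φ

/-- `A` is antiliminal if it contains no nonzero abelian positive element. -/
def IsAntiliminal : Prop := ∀ a : A, IsAbelianElement a → a = 0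

/-- `A` is of type I if every nonzero quotient contains a nonzero abelian element. -/
def IsTypeI : Prop :=
  ∀ I : ClosedIdeal A, Nontrivial I.Quotient → ∃ a : I.Quotient, a ≠ 0 ∧ IsAbelianElement a

/-- `A` is elementary if it is ⋆-isomorphic to the compact operators on some Hilbert space. -/
def IsElementary : Prop :=
  ∃ (H : Type u) (_ : NormedAddCommGroup H) (_ : InnerProductSpace ℂ H) (_ : CompleteSpace H),
    Nonempty (A ≃⋆ₐ[ℂ] ClosedIdeal.compactOperators H)

/-- `A` is nowhere scattered if none of its quotients contains a minimal open projection. -/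
def IsNowhereScattered : Prop :=
  ∀ I : ClosedIdeal A, ¬ ∃ p : I.Quotient, IsMinimalOpenProjection p

end Notions

section Representations

/-- A representation `π : B → B(H)` of a complex ⋆-algebra is irreducible if `0` and `H` are the
only closed subspaces of `H` that are invariant under `π(B)`. -/
def IsIrreducibleRep {B : Type*} [NonUnitalSemiring B] [StarRing B] [Module ℂ B]
    {H : Type*} [NormedAddCommGroup H] [InnerProductSpace ℂ H] [CompleteSpace H]
    (π : B →⋆ₙₐ[ℂ] (H →L[ℂ] H)) : Prop :=
  ∀ K : Submodule ℂ H, IsClosed (K : Set H) → (∀ b, ∀ ξ ∈ K, π b ξ ∈ K) → K = ⊥ ∨ K = ⊤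

/-- A representation `π : B → B(H)` is GCR if `π(B) ∩ K(H) ≠ {0}`. -/
def IsGCRRep {B : Type*} [NonUnitalSemiring B] [StarRing B] [Module ℂ B]
    {H : Type u} [NormedAddCommGroup H] [InnerProductSpace ℂ H] [CompleteSpace H]
    (π : B →⋆ₙₐ[ℂ] (H →L[ℂ] H)) : Prop :=
  Set.range π ∩ (ClosedIdeal.compactOperators H : Set (H →L[ℂ] H)) ≠ {0}

end Representations

/-!
Every implication is proved by negation. The hub is the failure of the first condition: some
quotient `A / I` contains a nonzero projection `p` with `p (A / I) p = ℂ p`, which will be called a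
minimal projection.

**From a minimal projection to the other structures.** With the inner product `⟪x, y⟫ p = x⋆ y`, the
left ideal `(A / I) p` is a Hilbert space whose norm is that of `A / I`. Left multiplication is an
irreducible representation in which `x y⋆` acts as a rank-one operator, so its image contains all
compact operators: this gives a GCR representation (`exists_irreducibleRep_rankOne`) and, by
pulling back the compact operators, an elementary ideal-quotient
(`exists_isElementary_of_rankOne`). The elements of `A` that are mapped into `ℂ p` form a
hereditary subalgebra with a character (`exists_hereditary_oneDimensional`). Elementary algebras are
of type `I` because rank-one projections are abelian, and scattered because a density operator `ρ`
is the sum of the rank-one operators attached to `√ρ eᵢ`, for a Hilbert basis `eᵢ`.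

**Back to a minimal projection.** A closed subalgebra `B` with `B A B ⊆ B` passes minimal
projections of its quotients on to quotients of `A` (`not_isNowhereScattered_of_corner`). For an
abelian element `a`, the algebra `closure (a A a)` has a character, whose kernel gives such a
quotient. If an algebra has no minimal projection, then every corner `closure (b A b)` contains two
orthogonal positive elements of norm one (`exists_orthogonal_pair`). Hence a nonzero compact operator
in the image of a representation yields a minimal projection: otherwise a nonzero element of finite
rank could be split into elements of smaller rank.

**Scattered algebras.** This is the deepest part. In a nonzero algebra without minimal projections,
repeated splitting gives a dyadic tree of positive elements. Distributing mass evenly over the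
branches of deep trees, and passing to a limit along an ultrafilter, one obtains a positive
functional `φ` with the following property. The restrictions `θₙ ≤ φ` of `φ` to the branches that
turn left in generation `n` are uniformly separated in norm, as one sees by testing them on the sum
`uₙ` of the elements which separate left from right in that generation
(`exists_separated_sequence`). On the other hand, if `φ = ∑ σᵢ` with `σᵢ` multiples of pure states,
then the order interval `[0, φ]` is totally bounded (`exists_norm_sub_lt_of_hasSum`). To see this,
let `π` be the GNS representation of `φ`, with cyclic vector `ξ`, and represent each `θ` in the
interval by its Radon–Nikodym derivative `T` in the commutant of `π`. Purity makes the derivatives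
`Sᵢ` of `σᵢ` minimal in the commutant, so that each `Sᵢ T Sⱼ` stays in a line. With
`Q = ∑_{i < N} Sᵢ`, the vectors `Q T Q ξ` therefore stay in a finite-dimensional space. Since `Q`
commutes with `π` and `Q ξ` is close to `ξ`, the number `θ u = ⟪ξ, T π(u) ξ⟫` is close to
`⟪ξ, π(u) Q T Q ξ⟫`, uniformly on the unit ball.
-/

/-! ### Ideals, quotients and homomorphisms -/

namespace ClosedIdeal

variable {A : Type u} [NonUnitalCStarAlgebra A] {B : Type*} [NonUnitalCStarAlgebra B]

theorem _root_.NonUnitalStarAlgHom.continuous_of_cstar (f : A →⋆ₙₐ[ℂ] B) : Continuous f :=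
  AddMonoidHomClass.continuous_of_bound f 1 fun a => by
    simpa using NonUnitalStarAlgHom.norm_apply_le f a

/-- The preimage of a closed ideal under a `⋆`-homomorphism. -/
def comap {B : Type u} [NonUnitalCStarAlgebra B] (f : A →⋆ₙₐ[ℂ] B) (J : ClosedIdeal B) :
    ClosedIdeal A where
  carrier := {a | f a ∈ J}
  add_mem' {a b} (ha : f a ∈ J) (hb : f b ∈ J) := show f (a + b) ∈ J by
    rw [map_add]; exact add_mem ha hb
  zero_mem' := show f 0 ∈ J by rw [map_zero]; exact zero_mem J
  smul_mem' c x (hx : f x ∈ J) := show f (c • x) ∈ J by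
    rw [map_smul]; exact SMulMemClass.smul_mem c hx
  mul_mem_left' a x hx := by
    have := J.mul_mem_left (f a) hx
    rwa [← map_mul] at this
  mul_mem_right' a x hx := by
    have := J.mul_mem_right (f a) hx
    rwa [← map_mul] at this
  isClosed' := (isClosed_coe J).preimage f.continuous_of_cstar

/-- The kernel of a `⋆`-homomorphism, as a closed ideal. -/
def ker (f : A →⋆ₙₐ[ℂ] B) : ClosedIdeal A where
  carrier := {a | f a = 0}
  add_mem' {a b} (ha : f a = 0) (hb : f b = 0) := show f (a + b) = 0 by rw [map_add, ha, hb, add_zero]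
  zero_mem' := map_zero f
  smul_mem' c x (hx : f x = 0) := show f (c • x) = 0 by rw [map_smul, hx, smul_zero]
  mul_mem_left' a x (hx : f x = 0) := show f (a * x) = 0 by rw [map_mul, hx, mul_zero]
  mul_mem_right' a x (hx : f x = 0) := show f (x * a) = 0 by rw [map_mul, hx, zero_mul]
  isClosed' := isClosed_singleton.preimage f.continuous_of_cstar

theorem mem_ker {f : A →⋆ₙₐ[ℂ] B} {a : A} : a ∈ ker f ↔ f a = 0 := Iff.rfl

/-- The zero ideal. -/
def zeroIdeal (A : Type u) [NonUnitalCStarAlgebra A] : ClosedIdeal A where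
  toSubmodule := ⊥
  mul_mem_left' a x hx := by
    have hx : x = 0 := hx
    simp [hx]
  mul_mem_right' a x hx := by
    have hx : x = 0 := hx
    simp [hx]
  isClosed' := isClosed_singleton

theorem mem_zeroIdeal {a : A} : a ∈ zeroIdeal A ↔ a = 0 := Iff.rfl

/-- The quotient map as a `⋆`-homomorphism. -/
def projHom (I : ClosedIdeal A) : A →⋆ₙₐ[ℂ] I.Quotient where
  toFun := I.proj
  map_smul' _ _ := rfl
  map_zero' := rfl
  map_add' _ _ := rfl
  map_mul' _ _ := rfl
  map_star' _ := rfl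

theorem proj_eq_zero (I : ClosedIdeal A) {a : A} : I.proj a = 0 ↔ a ∈ I := by
  rw [← I.proj_zero, I.proj_eq_proj, sub_zero]

theorem proj_sub (I : ClosedIdeal A) (a b : A) : I.proj (a - b) = I.proj a - I.proj b := rfl

/-- The factorisation of a `⋆`-homomorphism through the quotient by its kernel. -/
def kerLift (f : A →⋆ₙₐ[ℂ] B) : (ker f).Quotient →⋆ₙₐ[ℂ] B where
  toFun := _root_.Quotient.lift f fun a b hab => by
    have h : a - b ∈ ker f := (Submodule.quotientRel_def _).1 hab
    rwa [mem_ker, map_sub, sub_eq_zero] at h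
  map_smul' c x := by
    obtain ⟨a, rfl⟩ := (ker f).proj_surjective x
    exact map_smul f c a
  map_zero' := map_zero f
  map_add' x y := by
    obtain ⟨a, rfl⟩ := (ker f).proj_surjective x
    obtain ⟨b, rfl⟩ := (ker f).proj_surjective y
    exact map_add f a b
  map_mul' x y := by
    obtain ⟨a, rfl⟩ := (ker f).proj_surjective x
    obtain ⟨b, rfl⟩ := (ker f).proj_surjective y
    exact map_mul f a b
  map_star' x := by
    obtain ⟨a, rfl⟩ := (ker f).proj_surjective x
    exact map_star f a

theorem kerLift_injective (f : A →⋆ₙₐ[ℂ] B) : Function.Injective (kerLift f) := by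
  rw [injective_iff_map_eq_zero]
  intro x hx
  obtain ⟨a, rfl⟩ := (ker f).proj_surjective x
  exact (ker f).proj_eq_zero.2 hx

end ClosedIdeal

/-! ### Minimal projections modulo an ideal -/

section MinimalMod

variable {A : Type u} [NonUnitalCStarAlgebra A]

/-- The element `p` of `A` represents a minimal open projection of the quotient `A / I`. -/
structure IsMinimalMod (I : ClosedIdeal A) (p : A) : Prop where
  notMem : p ∉ I
  mul_self : p * p - p ∈ I
  star_self : star p - p ∈ I
  corner : ∀ a, ∃ c : ℂ, p * a * p - c • p ∈ I

theorem isMinimalOpenProjection_iff {p : A} :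
    IsMinimalOpenProjection p ↔
      p ≠ 0 ∧ p * p = p ∧ star p = p ∧ ∀ a, ∃ c : ℂ, p * a * p = c • p := by
  constructor
  · rintro ⟨h0, hp, h⟩
    refine ⟨h0, hp.isIdempotentElem, hp.isSelfAdjoint, fun a => ?_⟩
    obtain ⟨c, hc⟩ : p * a * p ∈ Set.range fun c : ℂ => c • p := h ▸ ⟨a, rfl⟩
    exact ⟨c, hc.symm⟩
  · rintro ⟨h0, hpp, hps, h⟩
    refine ⟨h0, ⟨hpp, hps⟩, ?_⟩
    apply Set.Subset.antisymm
    · rintro _ ⟨a, rfl⟩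
      obtain ⟨c, hc⟩ := h a
      exact ⟨c, hc.symm⟩
    · rintro _ ⟨c, rfl⟩
      refine ⟨c • p, ?_⟩
      simp only [mul_smul_comm, smul_mul_assoc, hpp]

theorem isMinimalMod_iff {I : ClosedIdeal A} {p : A} :
    IsMinimalMod I p ↔ IsMinimalOpenProjection (I.proj p) := by
  rw [isMinimalOpenProjection_iff]
  constructor
  · rintro ⟨h0, h1, h2, h3⟩
    refine ⟨fun h => h0 (I.proj_eq_zero.1 h), ?_, ?_, fun x => ?_⟩
    · rw [← I.proj_mul, I.proj_eq_proj]; exact h1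
    · rw [← I.proj_star, I.proj_eq_proj]; exact h2
    · obtain ⟨a, rfl⟩ := I.proj_surjective x
      obtain ⟨c, hc⟩ := h3 a
      exact ⟨c, by rw [← I.proj_mul, ← I.proj_mul, ← I.proj_smul, I.proj_eq_proj]; exact hc⟩
  · rintro ⟨h0, h1, h2, h3⟩
    refine ⟨fun h => h0 (I.proj_eq_zero.2 h), ?_, ?_, fun a => ?_⟩
    · rwa [← I.proj_mul, I.proj_eq_proj] at h1
    · rwa [← I.proj_star, I.proj_eq_proj] at h2
    · obtain ⟨c, hc⟩ := h3 (I.proj a)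
      refine ⟨c, ?_⟩
      rwa [← I.proj_mul, ← I.proj_mul, ← I.proj_smul, I.proj_eq_proj] at hc

theorem not_isNowhereScattered_iff :
    ¬ IsNowhereScattered A ↔ ∃ (I : ClosedIdeal A) (p : A), IsMinimalMod I p := by
  simp only [IsNowhereScattered, not_forall, not_not]
  constructor
  · rintro ⟨I, x, hx⟩
    obtain ⟨p, rfl⟩ := I.proj_surjective x
    exact ⟨I, p, isMinimalMod_iff.2 hx⟩
  · rintro ⟨I, p, hp⟩
    exact ⟨I, _, isMinimalMod_iff.1 hp⟩

/-- A minimal open projection in a quotient of a quotient of `A` is one in a quotient of `A`. -/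
theorem IsMinimalMod.comap_proj {I : ClosedIdeal A} {N : ClosedIdeal I.Quotient} {p : A}
    (h : IsMinimalMod N (I.proj p)) : IsMinimalMod (N.comap I.projHom) p where
  notMem := h.notMem
  mul_self := h.mul_self
  star_self := h.star_self
  corner a := h.corner (I.proj a)

theorem not_isNowhereScattered_of_quotient {I : ClosedIdeal A}
    (h : ¬ IsNowhereScattered I.Quotient) : ¬ IsNowhereScattered A := by
  obtain ⟨N, x, hx⟩ := not_isNowhereScattered_iff.1 h
  obtain ⟨p, rfl⟩ := I.proj_surjective x
  exact not_isNowhereScattered_iff.2 ⟨_, p, hx.comap_proj⟩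

theorem ClosedIdeal.selfAdjointPart_mem {I : ClosedIdeal A} {x : A} (hx : x ∈ I) :
    x ∈ I.selfAdjointPart := ⟨hx, I.star_mem_of_mem hx⟩

/-- The whole algebra, as a closed ideal. -/
def ClosedIdeal.wholeIdeal (A : Type u) [NonUnitalCStarAlgebra A] : ClosedIdeal A where
  toSubmodule := ⊤
  mul_mem_left' _ _ _ := trivial
  mul_mem_right' _ _ _ := trivial
  isClosed' := isClosed_univ

/-- A closed ideal contains an approximate unit of self-adjoint contractions for itself. -/
theorem ClosedIdeal.exists_approxUnit (I : ClosedIdeal A) :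
    ∃ l : Filter A, l.NeBot ∧ (∀ᶠ e in l, e ∈ I ∧ star e = e ∧ ‖e‖ ≤ 1) ∧
      ∀ x ∈ I, Tendsto (fun e => x * e) l (𝓝 x) ∧ Tendsto (fun e => e * x) l (𝓝 x) := by
  obtain ⟨l, hl, h1, h2⟩ := I.exists_approximateUnit
  exact ⟨l, hl, h1.mono fun e he => ⟨he.1, he.2.1, he.2.2.1⟩,
    fun x hx => h2 x (ClosedIdeal.selfAdjointPart_mem hx)⟩

variable (A) in
theorem exists_approxUnit :
    ∃ l : Filter A, l.NeBot ∧ (∀ᶠ e in l, star e = e ∧ ‖e‖ ≤ 1) ∧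
      ∀ x, Tendsto (fun e => x * e) l (𝓝 x) ∧ Tendsto (fun e => e * x) l (𝓝 x) := by
  obtain ⟨l, hl, h1, h2⟩ := (ClosedIdeal.wholeIdeal A).exists_approxUnit
  exact ⟨l, hl, h1.mono fun e he => he.2, fun x => h2 x trivial⟩

/-- Sandwiching with an approximate unit of contractions. -/
theorem tendsto_sandwich {l : Filter A} (he : ∀ᶠ e in l, ‖e‖ ≤ 1) {x : A}
    (h1 : Tendsto (fun e => x * e) l (𝓝 x)) (h2 : Tendsto (fun e => e * x) l (𝓝 x)) :
    Tendsto (fun e => e * x * e) l (𝓝 x) := by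
  have h5 : Tendsto (fun e => e * (x * e - x)) l (𝓝 0) := by
    refine squeeze_zero_norm' ?_ (tendsto_iff_norm_sub_tendsto_zero.1 h1)
    filter_upwards [he] with e h
    calc ‖e * (x * e - x)‖ ≤ ‖e‖ * ‖x * e - x‖ := norm_mul_le _ _
      _ ≤ 1 * ‖x * e - x‖ := by gcongr
      _ = _ := one_mul _
  have h6 := h5.add h2
  rw [zero_add] at h6
  refine h6.congr fun e => ?_
  noncomm_ring

end MinimalMod

/-! ### Hereditary subalgebras -/

section Hereditary

variable {A : Type u} [NonUnitalCStarAlgebra A]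

/-- If `B` is a closed `⋆`-subalgebra with `B A B ⊆ B` and some quotient of `B` contains a minimal
open projection, then so does some quotient of `A`. For an ideal `I` of `B`, the set `N` of those
`x` with `B A x A B ⊆ I` is an ideal of `A` that meets `B` exactly in `I`. -/
theorem not_isNowhereScattered_of_corner (B : NonUnitalStarSubalgebra ℂ A)
    [hB : IsClosed (B : Set A)] (hBAB : ∀ b ∈ B, ∀ c ∈ B, ∀ a, b * a * c ∈ B)
    (h : ¬ IsNowhereScattered B) : ¬ IsNowhereScattered A := by
  obtain ⟨I, p, hp⟩ := not_isNowhereScattered_iff.1 h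
  let S : Set A := Subtype.val '' (I : Set B)
  have hS : IsClosed S := hB.isClosedEmbedding_subtypeVal.isClosedMap _ (ClosedIdeal.isClosed_coe I)
  have hS0 : (0 : A) ∈ S := ⟨0, zero_mem I, rfl⟩
  have hSadd : ∀ x ∈ S, ∀ y ∈ S, x + y ∈ S := by
    rintro _ ⟨x, hx, rfl⟩ _ ⟨y, hy, rfl⟩
    exact ⟨x + y, add_mem hx hy, rfl⟩
  have hSsmul : ∀ c : ℂ, ∀ x ∈ S, c • x ∈ S := by
    rintro c _ ⟨x, hx, rfl⟩
    exact ⟨c • x, SMulMemClass.smul_mem c hx, rfl⟩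
  let N : ClosedIdeal A :=
    { carrier := {x | ∀ b c : B, ∀ y z : A, (b : A) * y * x * z * c ∈ S}
      add_mem' := fun {x x'} hx hx' b c y z => by
        simpa [mul_add, add_mul] using hSadd _ (hx b c y z) _ (hx' b c y z)
      zero_mem' := fun b c y z => by simpa using hS0
      smul_mem' := fun k x hx b c y z => by
        simpa [mul_smul_comm, smul_mul_assoc] using hSsmul k _ (hx b c y z)
      mul_mem_left' := fun a x hx b c y z => by
        simpa [mul_assoc] using hx b c (y * a) z
      mul_mem_right' := fun a x hx b c y z => by
        simpa [mul_assoc] using hx b c y (a * z)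
      isClosed' := by
        have : {x : A | ∀ b c : B, ∀ y z : A, (b : A) * y * x * z * c ∈ S}
            = ⋂ (b : B) (c : B) (y : A) (z : A), (fun x => (b : A) * y * x * z * c) ⁻¹' S := by
          ext; simp
        rw [this]
        refine isClosed_iInter fun b => isClosed_iInter fun c => isClosed_iInter fun y =>
          isClosed_iInter fun z => hS.preimage (by fun_prop) }
  have hIN : ∀ x ∈ I, (x : A) ∈ N := by
    intro x hx b c y z
    obtain ⟨l, hl, he, ht⟩ := I.exists_approxUnit
    have h1 := tendsto_sandwich (he.mono fun e h => h.2.2) (ht x hx).1 (ht x hx).2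
    have h2 : Tendsto (fun e : B => (b : A) * y * (e * x * e : B) * z * c) l
        (𝓝 ((b : A) * y * x * z * c)) :=
      ((by fun_prop : Continuous fun w : B => (b : A) * y * (w : A) * z * c).tendsto x).comp h1
    refine hS.mem_of_tendsto h2 (.of_forall fun e => ?_)
    refine ⟨⟨b * y * e, hBAB _ b.2 _ e.2 y⟩ * x * ⟨e * z * c, hBAB _ e.2 _ c.2 z⟩,
      I.mul_mem_right _ (I.mul_mem_left _ hx), ?_⟩
    simp [mul_assoc]
  have hNI : ∀ x : B, (x : A) ∈ N → x ∈ I := by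
    intro x hx
    obtain ⟨l, hl, he, ht⟩ := exists_approxUnit B
    have hn : ∀ᶠ e in l, ‖e‖ ≤ 1 := he.mono fun e h => h.2
    have h1 := tendsto_sandwich hn (ht x).1 (ht x).2
    have h2 : Tendsto (fun e : B => e * (e * x * e) * e) l (𝓝 x) := by
      have h3 : Tendsto (fun e : B => e * (e * x * e - x) * e) l (𝓝 0) := by
        refine squeeze_zero_norm' ?_ (tendsto_iff_norm_sub_tendsto_zero.1 h1)
        filter_upwards [hn] with e h
        calc ‖e * (e * x * e - x) * e‖ ≤ ‖e‖ * ‖e * x * e - x‖ * ‖e‖ := norm_mul₃_le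
          _ ≤ 1 * ‖e * x * e - x‖ * 1 := by gcongr
          _ = _ := by ring
      have h4 := h3.add h1
      rw [zero_add] at h4
      refine h4.congr fun e => ?_
      noncomm_ring
    refine (ClosedIdeal.isClosed_coe I).mem_of_tendsto h2 (.of_forall fun e => ?_)
    obtain ⟨w, hw, hwe⟩ := hx e e (e : A) (e : A)
    have : e * (e * x * e) * e = w := Subtype.ext (by rw [hwe]; simp [mul_assoc])
    rw [this]
    exact hw
  refine not_isNowhereScattered_iff.2 ⟨N, p, fun h => hp.notMem (hNI p h), hIN _ hp.mul_self,
    hIN _ hp.star_self, fun a => ?_⟩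
  obtain ⟨c, hc⟩ := hp.corner ⟨p * a * p, hBAB _ p.2 _ p.2 a⟩
  refine ⟨c, ?_⟩
  have h1 : (p : A) * (p * a * p) * p - c • (p : A) ∈ N := hIN _ hc
  have h2 : (p : A) * p - p ∈ N := hIN _ hp.mul_self
  have h3 : (p : A) * a * p - c • (p : A) = ((p : A) * (p * a * p) * p - c • (p : A))
      - (((p : A) * p - p) * (a * p * p) + p * a * ((p : A) * p - p)) := by
    noncomm_ring
  rw [h3]
  exact sub_mem h1 (add_mem (N.mul_mem_right _ h2) (N.mul_mem_left _ h2))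

theorem isPositiveElement_iff [PartialOrder A] [StarOrderedRing A] {a : A} :
    IsPositiveElement a ↔ 0 ≤ a :=
  CStarAlgebra.nonneg_iff_eq_star_mul_self.symm

/-- Order-hereditary subalgebras satisfy `B A B ⊆ B`. -/
theorem IsHereditary.mul_mul_mem {B : NonUnitalStarSubalgebra ℂ A} (hB : IsHereditary B)
    {b c : A} (hb : b ∈ B) (hc : c ∈ B) (a : A) : b * a * c ∈ B := by
  let := CStarAlgebra.spectralOrder A
  have := CStarAlgebra.spectralOrderedRing A
  have hpos : ∀ c ∈ B, ∀ a : A, 0 ≤ a → star c * a * c ∈ B := by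
    intro c hc a ha
    refine hB.2 _ (‖a‖ • (star c * c)) ?_ ?_ ?_
    · exact isPositiveElement_iff.2 (star_left_conjugate_nonneg ha c)
    · rw [isPositiveElement_iff, sub_nonneg]
      exact CStarAlgebra.star_left_conjugate_le_norm_smul
    · rw [← Complex.coe_smul]
      exact SMulMemClass.smul_mem _ (mul_mem (star_mem hc) hc)
  have hdiag : ∀ c ∈ B, ∀ a : A, star c * a * c ∈ B := by
    intro c hc a
    obtain ⟨y, hy, -, h⟩ := CStarAlgebra.exists_sum_four_nonneg a
    rw [h, Finset.mul_sum, Finset.sum_mul]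
    refine sum_mem fun i _ => ?_
    rw [mul_smul_comm, smul_mul_assoc]
    exact SMulMemClass.smul_mem _ (hpos c hc _ (hy i))
  -- polarisation
  have h1 := hdiag (star b + c) (add_mem (star_mem hb) hc) a
  have h2 := hdiag (star b + Complex.I • c)
    (add_mem (star_mem hb) (SMulMemClass.smul_mem _ hc)) a
  have h3 := hdiag (star b) (star_mem hb) a
  have h4 := hdiag c hc a
  have h5 : star (star b + c) * a * (star b + c) - Complex.I • (star (star b + Complex.I • c) * a *
      (star b + Complex.I • c)) - (1 - Complex.I) • (star (star b) * a * star b)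
      - (1 - Complex.I) • (star c * a * c) ∈ B :=
    sub_mem (sub_mem (sub_mem h1 (SMulMemClass.smul_mem _ h2)) (SMulMemClass.smul_mem _ h3))
      (SMulMemClass.smul_mem _ h4)
  have h6 : star (star b + c) * a * (star b + c) - Complex.I • (star (star b + Complex.I • c) * a *
      (star b + Complex.I • c)) - (1 - Complex.I) • (star (star b) * a * star b)
      - (1 - Complex.I) • (star c * a * c) = (2 : ℂ) • (b * a * c) := by
    simp only [star_add, star_star, star_smul, mul_add, add_mul, smul_mul_assoc, mul_smul_comm,
      smul_add, smul_smul, sub_smul, one_smul, Complex.star_def, Complex.conj_I, neg_smul, smul_neg,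
      Complex.I_mul_I, neg_mul, neg_neg, two_smul]
    abel
  rw [h6] at h5
  have h7 := SMulMemClass.smul_mem (2⁻¹ : ℂ) h5
  rwa [smul_smul, inv_mul_cancel₀ two_ne_zero, one_smul] at h7

end Hereditary

/-! ### Corners and abelian elements -/

section Corner

variable {A : Type u} [NonUnitalCStarAlgebra A]

/-- The hereditary subalgebra `closure (b A b)` attached to a self-adjoint element `b`. -/
def cornerSubalgebra (b : A) (hb : star b = b) : NonUnitalStarSubalgebra ℂ A :=
  NonUnitalStarSubalgebra.topologicalClosure
    { carrier := Set.range fun z : A => b * z * b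
      add_mem' := by
        rintro _ _ ⟨z, rfl⟩ ⟨w, rfl⟩
        exact ⟨z + w, by simp [mul_add, add_mul]⟩
      zero_mem' := ⟨0, by simp⟩
      mul_mem' := by
        rintro _ _ ⟨z, rfl⟩ ⟨w, rfl⟩
        exact ⟨z * b * b * w, by simp [mul_assoc]⟩
      smul_mem' := by
        rintro c _ ⟨z, rfl⟩
        exact ⟨c • z, by simp [mul_smul_comm, smul_mul_assoc]⟩
      star_mem' := by
        rintro _ ⟨z, rfl⟩
        exact ⟨star z, by simp [hb, mul_assoc]⟩ }

theorem isClosed_cornerSubalgebra (b : A) (hb : star b = b) :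
    IsClosed (cornerSubalgebra b hb : Set A) :=
  NonUnitalStarSubalgebra.isClosed_topologicalClosure _

theorem mul_mul_mem_cornerSubalgebra (b : A) (hb : star b = b) (z : A) :
    b * z * b ∈ cornerSubalgebra b hb := subset_closure ⟨z, rfl⟩

/-- A closed condition that holds on `b A b` holds on `cornerSubalgebra b`. -/
theorem cornerSubalgebra_induction {b : A} {hb : star b = b} {P : A → Prop}
    (hP : IsClosed {x | P x}) (h : ∀ z, P (b * z * b)) {x : A} (hx : x ∈ cornerSubalgebra b hb) :
    P x :=
  closure_minimal (s := Set.range fun z : A => b * z * b) (by rintro _ ⟨z, rfl⟩; exact h z) hP hx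

theorem mul_mul_mem_of_mem_cornerSubalgebra {b : A} (hb : star b = b) {x y : A}
    (hx : x ∈ cornerSubalgebra b hb) (hy : y ∈ cornerSubalgebra b hb) (a : A) :
    x * a * y ∈ cornerSubalgebra b hb := by
  have hc := isClosed_cornerSubalgebra b hb
  refine cornerSubalgebra_induction (P := fun x => x * a * y ∈ cornerSubalgebra b hb)
    (hc.preimage (by fun_prop)) (fun z => ?_) hx
  refine cornerSubalgebra_induction
    (P := fun y => b * z * b * a * y ∈ cornerSubalgebra b hb)
    (hc.preimage (by fun_prop)) (fun w => ?_) hy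
  have : b * z * b * a * (b * w * b) = b * (z * b * a * b * w) * b := by simp only [mul_assoc]
  rw [this]
  exact mul_mul_mem_cornerSubalgebra b hb _

theorem IsPositiveElement.star_eq {a : A} (ha : IsPositiveElement a) : star a = a := by
  obtain ⟨b, rfl⟩ := ha
  simp

/-- Commutativity of `closure (a A a)` can be tested on `a A a`. -/
theorem isAbelianElement_iff {a : A} :
    IsAbelianElement a ↔ IsPositiveElement a ∧
      ∀ z w : A, (a * z * a) * (a * w * a) = (a * w * a) * (a * z * a) := by
  refine and_congr_right fun ha => ⟨fun h z w => h _ (subset_closure ⟨z, rfl⟩) _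
    (subset_closure ⟨w, rfl⟩), fun h x hx y hy => ?_⟩
  refine cornerSubalgebra_induction (hb := ha.star_eq) (P := fun x => x * y = y * x)
    (isClosed_eq (by fun_prop) (by fun_prop)) (fun z => ?_) hx
  exact cornerSubalgebra_induction (hb := ha.star_eq)
    (P := fun y => a * z * a * y = y * (a * z * a))
    (isClosed_eq (by fun_prop) (by fun_prop)) (fun w => h z w) hy

theorem IsMinimalOpenProjection.isAbelianElement {p : A} (hp : IsMinimalOpenProjection p) :
    IsAbelianElement p := by
  obtain ⟨-, hpp, hps, h⟩ := isMinimalOpenProjection_iff.1 hp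
  refine isAbelianElement_iff.2 ⟨⟨p, by rw [hps, hpp]⟩, fun z w => ?_⟩
  obtain ⟨c, hc⟩ := h z
  obtain ⟨d, hd⟩ := h w
  simp only [hc, hd, smul_mul_smul_comm, mul_comm c d]

/-- A nonzero commutative C⋆-algebra has a character. -/
theorem exists_character {C : Type u} [NonUnitalCommCStarAlgebra C] [Nontrivial C] :
    ∃ χ : C →⋆ₙₐ[ℂ] ℂ, χ ≠ 0 := by
  obtain ⟨a, ha⟩ := exists_ne (0 : C)
  have ha' : (Unitization.inr (star a * a) : Unitization ℂ C) ≠ 0 := by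
    intro h
    exact ha (CStarRing.star_mul_self_eq_zero_iff a |>.1 (Unitization.inr_injective h))
  have hne : WeakDual.gelfandTransform ℂ (Unitization ℂ C) (Unitization.inr (star a * a)) ≠ 0 := by
    intro h
    exact ha' ((gelfandTransform_isometry (Unitization ℂ C)).injective
      (by rw [h, map_zero]))
  obtain ⟨φ, hφ⟩ : ∃ φ : WeakDual.characterSpace ℂ (Unitization ℂ C),
      φ (Unitization.inr (star a * a)) ≠ 0 := by
    by_contra! h
    exact hne (ContinuousMap.ext h)
  refine ⟨(NonUnitalStarAlgHomClass.toNonUnitalStarAlgHom φ).comp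
    (Unitization.inrNonUnitalStarAlgHom ℂ C), fun h => hφ ?_⟩
  exact congrArg (fun f : C →⋆ₙₐ[ℂ] ℂ => f (star a * a)) h

theorem not_isNowhereScattered_of_character (χ : A →⋆ₙₐ[ℂ] ℂ) (hχ : χ ≠ 0) :
    ¬ IsNowhereScattered A := by
  obtain ⟨a, ha⟩ : ∃ a, χ a ≠ 0 := by
    by_contra! h
    exact hχ (NonUnitalStarAlgHom.ext h)
  refine not_isNowhereScattered_iff.2 ⟨ClosedIdeal.ker χ, (χ a)⁻¹ • a, ?_⟩
  have h1 : χ ((χ a)⁻¹ • a) = 1 := by rw [map_smul, smul_eq_mul, inv_mul_cancel₀ ha]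
  generalize (χ a)⁻¹ • a = p at h1
  refine ⟨fun h => ?_, ?_, ?_, fun z => ⟨χ z, ?_⟩⟩
  · rw [ClosedIdeal.mem_ker, h1] at h
    exact one_ne_zero h
  · simp [ClosedIdeal.mem_ker, h1]
  · simp [ClosedIdeal.mem_ker, h1, map_star]
  · simp [ClosedIdeal.mem_ker, h1]

/-- A nonzero abelian element of `A` gives a minimal open projection in a quotient of `A`. -/
theorem not_isNowhereScattered_of_isAbelianElement {a : A} (ha : IsAbelianElement a)
    (h0 : a ≠ 0) : ¬ IsNowhereScattered A := by
  have hs := ha.1.star_eq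
  have hcl := isClosed_cornerSubalgebra a hs
  refine not_isNowhereScattered_of_corner (cornerSubalgebra a hs)
    (fun b hb c hc z => mul_mul_mem_of_mem_cornerSubalgebra hs hb hc z) ?_
  let : NonUnitalCommCStarAlgebra (cornerSubalgebra a hs) :=
    { NonUnitalStarSubalgebra.nonUnitalCStarAlgebra (cornerSubalgebra a hs) with
      mul_comm := fun x y => Subtype.ext (ha.2 x x.2 y y.2) }
  have : Nontrivial (cornerSubalgebra a hs) := by
    refine ⟨⟨⟨a * (a * a) * a, mul_mul_mem_cornerSubalgebra a hs _⟩, 0, fun h => h0 ?_⟩⟩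
    have h1 : a * (a * a) * a = 0 := congrArg Subtype.val h
    have h2 : star (a * a) * (a * a) = 0 := by
      rw [star_mul, hs, ← h1]
      simp only [mul_assoc]
    rw [CStarRing.star_mul_self_eq_zero_iff] at h2
    rw [← CStarRing.star_mul_self_eq_zero_iff, hs, h2]
  obtain ⟨χ, hχ⟩ := exists_character (C := cornerSubalgebra a hs)
  exact not_isNowhereScattered_of_character χ hχ

/-! ### Splitting elements when there is no minimal projection -/

/-- If there is no minimal projection, every corner contains a self-adjoint element whose nonzero
spectrum is not a single point. -/
theorem exists_mul_self_ne_smul (hA : ∀ p : A, ¬ IsMinimalOpenProjection p) {b : A}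
    (hb : star b = b) (h0 : b ≠ 0) :
    ∃ z : A, star z = z ∧
      ∀ ν : ℝ, (b * z * b) * (b * z * b) ≠ ν • (b * z * b) := by
  by_contra! H
  have h2 : b * b ≠ 0 := fun h =>
    h0 (by rwa [← CStarRing.star_mul_self_eq_zero_iff, hb])
  have h4 : (b * b) * (b * b) ≠ 0 := fun h =>
    h2 (by rwa [← CStarRing.star_mul_self_eq_zero_iff, star_mul, hb])
  obtain ⟨ν, hν⟩ := H (b * b) (by rw [star_mul, hb])
  have hc0 : star (b * (b * b) * b) * (b * (b * b) * b) ≠ 0 := fun h => by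
    rw [CStarRing.star_mul_self_eq_zero_iff] at h
    exact h4 (by rw [← h]; simp only [mul_assoc])
  have hcs : star (b * (b * b) * b) = b * (b * b) * b := by simp [hb, mul_assoc]
  rw [hcs, hν] at hc0
  have hν0 : ν ≠ 0 := fun h => hc0 (by rw [h, zero_smul])
  obtain ⟨q, hq⟩ : ∃ q, q = ν⁻¹ • (b * (b * b) * b) := ⟨_, rfl⟩
  have hq0 : q ≠ 0 := fun h => by
    rw [h] at hq
    exact hc0 (by rw [(smul_eq_zero.1 hq.symm).resolve_left (inv_ne_zero hν0), smul_zero])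
  have hqs : star q = q := by rw [hq, star_smul, hcs, star_trivial]
  have hqq : q * q = q := by
    rw [hq, smul_mul_smul_comm, hν, smul_smul, mul_assoc, inv_mul_cancel₀ hν0, mul_one]
  have hqb : ∀ d : A, star d = d → ∃ z, star z = z ∧ q * d * q = b * z * b := fun d hd =>
    ⟨(ν⁻¹ * ν⁻¹) • ((b * b * b) * d * (b * b * b)), by simp [hb, hd, mul_assoc], by
      simp only [hq, smul_mul_assoc, mul_smul_comm, smul_smul, mul_assoc]⟩
  have Hq : ∀ d : A, star d = d → ∃ ν : ℝ, (q * d * q) * (q * d * q) = ν • (q * d * q) := by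
    intro d hd
    obtain ⟨z, hz, hzd⟩ := hqb d hd
    rw [hzd]
    exact H z hz
  -- with `c = q d q`, the elements `c`, `q + c` and `q + 2 c` all have the same property
  have key : ∀ d : A, star d = d → ∃ t : ℝ, q * d * q = t • q := by
    intro d hd
    obtain ⟨c, hc⟩ : ∃ c, c = q * d * q := ⟨_, rfl⟩
    have hqc : q * c = c := by rw [hc, ← mul_assoc, ← mul_assoc, hqq]
    have hcq : c * q = c := by rw [hc, mul_assoc, hqq]
    have hcst : star c = c := by rw [hc]; simp [hqs, hd, mul_assoc]
    obtain ⟨ν₁, h1⟩ := Hq c hcst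
    obtain ⟨ν₂, h2⟩ := Hq (q + c) (by rw [star_add, hqs, hcst])
    obtain ⟨ν₃, h3⟩ := Hq (q + (2 : ℝ) • c)
      (by rw [star_add, star_smul, hqs, hcst, star_trivial])
    simp only [mul_add, add_mul, mul_smul_comm, smul_mul_assoc, hqq, hqc, hcq] at h1 h2 h3
    rw [h1] at h2 h3
    rw [← hc]
    by_cases hne : 2 + ν₁ - ν₂ = 0
    · by_cases hν₂ : ν₂ = 1
      · have hν₁ : ν₁ = -1 := by linarith
        rw [hν₁] at h3
        have h5 : (1 - ν₃) • q = (2 * ν₃) • c := by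
          rw [← sub_eq_zero] at h3 ⊢
          rw [← h3]
          module
        by_cases h3' : ν₃ = 0
        · rw [h3'] at h5
          exact absurd (by simpa using h5) hq0
        · exact ⟨(2 * ν₃)⁻¹ * (1 - ν₃), by
            rw [mul_smul, h5, smul_smul, inv_mul_cancel₀ (by simpa using h3'), one_smul]⟩
      · have h5 : (1 - ν₂) • q = 0 := by
          have h6 : (1 - ν₂) • q = -(2 + ν₁ - ν₂) • c := by
            rw [← sub_eq_zero] at h2 ⊢
            rw [← h2]
            module
          rw [h6, hne, neg_zero, zero_smul]
        exact absurd ((smul_eq_zero.1 h5).resolve_left (sub_ne_zero.2 (Ne.symm hν₂))) hq0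
    · have h6 : (2 + ν₁ - ν₂) • c = (ν₂ - 1) • q := by
        rw [← sub_eq_zero] at h2 ⊢
        rw [← h2]
        module
      exact ⟨(2 + ν₁ - ν₂)⁻¹ * (ν₂ - 1), by
        rw [mul_smul, ← h6, smul_smul, inv_mul_cancel₀ hne, one_smul]⟩
  refine hA q (isMinimalOpenProjection_iff.2 ⟨hq0, hqq, hqs, fun a => ?_⟩)
  obtain ⟨s, hs⟩ := key (realPart a) (realPart a).2
  obtain ⟨t, ht⟩ := key (imaginaryPart a) (imaginaryPart a).2
  refine ⟨s + t * Complex.I, ?_⟩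
  conv_lhs => rw [← realPart_add_I_smul_imaginaryPart a]
  rw [mul_add, add_mul, mul_smul_comm, smul_mul_assoc, hs, ht, add_smul, mul_comm, mul_smul,
    Complex.coe_smul, Complex.coe_smul]

/-- The continuous tent function of height `1` around `x₀` with half-width `δ`. -/
noncomputable def tent (x₀ δ x : ℝ) : ℝ := max 0 (1 - |x - x₀| / δ)

/-- The plateau function equal to `1` within distance `δ` of `x₀` and to `0` beyond `2 δ`. -/
noncomputable def plateau (x₀ δ x : ℝ) : ℝ := min 1 (max 0 (2 - |x - x₀| / δ))

theorem continuous_tent (x₀ δ : ℝ) : Continuous (tent x₀ δ) := by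
  unfold tent; fun_prop

theorem continuous_plateau (x₀ δ : ℝ) : Continuous (plateau x₀ δ) := by
  unfold plateau; fun_prop

theorem tent_self (x₀ δ : ℝ) : tent x₀ δ x₀ = 1 := by simp [tent]

theorem tent_nonneg (x₀ δ x : ℝ) : 0 ≤ tent x₀ δ x := le_max_left _ _

theorem tent_le_one (x₀ x : ℝ) {δ : ℝ} (hδ : 0 < δ) : tent x₀ δ x ≤ 1 :=
  max_le zero_le_one (by have : 0 ≤ |x - x₀| / δ := by positivity
                         linarith)

theorem tent_eq_zero {x₀ δ x : ℝ} (hδ : 0 < δ) (h : δ ≤ |x - x₀|) : tent x₀ δ x = 0 :=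
  max_eq_left (by have := (one_le_div hδ).2 h
                  linarith)

theorem plateau_eq_one {x₀ δ x : ℝ} (hδ : 0 < δ) (h : |x - x₀| ≤ δ) : plateau x₀ δ x = 1 := by
  have h1 := (div_le_one hδ).2 h
  exact min_eq_left (le_max_of_le_right (by linarith))

theorem plateau_eq_zero {x₀ δ x : ℝ} (hδ : 0 < δ) (h : 2 * δ ≤ |x - x₀|) :
    plateau x₀ δ x = 0 := by
  have h1 := (le_div_iff₀ hδ).2 h
  unfold plateau
  rw [max_eq_left (by linarith)]
  simp

theorem abs_plateau_le (x₀ δ x : ℝ) : |plateau x₀ δ x| ≤ 1 := by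
  rw [abs_of_nonneg (le_min zero_le_one (le_max_left _ _))]
  exact min_le_left _ _

theorem plateau_mul_tent {x₀ δ : ℝ} (hδ : 0 < δ) (x : ℝ) :
    plateau x₀ δ x * tent x₀ δ x = tent x₀ δ x := by
  rcases le_total δ |x - x₀| with h | h
  · rw [tent_eq_zero hδ h, mul_zero]
  · rw [plateau_eq_one hδ h, one_mul]

theorem plateau_mul_tent_eq_zero {x₀ y₀ δ : ℝ} (hδ : 0 < δ) (h : 3 * δ ≤ |x₀ - y₀|) (x : ℝ) :
    plateau x₀ δ x * tent y₀ δ x = 0 := by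
  rcases le_total δ |x - y₀| with h1 | h1
  · rw [tent_eq_zero hδ h1, mul_zero]
  · rw [plateau_eq_zero hδ, zero_mul]
    have := abs_sub_le x₀ x y₀
    rw [abs_sub_comm x₀ x] at this
    linarith

theorem tent_zero {x₀ δ : ℝ} (hδ : 0 < δ) (h : δ ≤ |x₀|) : tent x₀ δ 0 = 0 :=
  tent_eq_zero hδ (by simpa using h)

theorem plateau_zero {x₀ δ : ℝ} (hδ : 0 < δ) (h : 2 * δ ≤ |x₀|) : plateau x₀ δ 0 = 0 :=
  plateau_eq_zero hδ (by simpa using h)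

theorem norm_cfcₙ_tent {c : A} (hc : IsSelfAdjoint c) {x₀ δ : ℝ} (hδ : 0 < δ) (h : δ ≤ |x₀|)
    (hx : x₀ ∈ quasispectrum ℝ c) : ‖cfcₙ (tent x₀ δ) c‖ = 1 := by
  have hf0 := tent_zero hδ h
  have hcont := (continuous_tent x₀ δ).continuousOn (s := quasispectrum ℝ c)
  refine le_antisymm (norm_cfcₙ_le fun x _ => ?_) ?_
  · rw [Real.norm_of_nonneg (tent_nonneg _ _ _)]
    exact tent_le_one _ _ hδ
  · have := norm_apply_le_norm_cfcₙ (tent x₀ δ) c hx hcont hf0 hc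
    rwa [tent_self, norm_one] at this

theorem isPositiveElement_cfcₙ_tent (c : A) (x₀ δ : ℝ) :
    IsPositiveElement (cfcₙ (tent x₀ δ) c) := by
  let := CStarAlgebra.spectralOrder A
  have := CStarAlgebra.spectralOrderedRing A
  exact isPositiveElement_iff.2 (cfcₙ_nonneg fun x _ => tent_nonneg _ _ _)

/-- If there is no minimal projection, every corner `closure (b A b)` contains two orthogonal
positive elements of norm one, separated by a self-adjoint contraction of that corner. -/
theorem exists_orthogonal_pair (hA : ∀ p : A, ¬ IsMinimalOpenProjection p) {b : A}
    (hb : star b = b) (h0 : b ≠ 0) :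
    ∃ x ∈ cornerSubalgebra b hb, ∃ y ∈ cornerSubalgebra b hb, ∃ h ∈ cornerSubalgebra b hb,
      IsPositiveElement x ∧ IsPositiveElement y ∧ ‖x‖ = 1 ∧ ‖y‖ = 1 ∧
        star h = h ∧ ‖h‖ ≤ 1 ∧ h * x = x ∧ h * y = 0 := by
  obtain ⟨z, hz, hν⟩ := exists_mul_self_ne_smul hA hb h0
  obtain ⟨c, hc⟩ : ∃ c, c = b * z * b := ⟨_, rfl⟩
  rw [← hc] at hν
  have hcs : IsSelfAdjoint c := by
    rw [IsSelfAdjoint, hc]; simp [hb, hz, mul_assoc]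
  have hcmem : c ∈ cornerSubalgebra b hb := hc ▸ mul_mul_mem_cornerSubalgebra b hb z
  obtain ⟨r, hr, s, hs, hr0, hs0, hrs⟩ : ∃ r ∈ quasispectrum ℝ c, ∃ s ∈ quasispectrum ℝ c,
      r ≠ 0 ∧ s ≠ 0 ∧ r ≠ s := by
    by_contra! H
    obtain ⟨ν, hν'⟩ : ∃ ν : ℝ, ∀ x ∈ quasispectrum ℝ c, x * x = ν * x := by
      by_cases h : ∃ x ∈ quasispectrum ℝ c, x ≠ 0
      · obtain ⟨x, hx, hx0⟩ := h
        refine ⟨x, fun y hy => ?_⟩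
        by_cases hy0 : y = 0
        · simp [hy0]
        · rw [H x hx y hy hx0 hy0]
      · push Not at h
        exact ⟨0, fun y hy => by simp [h y hy]⟩
    refine hν ν ?_
    have h1 : cfcₙ (fun x : ℝ => x * x) c = c * c := by
      rw [cfcₙ_mul (fun x : ℝ => x) (fun x : ℝ => x) c, cfcₙ_id' ℝ c]
    rw [← h1, ← cfcₙ_const_mul_id ν c]
    exact cfcₙ_congr hν'
  obtain ⟨δ, hδ, h1, h2, h3⟩ : ∃ δ : ℝ, 0 < δ ∧ 2 * δ ≤ |r| ∧ δ ≤ |s| ∧ 3 * δ ≤ |r - s| := by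
    refine ⟨min (|r| / 2) (min |s| (|r - s| / 3)), ?_, ?_, ?_, ?_⟩
    · have := abs_pos.2 hr0
      have := abs_pos.2 hs0
      have := abs_pos.2 (sub_ne_zero.2 hrs)
      simp only [lt_min_iff]
      exact ⟨by linarith, by linarith, by linarith⟩
    · have := min_le_left (|r| / 2) (min |s| (|r - s| / 3))
      linarith
    · exact (min_le_right _ _).trans (min_le_left _ _)
    · have := (min_le_right (|r| / 2) (min |s| (|r - s| / 3))).trans (min_le_right _ _)
      linarith
  have hrδ : δ ≤ |r| := by linarith
  have hcl := isClosed_cornerSubalgebra b hb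
  have hct := fun x₀ => (continuous_tent x₀ δ).continuousOn (s := quasispectrum ℝ c)
  have hcp := fun x₀ => (continuous_plateau x₀ δ).continuousOn (s := quasispectrum ℝ c)
  refine ⟨cfcₙ (tent r δ) c, cfcₙ_mem _ hcmem, cfcₙ (tent s δ) c, cfcₙ_mem _ hcmem,
    cfcₙ (plateau r δ) c, cfcₙ_mem _ hcmem, isPositiveElement_cfcₙ_tent _ _ _, isPositiveElement_cfcₙ_tent _ _ _,
    norm_cfcₙ_tent hcs hδ hrδ hr, norm_cfcₙ_tent hcs hδ h2 hs,
    cfcₙ_predicate (p := IsSelfAdjoint) (plateau r δ) c,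
    norm_cfcₙ_le fun x _ => abs_plateau_le _ _ _, ?_, ?_⟩
  · rw [← cfcₙ_mul _ _ c (hcp r) (plateau_zero hδ h1) (hct r) (tent_zero hδ hrδ)]
    exact cfcₙ_congr fun x _ => plateau_mul_tent hδ x
  · rw [← cfcₙ_mul _ _ c (hcp r) (plateau_zero hδ h1) (hct s) (tent_zero hδ h2)]
    rw [← cfcₙ_const_zero ℝ c]
    exact cfcₙ_congr fun x _ => plateau_mul_tent_eq_zero hδ h3 x

end Corner

/-! ### Compact operators in the image of a representation -/

section Compact

/-- The eigenspace of a compact operator for the eigenvalue `1` is finite-dimensional. -/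
theorem finiteDimensional_of_isCompactOperator {H : Type*} [NormedAddCommGroup H]
    [InnerProductSpace ℂ H] {K : H →L[ℂ] H} (hK : IsCompactOperator K)
    {V : Submodule ℂ H} (hV : ∀ v ∈ V, K v = v) : FiniteDimensional ℂ V := by
  have hle : V ≤ LinearMap.ker ((K : H →ₗ[ℂ] H) - LinearMap.id) := fun v hv => by
    simp [hV v hv]
  suffices FiniteDimensional ℂ (LinearMap.ker ((K : H →ₗ[ℂ] H) - LinearMap.id)) from
    Submodule.finiteDimensional_of_le hle
  set W := LinearMap.ker ((K : H →ₗ[ℂ] H) - LinearMap.id)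
  have hW : ∀ v ∈ W, K v = v := fun v hv => by
    simpa [W, sub_eq_zero] using hv
  have hWc : IsClosed (W : Set H) := by
    have : (W : Set H) = {v | K v = v} := by
      ext v
      simp [W, sub_eq_zero]
    rw [this]
    exact isClosed_eq K.continuous continuous_id
  refine FiniteDimensional.of_isCompactOperator_id (𝕜 := ℂ) ?_
  have hK' : IsCompactOperator (K : H →ₗ[ℂ] H) := hK
  have h := hK'.restrict (V := W) (fun v hv => by
    change K v ∈ W
    rwa [hW v hv]) hWc
  have hid : (id : W → W) = (K : H →ₗ[ℂ] H).restrict (p := W) (q := W) (fun v hv => by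
      change K v ∈ W
      rwa [hW v hv]) := funext fun v => Subtype.ext (hW v v.2).symm
  rw [hid]
  exact h

variable {D : Type u} [NonUnitalCStarAlgebra D]
  {H : Type*} [NormedAddCommGroup H] [InnerProductSpace ℂ H] [CompleteSpace H]

/-- If the image of some `a ≠ 0` is compact, some self-adjoint `b ≠ 0` has an image of finite
rank. -/
theorem exists_finiteRank_of_compact (π : D →⋆ₙₐ[ℂ] (H →L[ℂ] H)) {a : D} (ha : a ≠ 0)
    (hc : IsCompactOperator (π a)) :
    ∃ b : D, star b = b ∧ b ≠ 0 ∧ FiniteDimensional ℂ (LinearMap.range (π b : H →ₗ[ℂ] H)) := by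
  obtain ⟨d, hd⟩ : ∃ d, d = star a * a := ⟨_, rfl⟩
  have hds : IsSelfAdjoint d := hd ▸ IsSelfAdjoint.star_mul_self a
  have hd0 : d ≠ 0 := fun h => ha ((CStarRing.star_mul_self_eq_zero_iff a).1 (hd ▸ h))
  have hdc : IsCompactOperator (π d) := by
    rw [hd, map_mul]
    exact hc.clm_comp _
  obtain ⟨r, hr, hr0⟩ : ∃ r ∈ quasispectrum ℝ d, r ≠ 0 := by
    by_contra! h
    exact hd0 (CFC.eq_zero_of_quasispectrum_eq_zero (R := ℝ) d h)
  have hr' := abs_pos.2 hr0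
  obtain ⟨δ, hδ⟩ : ∃ δ, δ = |r| / 4 := ⟨_, rfl⟩
  have hδ0 : 0 < δ := by linarith
  have h1 : 2 * δ ≤ |r| := by linarith
  have h2 : δ ≤ |r| := by linarith
  -- `plateau r δ x = x * l x` with `l` continuous, since the plateau vanishes near `0`
  let l : ℝ → ℝ := fun x => plateau r δ x * x / max (x ^ 2) (δ ^ 2)
  have hl : Continuous l := by
    refine ((continuous_plateau r δ).mul continuous_id).div (by fun_prop) fun x => ?_
    exact (lt_max_of_lt_right (by positivity)).ne'
  have hl0 : l 0 = 0 := by simp [l]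
  have hlx : ∀ x, x * l x = plateau r δ x := by
    intro x
    by_cases hx : 2 * δ ≤ |x - r|
    · simp [l, plateau_eq_zero hδ0 hx]
    · have h3 : δ ≤ |x| := by
        have := abs_sub_abs_le_abs_sub r x
        rw [abs_sub_comm] at this
        linarith
      have h4 : δ ^ 2 ≤ x ^ 2 := by
        rw [← sq_abs x]
        gcongr
      have h5 : x ≠ 0 := abs_pos.1 (hδ0.trans_le h3)
      simp only [l]
      rw [max_eq_left h4]
      field_simp
  refine ⟨cfcₙ (tent r δ) d, (isPositiveElement_cfcₙ_tent d r δ).star_eq, ?_, ?_⟩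
  · rw [← norm_ne_zero_iff, norm_cfcₙ_tent hds hδ0 h2 hr]
    exact one_ne_zero
  · have hk : cfcₙ (plateau r δ) d * cfcₙ (tent r δ) d = cfcₙ (tent r δ) d := by
      rw [← cfcₙ_mul _ _ d (continuous_plateau r δ).continuousOn (plateau_zero hδ0 h1)
        (continuous_tent r δ).continuousOn (tent_zero hδ0 h2)]
      exact cfcₙ_congr fun x _ => plateau_mul_tent hδ0 x
    have hkc : IsCompactOperator (π (cfcₙ (plateau r δ) d)) := by
      have : cfcₙ (plateau r δ) d = d * cfcₙ l d := by
        rw [← funext hlx, cfcₙ_mul (fun x => x) l d continuous_id.continuousOn rfl hl.continuousOn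
          hl0, cfcₙ_id' ℝ d]
      rw [this, map_mul]
      exact hdc.comp_clm _
    refine finiteDimensional_of_isCompactOperator hkc ?_
    rintro _ ⟨v, rfl⟩
    conv_rhs => rw [← hk, map_mul]
    rfl

/-- A faithful representation with a nonzero compact operator in its image forces a minimal
projection: split a nonzero finite-rank element of minimal rank. -/
theorem exists_isMinimalOpenProjection_of_compact (π : D →⋆ₙₐ[ℂ] (H →L[ℂ] H))
    (hπ : Function.Injective π) {a : D} (ha : a ≠ 0) (hc : IsCompactOperator (π a)) :
    ∃ p : D, IsMinimalOpenProjection p := by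
  by_contra! hA
  suffices h : ∀ n : ℕ, ∀ b : D, star b = b → b ≠ 0 →
      FiniteDimensional ℂ (LinearMap.range (π b : H →ₗ[ℂ] H)) →
      Module.finrank ℂ (LinearMap.range (π b : H →ₗ[ℂ] H)) = n → False by
    obtain ⟨b, hb, hb0, hf⟩ := exists_finiteRank_of_compact π ha hc
    exact h _ b hb hb0 hf rfl
  intro n
  induction n using Nat.strong_induction_on with
  | _ n ih =>
    intro b hb hb0 hf hn
    obtain ⟨x, hx, y, hy, h, -, hxp, hyp, hx1, hy1, hh, -, hhx, hhy⟩ :=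
      exists_orthogonal_pair hA hb hb0
    have hxs := hxp.star_eq
    have hys := hyp.star_eq
    have hVc : IsClosed (LinearMap.range (π b : H →ₗ[ℂ] H) : Set H) :=
      Submodule.closed_of_finiteDimensional _
    have hrange : ∀ z ∈ cornerSubalgebra b hb, ∀ v, π z v ∈ LinearMap.range (π b : H →ₗ[ℂ] H) := by
      intro z hz v
      refine cornerSubalgebra_induction
        (P := fun z => π z v ∈ LinearMap.range (π b : H →ₗ[ℂ] H)) ?_ (fun w => ?_) hz
      · refine hVc.preimage ?_
        exact (ContinuousLinearMap.apply ℂ H v).continuous.comp π.continuous_of_cstar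
      · rw [map_mul, map_mul, mul_assoc]
        exact ⟨_, rfl⟩
    have hxh : x * h = x := by rw [← hxs, ← hh, ← star_mul, hhx]
    have hxy : x * y = 0 := by rw [← hxh, mul_assoc, hhy, mul_zero]
    have hyx : y * x = 0 := by rw [← hys, ← hxs, ← star_mul, hxy, star_zero]
    have hle : LinearMap.range (π x : H →ₗ[ℂ] H) ≤ LinearMap.range (π b : H →ₗ[ℂ] H) := by
      rintro _ ⟨v, rfl⟩
      exact hrange x hx v
    have hlt : LinearMap.range (π x : H →ₗ[ℂ] H) < LinearMap.range (π b : H →ₗ[ℂ] H) := by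
      refine lt_of_le_of_ne hle fun heq => ?_
      have hyy : π (y * y) = 0 := by
        ext v
        obtain ⟨w, hw⟩ := heq.symm ▸ hrange y hy v
        have hw' : π x w = π y v := hw
        have h3 : π y (π x w) = π (y * x) w := by rw [map_mul]; rfl
        have h4 : π y (π y v) = π (y * y) v := by rw [map_mul]; rfl
        rw [← h4, ← hw', h3, hyx, map_zero]
        rfl
      have hyy' : star y * y = 0 := by
        rw [hys]
        exact hπ (by rw [hyy, map_zero])
      rw [CStarRing.star_mul_self_eq_zero_iff] at hyy'
      rw [hyy', norm_zero] at hy1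
      exact zero_ne_one hy1
    refine ih _ (hn ▸ Submodule.finrank_lt_finrank_of_lt hlt) x hxs (fun h0 => ?_)
      (Submodule.finiteDimensional_of_le hle) rfl
    rw [h0, norm_zero] at hx1
    exact zero_ne_one hx1

/-- A nonzero compact operator in the image of a representation of `A` yields a minimal open
projection in a quotient of `A`. -/
theorem not_isNowhereScattered_of_compact (π : D →⋆ₙₐ[ℂ] (H →L[ℂ] H)) {a : D} (ha : π a ≠ 0)
    (hc : IsCompactOperator (π a)) : ¬ IsNowhereScattered D := by
  obtain ⟨p, hp⟩ := exists_isMinimalOpenProjection_of_compact (ClosedIdeal.kerLift π)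
    (ClosedIdeal.kerLift_injective π) (a := (ClosedIdeal.ker π).proj a)
    (fun h => ha ((ClosedIdeal.ker π).proj_eq_zero.1 h)) hc
  exact fun h => h _ ⟨p, hp⟩

end Compact

/-! ### Finite-dimensional representations of hereditary subalgebras -/

section FiniteDimensionalRep

variable {A : Type u} [NonUnitalCStarAlgebra A]

/-- A nonzero finite-dimensional representation of a hereditary subalgebra yields a minimal open
projection in a quotient of `A`. -/
theorem not_isNowhereScattered_of_finiteDimensional (B : NonUnitalStarSubalgebra ℂ A)
    (hB : IsHereditary B) {H : Type*} [NormedAddCommGroup H] [InnerProductSpace ℂ H]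
    [CompleteSpace H] [FiniteDimensional ℂ H] (π : B →⋆ₙₐ[ℂ] (H →L[ℂ] H)) (hπ : π ≠ 0) :
    ¬ IsNowhereScattered A := by
  have := hB.1
  refine not_isNowhereScattered_of_corner B (fun b hb c hc a => hB.mul_mul_mem hb hc a) ?_
  obtain ⟨b, hb⟩ : ∃ b, π b ≠ 0 := by
    by_contra! h
    exact hπ (NonUnitalStarAlgHom.ext h)
  have : ProperSpace H := FiniteDimensional.proper ℂ H
  exact not_isNowhereScattered_of_compact (D := B) π hb
    (isCompactOperator_of_locallyCompactSpace_dom (π b))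

/-- The representation of `ℂ` by scalar operators. -/
noncomputable def scalarRep (H : Type*) [NormedAddCommGroup H] [InnerProductSpace ℂ H]
    [CompleteSpace H] : ℂ →⋆ₙₐ[ℂ] (H →L[ℂ] H) where
  toFun c := c • (1 : H →L[ℂ] H)
  map_smul' c d := by rw [smul_eq_mul, mul_smul]; rfl
  map_zero' := zero_smul _ _
  map_add' c d := add_smul c d (1 : H →L[ℂ] H)
  map_mul' c d := by rw [smul_mul_smul_comm, one_mul]
  map_star' c := by rw [star_smul, star_one]

theorem scalarRep_one (H : Type*) [NormedAddCommGroup H] [InnerProductSpace ℂ H]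
    [CompleteSpace H] : scalarRep H 1 = 1 := one_smul ℂ (1 : H →L[ℂ] H)

/-- A minimal open projection `p ∈ A / I` gives a one-dimensional representation of the hereditary
subalgebra of those elements of `A` that are sent into `ℂ p`. -/
theorem exists_hereditary_oneDimensional (h : ¬ IsNowhereScattered A) :
    ∃ B : NonUnitalStarSubalgebra ℂ A, IsHereditary B ∧
      ∃ π : B →⋆ₙₐ[ℂ] (EuclideanSpace ℂ PUnit.{u + 1} →L[ℂ] EuclideanSpace ℂ PUnit.{u + 1}),
        π ≠ 0 := by
  simp only [IsNowhereScattered, not_forall, not_not] at h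
  obtain ⟨I, p, hp⟩ := h
  obtain ⟨hp0, hpp, hps, hpa⟩ := isMinimalOpenProjection_iff.1 hp
  obtain ⟨e, rfl⟩ := I.proj_surjective p
  let B : NonUnitalStarSubalgebra ℂ A :=
    { carrier := {b | ∃ c : ℂ, I.proj b = c • I.proj e}
      add_mem' := by
        rintro a b ⟨c, hc⟩ ⟨d, hd⟩
        exact ⟨c + d, by rw [I.proj_add, hc, hd, add_smul]⟩
      zero_mem' := ⟨0, by rw [I.proj_zero, zero_smul]⟩
      mul_mem' := by
        rintro a b ⟨c, hc⟩ ⟨d, hd⟩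
        exact ⟨c * d, by rw [I.proj_mul, hc, hd, smul_mul_smul_comm, hpp]⟩
      smul_mem' := by
        rintro k a ⟨c, hc⟩
        exact ⟨k * c, by rw [I.proj_smul, hc, smul_smul]⟩
      star_mem' := by
        rintro a ⟨c, hc⟩
        exact ⟨star c, by rw [I.proj_star, hc, star_smul, hps]⟩ }
  have hcont : Continuous I.proj := I.projHom.continuous_of_cstar
  have hBcl : IsClosed (B : Set A) := by
    have h1 : (B : Set A) = I.proj ⁻¹' (Submodule.span ℂ {I.proj e} : Set I.Quotient) := by
      ext b
      simp only [Set.mem_preimage, SetLike.mem_coe, Submodule.mem_span_singleton]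
      exact ⟨fun ⟨c, hc⟩ => ⟨c, hc.symm⟩, fun ⟨c, hc⟩ => ⟨c, hc.symm⟩⟩
    rw [h1]
    exact (Submodule.closed_of_finiteDimensional _).preimage hcont
  have hinj : Function.Injective fun c : ℂ => c • I.proj e := smul_left_injective ℂ hp0
  choose χ hχ using fun b : B => b.2
  let φ : B →⋆ₙₐ[ℂ] ℂ :=
    { toFun := χ
      map_smul' := fun c b => hinj (by
        change χ (c • b) • I.proj e = (c * χ b) • I.proj e
        rw [← hχ, mul_smul, ← hχ]; rfl)
      map_zero' := hinj (by
        change χ 0 • I.proj e = (0 : ℂ) • I.proj e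
        rw [← hχ, zero_smul]; rfl)
      map_add' := fun a b => hinj (by
        change χ (a + b) • I.proj e = (χ a + χ b) • I.proj e
        rw [← hχ, add_smul, ← hχ, ← hχ]; rfl)
      map_mul' := fun a b => hinj (by
        change χ (a * b) • I.proj e = (χ a * χ b) • I.proj e
        rw [← hχ, ← hpp, ← smul_mul_smul_comm, ← hχ, ← hχ]; rfl)
      map_star' := fun a => hinj (by
        change χ (star a) • I.proj e = (star (χ a)) • I.proj e
        rw [← hχ, ← hps, ← star_smul, ← hχ]; rfl) }
  refine ⟨B, ⟨hBcl, ?_⟩, (scalarRep _).comp φ, fun h0 => ?_⟩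
  · rintro a b ⟨x, hx⟩ ⟨y, hy⟩ ⟨c, hc⟩
    let := CStarAlgebra.spectralOrder I.Quotient
    have := CStarAlgebra.spectralOrderedRing I.Quotient
    -- `0 ≤ a ≤ c p` gives `x (1 - p) = 0` where `a = x⋆ x`, so that `a = p a p`
    have h1 : 0 ≤ I.proj a := by
      rw [hx, I.proj_mul, I.proj_star]; exact star_mul_self_nonneg _
    have h2 : I.proj a ≤ I.proj b := by
      rw [← sub_nonneg, ← I.proj_sub, hy, I.proj_mul, I.proj_star]; exact star_mul_self_nonneg _
    obtain ⟨z, hz⟩ : ∃ z, z = I.proj x := ⟨_, rfl⟩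
    have haz : I.proj a = star z * z := by rw [hx, I.proj_mul, I.proj_star, hz]
    have hzero : ∀ w : I.Quotient, z * (w - I.proj e * w) = 0 := by
      intro w
      have h3 := star_left_conjugate_le_conjugate h2 (w - I.proj e * w)
      have h4 : I.proj b * (w - I.proj e * w) = 0 := by
        rw [hc, smul_mul_assoc, mul_sub, ← mul_assoc, hpp, sub_self, smul_zero]
      rw [mul_assoc _ (I.proj b), h4, mul_zero] at h3
      have h5 := le_antisymm h3 (star_left_conjugate_nonneg h1 _)
      rw [← CStarRing.star_mul_self_eq_zero_iff, ← h5, haz, star_mul]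
      simp only [mul_assoc]
    have hza : z * star z - z * (I.proj e * star z) = 0 := by rw [← mul_sub, hzero]
    have hze : z - z * I.proj e = 0 := by
      rw [← CStarRing.mul_star_self_eq_zero_iff, star_sub, star_mul, hps, sub_mul, mul_sub, mul_sub]
      have h6 : z * I.proj e * (I.proj e * star z) = z * (I.proj e * star z) := by
        rw [← mul_assoc, mul_assoc z, hpp, mul_assoc]
      rw [h6, mul_assoc, sub_self, sub_zero, hza]
    rw [sub_eq_zero] at hze
    obtain ⟨d, hd⟩ := hpa (I.proj a)
    refine ⟨d, ?_⟩
    rw [← hd, haz]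
    conv_lhs => rw [hze]
    rw [star_mul, hps]
    simp only [mul_assoc]
  · have he : (e : A) ∈ B := ⟨1, (one_smul _ _).symm⟩
    have h1 : φ ⟨e, he⟩ = 1 := hinj (by
      change χ ⟨e, he⟩ • I.proj e = (1 : ℂ) • I.proj e
      rw [← hχ, one_smul])
    have h2 : scalarRep (EuclideanSpace ℂ PUnit.{u + 1}) (φ ⟨e, he⟩) = 0 :=
      congrArg (fun f : B →⋆ₙₐ[ℂ] _ => f ⟨e, he⟩) h0
    rw [h1, scalarRep_one] at h2
    exact one_ne_zero h2

/-- Every representation on a one-dimensional space is irreducible. -/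
theorem isIrreducibleRep_of_finrank_eq_one {B : Type*} [NonUnitalSemiring B] [StarRing B]
    [Module ℂ B] {H : Type*} [NormedAddCommGroup H] [InnerProductSpace ℂ H] [CompleteSpace H]
    (hH : Module.finrank ℂ H = 1) (π : B →⋆ₙₐ[ℂ] (H →L[ℂ] H)) : IsIrreducibleRep π := by
  intro K _ _
  have : IsSimpleOrder (Submodule ℂ H) := is_simple_module_of_finrank_eq_one hH
  exact eq_bot_or_eq_top K

end FiniteDimensionalRep

open scoped InnerProductSpace

/-! ### The algebra of compact operators -/

section CompactOperators

variable {H : Type u} [NormedAddCommGroup H] [InnerProductSpace ℂ H] [CompleteSpace H]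

/-- The rank-one operator `z ↦ ⟪y, z⟫ x`, as an element of the algebra of compact operators. -/
noncomputable def compactRankOne (x y : H) : ClosedIdeal.compactOperators H :=
  ⟨InnerProductSpace.rankOne ℂ x y, by
    have h : IsCompactOperator (InnerProductSpace.rankOne ℂ x y) := by
      rw [InnerProductSpace.rankOne_def']
      have h1 : IsCompactOperator (ContinuousLinearMap.toSpanSingleton ℂ x) :=
        isCompactOperator_of_locallyCompactSpace_rng _
      exact h1.comp_clm (innerSL ℂ y)
    exact h⟩

theorem coe_compactRankOne (x y : H) :
    (compactRankOne x y : H →L[ℂ] H) = InnerProductSpace.rankOne ℂ x y := rfl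

theorem mul_compactRankOne (T : ClosedIdeal.compactOperators H) (x y : H) :
    T * compactRankOne x y = compactRankOne ((T : H →L[ℂ] H) x) y := by
  refine Subtype.ext (ContinuousLinearMap.ext fun z => ?_)
  change (T : H →L[ℂ] H) (⟪y, z⟫_ℂ • x) = ⟪y, z⟫_ℂ • (T : H →L[ℂ] H) x
  rw [map_smul]

theorem compactRankOne_smul_left (c : ℂ) (x y : H) :
    compactRankOne (c • x) y = c • compactRankOne x y := by
  refine Subtype.ext (ContinuousLinearMap.ext fun z => ?_)
  change ⟪y, z⟫_ℂ • c • x = c • ⟪y, z⟫_ℂ • x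
  rw [smul_comm]

theorem star_compactRankOne (x y : H) : star (compactRankOne x y) = compactRankOne y x :=
  Subtype.ext (InnerProductSpace.adjoint_rankOne x y)

theorem compactRankOne_ne_zero {x : H} (hx : x ≠ 0) : compactRankOne x x ≠ 0 := fun h =>
  InnerProductSpace.rankOne_ne_zero (𝕜 := ℂ) hx hx (congrArg Subtype.val h)

/-- Finite-rank operators are dense among the compact operators. -/
theorem compactOperators_induction {P : ClosedIdeal.compactOperators H → Prop}
    (hcl : IsClosed {T | P T}) (h0 : P 0) (hadd : ∀ S T, P S → P T → P (S + T))
    (hr : ∀ x y, P (compactRankOne x y)) (T : ClosedIdeal.compactOperators H) : P T := by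
  refine hcl.closure_subset_iff.2 (subset_refl _) (Metric.mem_closure_iff.2 fun ε hε => ?_)
  have hT : IsCompactOperator (T : H →L[ℂ] H) := T.2
  have hcpt := hT.isCompact_closure_image_closedBall (f := ((T : H →L[ℂ] H) : H →ₗ[ℂ] H)) 1
  obtain ⟨t, ht, hcov⟩ := Metric.totallyBounded_iff.1 hcpt.totallyBounded (ε / 4) (by positivity)
  let U : Submodule ℂ H := Submodule.span ℂ t
  have : FiniteDimensional ℂ U := FiniteDimensional.span_of_finite ℂ ht
  let b := stdOrthonormalBasis ℂ U
  let S : ClosedIdeal.compactOperators H :=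
    ∑ i, compactRankOne (b i : H) (ContinuousLinearMap.adjoint (T : H →L[ℂ] H) (b i))
  have hS : P S := by
    refine Finset.sum_induction _ P hadd h0 fun i _ => hr _ _
  have hSv : ∀ v, (S : H →L[ℂ] H) v = U.starProjection ((T : H →L[ℂ] H) v) := by
    intro v
    have h1 : (S : H →L[ℂ] H) = ∑ i, InnerProductSpace.rankOne ℂ (b i : H)
        (ContinuousLinearMap.adjoint (T : H →L[ℂ] H) (b i)) := by
      simp only [S, AddSubmonoidClass.coe_finsetSum, coe_compactRankOne]
    rw [h1, b.starProjection_eq_sum_rankOne]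
    simp [ContinuousLinearMap.adjoint_inner_left]
  refine ⟨S, hS, ?_⟩
  rw [dist_eq_norm]
  change ‖(T : H →L[ℂ] H) - (S : H →L[ℂ] H)‖ < ε
  refine lt_of_le_of_lt (ContinuousLinearMap.opNorm_le_of_unit_norm (𝕜 := ℂ) (C := ε / 2)
    (by positivity) fun v hv => ?_) (by linarith)
  have hmem : (T : H →L[ℂ] H) v ∈ closure ((T : H →L[ℂ] H) '' Metric.closedBall 0 1) :=
    subset_closure ⟨v, by simp [hv], rfl⟩
  obtain ⟨y, hy, hyv⟩ := Set.mem_iUnion₂.1 (hcov hmem)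
  rw [Metric.mem_ball, dist_eq_norm] at hyv
  have hyU : U.starProjection y = y :=
    Submodule.starProjection_eq_self_iff.2 (Submodule.subset_span hy)
  rw [sub_apply, hSv]
  have h2 : (T : H →L[ℂ] H) v - U.starProjection ((T : H →L[ℂ] H) v)
      = ((T : H →L[ℂ] H) v - y) - U.starProjection ((T : H →L[ℂ] H) v - y) := by
    rw [map_sub, hyU]
    abel
  rw [h2]
  calc _ ≤ ‖(T : H →L[ℂ] H) v - y‖ + ‖U.starProjection ((T : H →L[ℂ] H) v - y)‖ := norm_sub_le _ _
    _ ≤ ‖(T : H →L[ℂ] H) v - y‖ + 1 * ‖(T : H →L[ℂ] H) v - y‖ := by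
        gcongr
        exact ContinuousLinearMap.le_of_opNorm_le _ U.starProjection_norm_le _
    _ ≤ ε / 2 := by linarith

/-- Elementary algebras are of type `I`: in a nonzero quotient some rank-one projection
survives. -/
theorem IsElementary.isTypeI {J : Type u} [NonUnitalCStarAlgebra J] (hJ : IsElementary J) :
    IsTypeI J := by
  obtain ⟨H, _, _, _, ⟨e⟩⟩ := hJ
  intro L hL
  have hcont : Continuous e.symm := e.symm.toNonUnitalStarAlgHom.continuous_of_cstar
  obtain ⟨x, hx, hxL⟩ : ∃ x : H, ‖x‖ = 1 ∧ e.symm (compactRankOne x x) ∉ L := by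
    by_contra! h
    have hall : ∀ T, e.symm T ∈ L := by
      refine compactOperators_induction ((ClosedIdeal.isClosed_coe L).preimage hcont)
        (by rw [map_zero]; exact zero_mem L)
        (fun S T hS hT => by rw [map_add]; exact add_mem hS hT) fun x y => ?_
      by_cases hx : x = 0
      · rw [hx, ← zero_smul ℂ (0 : H), compactRankOne_smul_left, zero_smul, map_zero]
        exact zero_mem L
      · have hn : ((‖x‖ : ℂ)) ≠ 0 := by simpa using hx
        have hu : ‖(‖x‖ : ℂ)⁻¹ • x‖ = 1 := by
          rw [norm_smul, norm_inv, Complex.norm_real, norm_norm, inv_mul_cancel₀]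
          simpa using hx
        have h1 : compactRankOne x y = (‖x‖ : ℂ) •
            (compactRankOne ((‖x‖ : ℂ)⁻¹ • x) ((‖x‖ : ℂ)⁻¹ • x) *
              compactRankOne ((‖x‖ : ℂ)⁻¹ • x) y) := by
          rw [mul_compactRankOne, coe_compactRankOne, InnerProductSpace.rankOne_apply,
            inner_self_eq_norm_sq_to_K, hu]
          simp only [RCLike.ofReal_one, one_pow, one_smul]
          rw [compactRankOne_smul_left, smul_inv_smul₀ hn]
        rw [h1, map_smul, map_mul]
        exact SMulMemClass.smul_mem _ (L.mul_mem_right _ (h _ hu))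
    obtain ⟨z, hz⟩ := exists_ne (0 : L.Quotient)
    obtain ⟨j, rfl⟩ := L.proj_surjective z
    refine hz (L.proj_eq_zero.2 ?_)
    rw [← e.symm_apply_apply j]
    exact hall _
  have hmin : IsMinimalMod L (e.symm (compactRankOne x x)) := by
    refine ⟨hxL, ?_, ?_, fun a => ⟨⟪x, (e a : H →L[ℂ] H) x⟫_ℂ, ?_⟩⟩
    · rw [← map_mul, mul_compactRankOne, coe_compactRankOne, InnerProductSpace.rankOne_apply,
        inner_self_eq_norm_sq_to_K, hx]
      simp
    · have h1 : star (e.symm (compactRankOne x x)) = e.symm (star (compactRankOne x x)) :=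
        (e.symm.map_star' _).symm
      rw [h1, star_compactRankOne, sub_self]
      exact zero_mem L
    · have h1 : e.symm (compactRankOne x x) * a * e.symm (compactRankOne x x)
          = e.symm (compactRankOne x x * (e a * compactRankOne x x)) := by
        rw [map_mul, map_mul, e.symm_apply_apply, mul_assoc]
      rw [h1, mul_compactRankOne, mul_compactRankOne, coe_compactRankOne,
        InnerProductSpace.rankOne_apply, compactRankOne_smul_left, map_smul, sub_self]
      exact zero_mem L
  have hmin' := isMinimalMod_iff.1 hmin
  exact ⟨_, hmin'.1, hmin'.isAbelianElement⟩

/-- A nonzero ideal of type `I` contains a nonzero abelian element of the whole algebra. -/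
theorem exists_isAbelianElement_of_isTypeI {D : Type u} [NonUnitalCStarAlgebra D]
    {J : ClosedIdeal D} [Nontrivial J] (hJ : IsTypeI J) : ∃ a : D, a ≠ 0 ∧ IsAbelianElement a := by
  have hinj : Function.Injective (ClosedIdeal.zeroIdeal J).proj := fun a b h => by
    rwa [ClosedIdeal.proj_eq_proj, ClosedIdeal.mem_zeroIdeal, sub_eq_zero] at h
  obtain ⟨x, hx0, hx⟩ := hJ (ClosedIdeal.zeroIdeal J) hinj.nontrivial
  obtain ⟨⟨b, hb⟩, hcomm⟩ := isAbelianElement_iff.1 hx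
  obtain ⟨b, rfl⟩ := (ClosedIdeal.zeroIdeal J).proj_surjective b
  obtain ⟨a, ha⟩ : ∃ a : J, a = star b * b := ⟨_, rfl⟩
  have hxa : x = (ClosedIdeal.zeroIdeal J).proj a := by rw [ha, hb]; rfl
  rw [hxa] at hcomm hx0
  have hcommJ : ∀ z w : J, (a * z * a) * (a * w * a) = (a * w * a) * (a * z * a) := fun z w =>
    hinj (hcomm ((ClosedIdeal.zeroIdeal J).proj z) ((ClosedIdeal.zeroIdeal J).proj w))
  have hpos : IsPositiveElement (a : D) := ⟨b, by rw [ha]; rfl⟩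
  refine ⟨a, fun h => hx0 ?_, isAbelianElement_iff.2 ⟨hpos, fun z w => ?_⟩⟩
  · rw [ClosedIdeal.proj_eq_zero, ClosedIdeal.mem_zeroIdeal]
    exact Subtype.ext h
  -- replace `z` and `w` by `e z e` and `e w e`, with `e` in an approximate unit of `J`
  obtain ⟨l, hl, he, ht⟩ := J.exists_approxUnit
  obtain ⟨h1, h2⟩ := ht a a.2
  have h3 : ∀ z : D, Tendsto (fun e => a * e * z * (e * a)) l (𝓝 (a * z * a)) := fun z =>
    (h1.mul_const z).mul h2
  have h4 := (h3 z).mul (h3 w)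
  have h5 := (h3 w).mul (h3 z)
  refine tendsto_nhds_unique_of_eventuallyEq h4 h5 ?_
  filter_upwards [he] with e he
  have h6 := congrArg Subtype.val (hcommJ ⟨e * z * e, J.mul_mem_left _ he.1⟩
    ⟨e * w * e, J.mul_mem_left _ he.1⟩)
  simpa [mul_assoc] using h6

end CompactOperators

/-! ### The representation attached to a minimal projection -/

section LeftRegular

variable {D : Type u} [NonUnitalCStarAlgebra D] {p : D}

/-- For a minimal projection `p`, the space `D p` with the inner product `⟪x, y⟫ p = x⋆ y`. Its
norm is that of `D`, which makes it complete. -/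
def MinimalLeftIdeal (_hp : IsMinimalOpenProjection p) : Type u :=
  ({ carrier := {x | x * p = x}
     add_mem' := fun {x y} (hx : x * p = x) (hy : y * p = y) =>
       show (x + y) * p = x + y by rw [add_mul, hx, hy]
     zero_mem' := zero_mul p
     smul_mem' := fun c x (hx : x * p = x) =>
       show (c • x) * p = c • x by rw [smul_mul_assoc, hx] } : Submodule ℂ D)

namespace MinimalLeftIdeal

variable (hp : IsMinimalOpenProjection p)

noncomputable instance : NormedAddCommGroup (MinimalLeftIdeal hp) :=
  inferInstanceAs (NormedAddCommGroup (Submodule.mk _ _ : Submodule ℂ D))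

noncomputable instance : NormedSpace ℂ (MinimalLeftIdeal hp) :=
  inferInstanceAs (NormedSpace ℂ (Submodule.mk _ _ : Submodule ℂ D))

/-- The underlying element of `D`. -/
def val (x : MinimalLeftIdeal hp) : D := Subtype.val x

variable {hp}

theorem val_mul (x : MinimalLeftIdeal hp) : x.val * p = x.val := x.2

theorem mul_star_val (x : MinimalLeftIdeal hp) : p * star x.val = star x.val := by
  conv_rhs => rw [← x.val_mul, star_mul, (isMinimalOpenProjection_iff.1 hp).2.2.1]

theorem val_add (x y : MinimalLeftIdeal hp) : (x + y).val = x.val + y.val := rfl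

theorem val_smul (c : ℂ) (x : MinimalLeftIdeal hp) : (c • x).val = c • x.val := rfl

theorem val_injective : Function.Injective (val hp) := Subtype.val_injective

instance : CompleteSpace (MinimalLeftIdeal hp) := by
  have h : IsClosed {x : D | x * p = x} := isClosed_eq (by fun_prop) continuous_id
  exact h.completeSpace_coe

theorem norm_projection (hp : IsMinimalOpenProjection p) : ‖p‖ = 1 := by
  obtain ⟨h0, hpp, hps, -⟩ := isMinimalOpenProjection_iff.1 hp
  have h1 := CStarRing.norm_star_mul_self (x := p)
  rw [hps, hpp] at h1
  have h2 : ‖p‖ ≠ 0 := norm_ne_zero_iff.2 h0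
  exact mul_left_cancel₀ h2 (by rw [← h1, mul_one])

theorem exists_inner (x y : MinimalLeftIdeal hp) : ∃ c : ℂ, star x.val * y.val = c • p := by
  obtain ⟨c, hc⟩ := (isMinimalOpenProjection_iff.1 hp).2.2.2 (star x.val * y.val)
  refine ⟨c, ?_⟩
  rw [← hc, ← mul_assoc, mul_star_val, mul_assoc, val_mul]

noncomputable instance : Inner ℂ (MinimalLeftIdeal hp) where
  inner x y := (exists_inner x y).choose

theorem inner_smul_eq (x y : MinimalLeftIdeal hp) :
    inner ℂ x y • p = star x.val * y.val := (exists_inner x y).choose_spec.symm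

theorem smul_cancel (hp : IsMinimalOpenProjection p) {c d : ℂ} (h : c • p = d • p) : c = d :=
  smul_left_injective ℂ hp.1 h

noncomputable instance : InnerProductSpace ℂ (MinimalLeftIdeal hp) where
  norm_sq_eq_re_inner x := by
    obtain ⟨c, hc⟩ : ∃ c : ℂ, c = inner ℂ x x := ⟨_, rfl⟩
    have h1 : c • p = star x.val * x.val := hc ▸ inner_smul_eq x x
    have h2 : ‖c‖ = ‖x‖ ^ 2 := by
      have h3 := congrArg norm h1
      rwa [norm_smul, norm_projection hp, mul_one, CStarRing.norm_star_mul_self, ← sq] at h3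
    -- `c p` is positive, so that `c = ‖c‖`
    have h4 : c = ‖c‖ := by
      let := CStarAlgebra.spectralOrder D
      have := CStarAlgebra.spectralOrderedRing D
      obtain ⟨h0, hpp, hps, -⟩ := isMinimalOpenProjection_iff.1 hp
      have hp0 : 0 ≤ p := by
        have := star_mul_self_nonneg p
        rwa [hps, hpp] at this
      have hc0 : 0 ≤ c • p := h1 ▸ star_mul_self_nonneg _
      have hsa : star (c • p) = c • p := h1 ▸ (by rw [star_mul, star_star])
      rw [star_smul, hps] at hsa
      have hreal : (c.re : ℂ) = c := Complex.conj_eq_iff_re.1 (smul_cancel hp hsa)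
      have hre : 0 ≤ c.re := by
        by_contra! hneg
        have h5 : 0 ≤ (-c.re) • p := smul_nonneg (by linarith) hp0
        have h6 : (-c.re) • p = -(c • p) := by
          rw [neg_smul, ← Complex.coe_smul, hreal]
        rw [h6] at h5
        have h7 := le_antisymm (neg_nonneg.1 h5) hc0
        rw [smul_eq_zero] at h7
        have h8 := h7.resolve_right h0
        rw [h8] at hneg
        exact lt_irrefl _ hneg
      rw [← hreal, Complex.norm_real, Real.norm_of_nonneg hre]
    rw [← h2, ← hc]
    change ‖c‖ = c.re
    conv_rhs => rw [h4]
    exact (Complex.ofReal_re _).symm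
  conj_inner_symm x y := by
    apply smul_cancel hp
    have h1 := congrArg star (inner_smul_eq y x)
    rw [star_smul, (isMinimalOpenProjection_iff.1 hp).2.2.1, star_mul, star_star] at h1
    rw [inner_smul_eq, ← h1, Complex.star_def]
  add_left x y z := by
    apply smul_cancel hp
    rw [add_smul, inner_smul_eq, inner_smul_eq, inner_smul_eq, val_add, star_add, add_mul]
  smul_left x y c := by
    apply smul_cancel hp
    rw [mul_smul, inner_smul_eq, inner_smul_eq, val_smul, star_smul, smul_mul_assoc,
      Complex.star_def]

/-- The element `a p` of `D p`. -/
def mk (hp : IsMinimalOpenProjection p) (a : D) : MinimalLeftIdeal hp :=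
  ⟨a * p, show a * p * p = a * p by rw [mul_assoc, (isMinimalOpenProjection_iff.1 hp).2.1]⟩

theorem val_mk (a : D) : (mk hp a).val = a * p := rfl

/-- The multiplication of `D` on `D p` from the left. -/
noncomputable def leftMul (hp : IsMinimalOpenProjection p) (a : D) :
    MinimalLeftIdeal hp →L[ℂ] MinimalLeftIdeal hp :=
  LinearMap.mkContinuous
    { toFun := fun x => ⟨a * x.val, show a * x.val * p = a * x.val by rw [mul_assoc, val_mul]⟩
      map_add' := fun x y => Subtype.ext (mul_add a x.val y.val)
      map_smul' := fun c x => Subtype.ext (mul_smul_comm c a x.val) } ‖a‖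
    fun x => norm_mul_le a x.val

theorem val_leftMul (a : D) (x : MinimalLeftIdeal hp) : (leftMul hp a x).val = a * x.val := rfl

variable (hp) in
/-- The representation of `D` on `D p` by left multiplication. -/
noncomputable def rep : D →⋆ₙₐ[ℂ] (MinimalLeftIdeal hp →L[ℂ] MinimalLeftIdeal hp) where
  toFun := leftMul hp
  map_smul' c a := ContinuousLinearMap.ext fun x => val_injective (smul_mul_assoc c a x.val)
  map_zero' := ContinuousLinearMap.ext fun x => val_injective (zero_mul x.val)
  map_add' a b := ContinuousLinearMap.ext fun x => val_injective (add_mul a b x.val)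
  map_mul' a b := ContinuousLinearMap.ext fun x => val_injective (mul_assoc a b x.val)
  map_star' a := by
    rw [ContinuousLinearMap.star_eq_adjoint, ContinuousLinearMap.eq_adjoint_iff]
    intro x y
    apply smul_cancel hp
    rw [inner_smul_eq, inner_smul_eq, val_leftMul, val_leftMul, star_mul, star_star, mul_assoc]

theorem val_rep (a : D) (x : MinimalLeftIdeal hp) : (rep hp a x).val = a * x.val := rfl

/-- The element `x y⋆` of `D` acts as a rank-one operator. -/
theorem rep_mul_star (x y : MinimalLeftIdeal hp) :
    rep hp (x.val * star y.val) = InnerProductSpace.rankOne ℂ x y := by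
  refine ContinuousLinearMap.ext fun z => val_injective ?_
  rw [val_rep, InnerProductSpace.rankOne_apply, val_smul, mul_assoc, ← inner_smul_eq,
    mul_smul_comm, val_mul]

variable (hp) in
theorem mk_self_ne_zero : mk hp p ≠ 0 := fun h => hp.1 (by
  have h1 : (mk hp p).val = 0 := congrArg (val hp) h
  rwa [val_mk, (isMinimalOpenProjection_iff.1 hp).2.1] at h1)

variable (hp) in
theorem isIrreducibleRep_rep : IsIrreducibleRep (rep hp) := by
  intro K _ hinv
  by_cases hK : K = ⊥
  · exact Or.inl hK
  refine Or.inr (eq_top_iff.2 fun y _ => ?_)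
  obtain ⟨x, hxK, hx0⟩ := K.ne_bot_iff.1 hK
  have h1 := hinv (y.val * star x.val) x hxK
  rw [rep_mul_star, InnerProductSpace.rankOne_apply] at h1
  have h2 : inner ℂ x x ≠ 0 := inner_self_ne_zero.2 hx0
  have h3 := K.smul_mem (inner ℂ x x)⁻¹ h1
  rwa [inv_smul_smul₀ h2] at h3

end MinimalLeftIdeal

variable {A : Type u} [NonUnitalCStarAlgebra A]

/-- If `A` is not nowhere scattered, some irreducible representation of `A` has all rank-one
operators in its image. -/
theorem exists_irreducibleRep_rankOne (h : ¬ IsNowhereScattered A) :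
    ∃ (H : Type u) (_ : NormedAddCommGroup H) (_ : InnerProductSpace ℂ H) (_ : CompleteSpace H)
      (π : A →⋆ₙₐ[ℂ] (H →L[ℂ] H)), Nontrivial H ∧ IsIrreducibleRep π ∧
        ∀ x y : H, ∃ a, π a = InnerProductSpace.rankOne ℂ x y := by
  simp only [IsNowhereScattered, not_forall, not_not] at h
  obtain ⟨I, p, hp⟩ := h
  refine ⟨MinimalLeftIdeal hp, inferInstance, inferInstance, inferInstance,
    (MinimalLeftIdeal.rep hp).comp I.projHom,
    ⟨⟨_, 0, MinimalLeftIdeal.mk_self_ne_zero hp⟩⟩, ?_, fun x y => ?_⟩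
  · intro K hK hinv
    refine MinimalLeftIdeal.isIrreducibleRep_rep hp K hK fun b ξ hξ => ?_
    obtain ⟨a, rfl⟩ := I.proj_surjective b
    exact hinv a ξ hξ
  · obtain ⟨a, ha⟩ := I.proj_surjective (x.val * star y.val)
    refine ⟨a, ?_⟩
    rw [← MinimalLeftIdeal.rep_mul_star, ← ha]
    rfl

/-- The preimage of the compact operators in `A / ker π` is elementary if all rank-one operators
lie in the image of `π`. -/
theorem exists_isElementary_of_rankOne {H : Type u} [NormedAddCommGroup H]
    [InnerProductSpace ℂ H] [CompleteSpace H] [Nontrivial H] (π : A →⋆ₙₐ[ℂ] (H →L[ℂ] H))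
    (hπ : ∀ x y : H, ∃ a, π a = InnerProductSpace.rankOne ℂ x y) :
    ∃ (I : ClosedIdeal A) (J : ClosedIdeal I.Quotient), Nontrivial J ∧ IsElementary J := by
  let J := (ClosedIdeal.compactOperators H).comap (ClosedIdeal.kerLift π)
  let f : J →⋆ₙₐ[ℂ] ClosedIdeal.compactOperators H :=
    { toFun := fun x => ⟨ClosedIdeal.kerLift π x, x.2⟩
      map_smul' := fun c x => Subtype.ext (map_smul _ c _)
      map_zero' := Subtype.ext (map_zero _)
      map_add' := fun x y => Subtype.ext (map_add _ _ _)
      map_mul' := fun x y => Subtype.ext (map_mul _ _ _)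
      map_star' := fun x => Subtype.ext (map_star _ _) }
  have hinj : Function.Injective f := fun x y h =>
    Subtype.ext (ClosedIdeal.kerLift_injective π (congrArg Subtype.val h))
  have hrank : ∀ x y : H, ∃ j, f j = compactRankOne x y := by
    intro x y
    obtain ⟨a, ha⟩ := hπ x y
    have ha' : ClosedIdeal.kerLift π ((ClosedIdeal.ker π).proj a) =
        InnerProductSpace.rankOne ℂ x y := ha
    refine ⟨⟨(ClosedIdeal.ker π).proj a, ?_⟩, Subtype.ext ha'⟩
    change ClosedIdeal.kerLift π ((ClosedIdeal.ker π).proj a) ∈ ClosedIdeal.compactOperators H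
    rw [ha', ← coe_compactRankOne]
    exact (compactRankOne x y).2
  have hsurj : Function.Surjective f := by
    have hiso : Isometry f := NonUnitalStarAlgHom.isometry f hinj
    refine compactOperators_induction (P := fun T => ∃ j, f j = T)
      hiso.isClosedEmbedding.isClosed_range ⟨0, map_zero f⟩ ?_ hrank
    rintro _ _ ⟨j, rfl⟩ ⟨k, rfl⟩
    exact ⟨j + k, map_add f j k⟩
  refine ⟨_, J, ?_, H, inferInstance, inferInstance, inferInstance,
    ⟨StarAlgEquiv.ofBijective f ⟨hinj, hsurj⟩⟩⟩
  obtain ⟨x, hx⟩ := exists_ne (0 : H)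
  obtain ⟨j, hj⟩ := hrank x x
  exact ⟨⟨j, 0, fun h => compactRankOne_ne_zero hx (by rw [← hj, h, map_zero])⟩⟩

end LeftRegular

open scoped ComplexOrder

/-! ### Positive functionals and pure states -/

section PositiveFunctionals

variable {A : Type u} [NonUnitalCStarAlgebra A]

/-- A bounded functional is positive if it is nonnegative on all `a⋆ a`. -/
def IsPositiveFunctional (φ : A →L[ℂ] ℂ) : Prop := ∀ a, 0 ≤ φ (star a * a)

theorem mem_stateSpace_iff {φ : A →L[ℂ] ℂ} :
    φ ∈ stateSpace A ↔ IsPositiveFunctional φ ∧ ‖φ‖ = 1 := by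
  refine and_congr_left fun _ => forall_congr' fun a => ?_
  rw [Complex.nonneg_iff, eq_comm (a := (0 : ℝ)) (b := (φ (star a * a)).im)]

namespace IsPositiveFunctional

variable {φ θ : A →L[ℂ] ℂ}

theorem add (hφ : IsPositiveFunctional φ) (hθ : IsPositiveFunctional θ) :
    IsPositiveFunctional (φ + θ) := fun a => add_nonneg (hφ a) (hθ a)

theorem smul (hφ : IsPositiveFunctional φ) {c : ℝ} (hc : 0 ≤ c) :
    IsPositiveFunctional (c • φ) := fun a => smul_nonneg hc (hφ a)

theorem ofReal_re (hφ : IsPositiveFunctional φ) (a : A) :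
    ((φ (star a * a)).re : ℂ) = φ (star a * a) :=
  Complex.conj_eq_iff_re.1 (hφ a).isSelfAdjoint

theorem re_nonneg (hφ : IsPositiveFunctional φ) (a : A) : 0 ≤ (φ (star a * a)).re :=
  (Complex.nonneg_iff.1 (hφ a)).1

theorem re_le_norm (φ : A →L[ℂ] ℂ) (a : A) : (φ (star a * a)).re ≤ ‖φ‖ * (‖a‖ * ‖a‖) := by
  rw [← CStarRing.norm_star_mul_self]
  exact (Complex.re_le_norm _).trans (φ.le_opNorm _)

/-- A positive functional, as a positive linear map for the spectral order. -/
def toPositiveLinearMap [PartialOrder A] [StarOrderedRing A] (hφ : IsPositiveFunctional φ) :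
    A →ₚ[ℂ] ℂ :=
  PositiveLinearMap.mk₀ (φ : A →ₗ[ℂ] ℂ) fun x hx => by
    obtain ⟨b, rfl⟩ := CStarAlgebra.nonneg_iff_eq_star_mul_self.1 hx
    exact hφ b

theorem map_star (hφ : IsPositiveFunctional φ) (a : A) : φ (star a) = star (φ a) := by
  let := CStarAlgebra.spectralOrder A
  have := CStarAlgebra.spectralOrderedRing A
  exact StarHomClass.map_star hφ.toPositiveLinearMap a

/-- The Cauchy–Schwarz inequality. -/
theorem norm_sq_le (hφ : IsPositiveFunctional φ) (a b : A) :
    ‖φ (star b * a)‖ ^ 2 ≤ (φ (star b * b)).re * (φ (star a * a)).re := by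
  let := CStarAlgebra.spectralOrder A
  have := CStarAlgebra.spectralOrderedRing A
  let f := hφ.toPositiveLinearMap
  have h1 := norm_inner_le_norm (𝕜 := ℂ) (f.toPreGNS b) (f.toPreGNS a)
  have h2 : ∀ c : A, ‖f.toPreGNS c‖ ^ 2 = (φ (star c * c)).re := fun c => by
    have h3 := f.preGNS_norm_sq (f.toPreGNS c)
    have h4 := congrArg Complex.re h3
    rw [← Complex.ofReal_pow, Complex.ofReal_re] at h4
    exact h4
  rw [← h2, ← h2, ← mul_pow]
  exact pow_le_pow_left₀ (norm_nonneg _) h1 2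

/-- The norm of a positive functional is the limit of its values on an approximate unit. -/
theorem tendsto_norm (hφ : IsPositiveFunctional φ) {l : Filter A} [l.NeBot]
    (he : ∀ᶠ e in l, star e = e ∧ ‖e‖ ≤ 1) (ht : ∀ x, Tendsto (fun e => e * x) l (𝓝 x)) :
    Tendsto (fun e => (φ (star e * e)).re) l (𝓝 ‖φ‖) := by
  have hle : ∀ᶠ e in l, (φ (star e * e)).re ≤ ‖φ‖ := by
    filter_upwards [he] with e h
    refine (re_le_norm φ e).trans ?_
    have : ‖e‖ * ‖e‖ ≤ 1 := mul_le_one₀ h.2 (norm_nonneg _) h.2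
    exact mul_le_of_le_one_right (norm_nonneg _) this
  rw [tendsto_order]
  refine ⟨fun c hc => ?_, fun c hc => hle.mono fun e h => h.trans_lt hc⟩
  by_contra hcon
  have hfreq : ∃ᶠ e in l, (φ (star e * e)).re ≤ c := by
    intro h
    exact hcon (h.mono fun e he => not_le.1 he)
  have hc0 : 0 ≤ c := by
    obtain ⟨e, h⟩ := hfreq.exists
    exact (hφ.re_nonneg e).trans h
  -- then `‖φ a‖² ≤ c ‖φ‖ ‖a‖²` for all `a`
  have hbound : ∀ a, ‖φ a‖ ^ 2 ≤ c * (‖φ‖ * (‖a‖ * ‖a‖)) := by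
    intro a
    have h1 : Tendsto (fun e => ‖φ (e * a)‖ ^ 2) l (𝓝 (‖φ a‖ ^ 2)) :=
      (((φ.continuous.tendsto a).comp (ht a)).norm).pow 2
    refine le_of_tendsto_of_frequently h1 ?_
    refine (hfreq.and_eventually he).mono fun e h => ?_
    have h2 := hφ.norm_sq_le a e
    rw [h.2.1] at h2
    have h3 := h.1
    rw [h.2.1] at h3
    refine h2.trans ?_
    have := re_le_norm φ a
    have := hφ.re_nonneg a
    gcongr
  have hn : ‖φ‖ ≤ √(c * ‖φ‖) := by
    refine φ.opNorm_le_bound (Real.sqrt_nonneg _) fun a => ?_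
    refine le_of_sq_le_sq ?_ (by positivity)
    rw [mul_pow, Real.sq_sqrt (by positivity)]
    exact (hbound a).trans (by ring_nf; rfl)
  have hpos : 0 < ‖φ‖ := hc0.trans_lt hc
  have h4 : ‖φ‖ ^ 2 ≤ c * ‖φ‖ := by
    calc ‖φ‖ ^ 2 ≤ √(c * ‖φ‖) ^ 2 := by gcongr
      _ = c * ‖φ‖ := Real.sq_sqrt (by positivity)
  nlinarith

theorem norm_add (hφ : IsPositiveFunctional φ) (hθ : IsPositiveFunctional θ) :
    ‖φ + θ‖ = ‖φ‖ + ‖θ‖ := by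
  obtain ⟨l, hl, he, ht⟩ := exists_approxUnit A
  refine tendsto_nhds_unique ((hφ.add hθ).tendsto_norm he fun x => (ht x).2) ?_
  refine ((hφ.tendsto_norm he fun x => (ht x).2).add
    (hθ.tendsto_norm he fun x => (ht x).2)).congr fun e => ?_
  rw [add_apply, Complex.add_re]

/-- The extension of the Cauchy–Schwarz inequality to an ideal unit vector. -/
theorem norm_apply_sq_le (hφ : IsPositiveFunctional φ) (a : A) :
    ‖φ a‖ ^ 2 ≤ ‖φ‖ * (φ (star a * a)).re := by
  obtain ⟨l, hl, he, ht⟩ := exists_approxUnit A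
  have h1 : Tendsto (fun e => ‖φ (e * a)‖ ^ 2) l (𝓝 (‖φ a‖ ^ 2)) :=
    (((φ.continuous.tendsto a).comp (ht a).2).norm).pow 2
  have h2 := (hφ.tendsto_norm he fun x => (ht x).2).mul_const (φ (star a * a)).re
  refine le_of_tendsto_of_tendsto h1 h2 ?_
  filter_upwards [he] with e h
  have h3 := hφ.norm_sq_le a e
  rwa [h.1] at h3 ⊢

theorem eq_smul_of_norm_smul {c : ℝ} (hφ : IsPositiveFunctional φ)
    (hθ : IsPositiveFunctional θ) (hφ1 : ‖φ‖ = 1) (hθ1 : ‖θ‖ = 1) (h : φ = c • θ) : φ = θ := by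
  have h1 : |c| = 1 := by
    have := congrArg norm h
    rwa [norm_smul, hφ1, hθ1, mul_one, Real.norm_eq_abs, eq_comm] at this
  rcases (abs_eq zero_le_one).1 h1 with h2 | h2
  · rw [h, h2, one_smul]
  · have h3 : φ + θ = 0 := by rw [h, h2]; ext; simp
    have h4 := hφ.norm_add hθ
    rw [h3, norm_zero, hφ1, hθ1] at h4
    norm_num at h4

end IsPositiveFunctional

/-- A state is pure iff every positive functional that it dominates is a multiple of it. -/
theorem mem_pureStates_iff {ψ : A →L[ℂ] ℂ} :
    ψ ∈ pureStates A ↔ ψ ∈ stateSpace A ∧ ∀ θ : A →L[ℂ] ℂ, IsPositiveFunctional θ →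
      IsPositiveFunctional (ψ - θ) → ∃ c : ℝ, θ = c • ψ := by
  constructor
  · intro h
    rw [pureStates, mem_extremePoints] at h
    refine ⟨h.1, fun θ hθ hψθ => ?_⟩
    have hn := hθ.norm_add hψθ
    rw [add_sub_cancel, (mem_stateSpace_iff.1 h.1).2] at hn
    by_cases h0 : ‖θ‖ = 0
    · exact ⟨0, by rw [norm_eq_zero.1 h0]; exact (zero_smul ℝ ψ).symm⟩
    by_cases h1 : ‖ψ - θ‖ = 0
    · exact ⟨1, (sub_eq_zero.1 (norm_eq_zero.1 h1)).symm.trans (one_smul ℝ ψ).symm⟩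
    have hst : ∀ χ : A →L[ℂ] ℂ, IsPositiveFunctional χ → ‖χ‖ ≠ 0 → ‖χ‖⁻¹ • χ ∈ stateSpace A := by
      intro χ hχ hχ0
      refine mem_stateSpace_iff.2 ⟨hχ.smul (by positivity), ?_⟩
      rw [norm_smul, norm_inv, norm_norm, inv_mul_cancel₀ hχ0]
    have h2 := (h.2 _ (hst θ hθ h0) _ (hst _ hψθ h1)
      ⟨‖θ‖, ‖ψ - θ‖, by positivity, by positivity, hn.symm, by
        rw [smul_inv_smul₀ h0, smul_inv_smul₀ h1, add_sub_cancel]⟩).1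
    exact ⟨‖θ‖, by rw [← h2, smul_inv_smul₀ h0]⟩
  · rintro ⟨h, hdom⟩
    rw [pureStates, mem_extremePoints_iff_left]
    refine ⟨h, fun φ₁ h₁ φ₂ h₂ h12 => ?_⟩
    obtain ⟨a, b, ha, hb, -, hab⟩ := h12
    rw [mem_stateSpace_iff] at h h₁ h₂
    obtain ⟨c, hc⟩ := hdom (a • φ₁) (h₁.1.smul ha.le) (by
      rw [← hab, add_sub_cancel_left]
      exact h₂.1.smul hb.le)
    refine h₁.1.eq_smul_of_norm_smul (c := a⁻¹ * c) h.1 h₁.2 h.2 ?_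
    rw [mul_smul, ← hc, inv_smul_smul₀ ha.ne']

/-- A `⋆`-homomorphism as a continuous linear map. -/
def homCLM {B : Type u} [NonUnitalCStarAlgebra B] (f : A →⋆ₙₐ[ℂ] B) : A →L[ℂ] B where
  toFun := f
  map_add' := map_add f
  map_smul' := map_smul f
  cont := f.continuous_of_cstar

theorem IsPositiveFunctional.comp {B : Type u} [NonUnitalCStarAlgebra B] {φ : B →L[ℂ] ℂ}
    (hφ : IsPositiveFunctional φ) (f : A →⋆ₙₐ[ℂ] B) :
    IsPositiveFunctional (φ.comp (homCLM f)) := fun a => by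
  change 0 ≤ φ (f (star a * a))
  rw [map_mul, StarHomClass.map_star]
  exact hφ _

theorem norm_comp_homCLM_le {B : Type u} [NonUnitalCStarAlgebra B] (φ : B →L[ℂ] ℂ)
    (f : A →⋆ₙₐ[ℂ] B) : ‖φ.comp (homCLM f)‖ ≤ ‖φ‖ :=
  ContinuousLinearMap.opNorm_le_bound _ (norm_nonneg _) fun a =>
    (φ.le_opNorm _).trans (by
      gcongr
      exact NonUnitalStarAlgHom.norm_apply_le f a)

section Transport

variable {B : Type u} [NonUnitalCStarAlgebra B] {f : A →⋆ₙₐ[ℂ] B} {g : B →⋆ₙₐ[ℂ] A}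

theorem comp_comp_homCLM (h : ∀ b, f (g b) = b) (φ : B →L[ℂ] ℂ) :
    (φ.comp (homCLM f)).comp (homCLM g) = φ :=
  ContinuousLinearMap.ext fun b => congrArg φ (h b)

theorem comp_mem_stateSpace (h : ∀ b, f (g b) = b) {φ : B →L[ℂ] ℂ} (hφ : φ ∈ stateSpace B) :
    φ.comp (homCLM f) ∈ stateSpace A := by
  rw [mem_stateSpace_iff] at hφ ⊢
  refine ⟨hφ.1.comp f, le_antisymm (hφ.2 ▸ norm_comp_homCLM_le φ f) ?_⟩
  have h1 := norm_comp_homCLM_le (φ.comp (homCLM f)) g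
  rwa [comp_comp_homCLM h, hφ.2] at h1

theorem comp_mem_pureStates (hfg : ∀ b, f (g b) = b) (hgf : ∀ a, g (f a) = a) {ψ : B →L[ℂ] ℂ}
    (hψ : ψ ∈ pureStates B) : ψ.comp (homCLM f) ∈ pureStates A := by
  rw [mem_pureStates_iff] at hψ ⊢
  refine ⟨comp_mem_stateSpace hfg hψ.1, fun θ hθ hdom => ?_⟩
  obtain ⟨c, hc⟩ := hψ.2 (θ.comp (homCLM g)) (hθ.comp g) (by
    have h1 := hdom.comp g
    rwa [ContinuousLinearMap.sub_comp, comp_comp_homCLM hfg] at h1)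
  refine ⟨c, ?_⟩
  rw [← comp_comp_homCLM hgf θ, hc, ContinuousLinearMap.smul_comp]

/-- Being scattered is invariant under `⋆`-isomorphism. -/
theorem IsScattered.of_equiv (hfg : ∀ b, f (g b) = b) (hgf : ∀ a, g (f a) = a)
    (hB : IsScattered B) : IsScattered A := by
  intro φ hφ
  obtain ⟨w, ψ, hw, hψ, hsum⟩ := hB _ (comp_mem_stateSpace hgf hφ)
  refine ⟨w, fun n => (ψ n).comp (homCLM f), hw, fun n => comp_mem_pureStates hfg hgf (hψ n), ?_⟩
  have h1 := hsum.mapL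
    ((ContinuousLinearMap.compL ℂ A B ℂ).flip (homCLM f))
  simpa [comp_comp_homCLM hgf, ContinuousLinearMap.smul_comp] using h1

end Transport

/-- An unconditional sum of countably many multiples of pure states is atomic. -/
theorem isAtomicFunctional_of_hasSum {ι : Type*} {φ : A →L[ℂ] ℂ} {σ : ι → A →L[ℂ] ℂ}
    (hσ : ∀ i, ∃ c : ℝ, 0 ≤ c ∧ ∃ ψ ∈ pureStates A, σ i = c • ψ) (hsum : HasSum σ φ)
    (hcount : (Function.support σ).Countable) (hne : (pureStates A).Nonempty) :
    IsAtomicFunctional φ := by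
  obtain ⟨ψ₀, hψ₀⟩ := hne
  have : Countable (Function.support σ) := hcount
  obtain ⟨f, hf⟩ := exists_injective_nat (Function.support σ)
  have h1 : HasSum (Function.extend f (σ ∘ ((↑) : Function.support σ → ι)) 0) φ :=
    (hasSum_extend_zero hf).2 (hasSum_subtype_support.2 hsum)
  have h2 : ∀ n, ∃ c : ℝ, 0 ≤ c ∧ ∃ ψ ∈ pureStates A,
      Function.extend f (σ ∘ ((↑) : Function.support σ → ι)) 0 n = c • ψ := by
    intro n
    by_cases h : ∃ i, f i = n
    · obtain ⟨i, rfl⟩ := h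
      rw [hf.extend_apply]
      exact hσ i
    · rw [Function.extend_apply' _ _ _ h]
      exact ⟨0, le_rfl, ψ₀, hψ₀, (zero_smul ℝ ψ₀).symm⟩
  choose w hw ψ hψ h using h2
  refine ⟨w, ψ, hw, hψ, ?_⟩
  rwa [← funext h]

end PositiveFunctionals

/-! ### States on the compact operators -/

section StatesOfCompacts

variable {H : Type u} [NormedAddCommGroup H] [InnerProductSpace ℂ H] [CompleteSpace H]

/-- The vector functional `T ↦ ⟪v, T v⟫` on the compact operators. -/
noncomputable def vectorFunctional (v : H) : ClosedIdeal.compactOperators H →L[ℂ] ℂ :=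
  (LinearMap.mkContinuous
    { toFun := fun T => ⟪v, (T : H →L[ℂ] H) v⟫_ℂ
      map_add' := fun S T => inner_add_right _ _ _
      map_smul' := fun c T => inner_smul_right _ _ _ } (‖v‖ ^ 2) fun T => by
    change ‖⟪v, (T : H →L[ℂ] H) v⟫_ℂ‖ ≤ _
    refine (norm_inner_le_norm _ _).trans ?_
    have h1 : ‖(T : H →L[ℂ] H) v‖ ≤ ‖T‖ * ‖v‖ := (T : H →L[ℂ] H).le_opNorm v
    calc ‖v‖ * ‖(T : H →L[ℂ] H) v‖ ≤ ‖v‖ * (‖T‖ * ‖v‖) := by gcongr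
      _ = ‖v‖ ^ 2 * ‖T‖ := by ring)

theorem vectorFunctional_apply (v : H) (T : ClosedIdeal.compactOperators H) :
    vectorFunctional v T = ⟪v, (T : H →L[ℂ] H) v⟫_ℂ := rfl

theorem norm_vectorFunctional_le (v : H) : ‖vectorFunctional v‖ ≤ ‖v‖ ^ 2 :=
  LinearMap.mkContinuous_norm_le _ (by positivity) _

theorem vectorFunctional_compactRankOne (v x y : H) :
    vectorFunctional v (compactRankOne x y) = ⟪v, x⟫_ℂ * ⟪y, v⟫_ℂ := by
  rw [vectorFunctional_apply, coe_compactRankOne, InnerProductSpace.rankOne_apply,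
    inner_smul_right, mul_comm]

theorem vectorFunctional_smul (c : ℝ) (v : H) :
    vectorFunctional (c • v) = (c ^ 2) • vectorFunctional v := by
  ext T
  simp only [vectorFunctional_apply, smul_apply, ← Complex.coe_smul, map_smul, inner_smul_left,
    inner_smul_right, Complex.conj_ofReal]
  simp only [Complex.ofReal_pow, smul_eq_mul]
  ring

theorem vectorFunctional_zero : vectorFunctional (0 : H) = 0 := by
  ext T
  rw [vectorFunctional_apply, inner_zero_left, zero_apply]

theorem isPositiveFunctional_vectorFunctional (v : H) :
    IsPositiveFunctional (vectorFunctional v) := fun T => by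
  have h1 : vectorFunctional v (star T * T) = ⟪(T : H →L[ℂ] H) v, (T : H →L[ℂ] H) v⟫_ℂ :=
    ContinuousLinearMap.adjoint_inner_right (T : H →L[ℂ] H) v ((T : H →L[ℂ] H) v)
  rw [h1]
  rw [inner_self_eq_norm_sq_to_K]
  rw [← RCLike.ofReal_pow]
  exact (RCLike.ofReal_nonneg (K := ℂ)).2 (sq_nonneg _)

theorem compactRankOne_add_left (x x' y : H) :
    compactRankOne (x + x') y = compactRankOne x y + compactRankOne x' y := by
  refine Subtype.ext (ContinuousLinearMap.ext fun z => ?_)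
  exact smul_add ⟪y, z⟫_ℂ x x'

theorem compactRankOne_add_right (x y y' : H) :
    compactRankOne x (y + y') = compactRankOne x y + compactRankOne x y' := by
  rw [← star_compactRankOne, compactRankOne_add_left, star_add, star_compactRankOne,
    star_compactRankOne]

theorem compactRankOne_smul_right (c : ℂ) (x y : H) :
    compactRankOne x (c • y) = star c • compactRankOne x y := by
  rw [← star_compactRankOne, compactRankOne_smul_left, star_smul, star_compactRankOne]

theorem compactRankOne_mul (x y z w : H) :
    compactRankOne x y * compactRankOne z w = ⟪y, z⟫_ℂ • compactRankOne x w := by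
  rw [mul_compactRankOne, coe_compactRankOne, InnerProductSpace.rankOne_apply,
    compactRankOne_smul_left]

/-- Two functionals that agree on rank-one operators are equal. -/
theorem functional_ext {φ θ : ClosedIdeal.compactOperators H →L[ℂ] ℂ}
    (h : ∀ x y, φ (compactRankOne x y) = θ (compactRankOne x y)) : φ = θ := by
  refine ContinuousLinearMap.ext fun T => compactOperators_induction
    (P := fun T => φ T = θ T) (isClosed_eq φ.continuous θ.continuous) (by simp)
    (fun S T hS hT => ?_) h T
  rw [map_add, map_add, hS, hT]

theorem norm_compactRankOne (x y : H) : ‖compactRankOne x y‖ = ‖x‖ * ‖y‖ :=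
  InnerProductSpace.norm_rankOne (𝕜 := ℂ) x y

/-- Vector states of the compact operators are pure. -/
theorem vectorFunctional_mem_pureStates {v : H} (hv : ‖v‖ = 1) :
    vectorFunctional v ∈ pureStates (ClosedIdeal.compactOperators H) := by
  have hvv : ⟪v, v⟫_ℂ = 1 := by rw [inner_self_eq_norm_sq_to_K, hv]; simp
  have hpos := isPositiveFunctional_vectorFunctional v
  refine mem_pureStates_iff.2 ⟨mem_stateSpace_iff.2 ⟨hpos, le_antisymm ?_ ?_⟩, ?_⟩
  · simpa [hv] using norm_vectorFunctional_le v
  · have h1 := (vectorFunctional v).le_opNorm (compactRankOne v v)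
    rw [vectorFunctional_compactRankOne, hvv, norm_compactRankOne, hv] at h1
    simpa using h1
  · intro θ hθ hdom
    -- `θ` vanishes on `rankOne x u` for `u ⟂ v`
    have hzero : ∀ u x : H, ⟪v, u⟫_ℂ = 0 → θ (compactRankOne x u) = 0 := by
      intro u x hu
      have h0 : star (compactRankOne v u) * compactRankOne v u = compactRankOne u u := by
        rw [star_compactRankOne, compactRankOne_mul, hvv, one_smul]
      have h1 : (θ (compactRankOne u u)).re ≤ 0 := by
        have h2 := hdom.re_nonneg (compactRankOne v u)
        rw [h0, sub_apply, vectorFunctional_compactRankOne, hu, zero_mul, zero_sub,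
          Complex.neg_re] at h2
        linarith
      have h3 := hθ.norm_sq_le (compactRankOne v u) (compactRankOne v x)
      rw [h0, star_compactRankOne, compactRankOne_mul, hvv, one_smul] at h3
      have h4 := hθ.re_nonneg (compactRankOne v x)
      rw [star_compactRankOne] at h4
      have h5 : ‖θ (compactRankOne x u)‖ ^ 2 ≤ 0 := h3.trans (mul_nonpos_of_nonneg_of_nonpos h4 h1)
      exact norm_eq_zero.1 (pow_eq_zero_iff two_ne_zero |>.1 (le_antisymm h5 (sq_nonneg _)))
    have hzero' : ∀ u x : H, ⟪v, u⟫_ℂ = 0 → θ (compactRankOne u x) = 0 := fun u x hu => by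
      rw [← star_compactRankOne, hθ.map_star, hzero u x hu, star_zero]
    obtain ⟨c, hc⟩ : ∃ c : ℝ, θ (compactRankOne v v) = c := by
      refine ⟨(θ (compactRankOne v v)).re, ?_⟩
      have h1 := hθ.ofReal_re (compactRankOne v v)
      rwa [star_compactRankOne, compactRankOne_mul, hvv, one_smul, eq_comm] at h1
    refine ⟨c, functional_ext fun x y => ?_⟩
    have hdec : ∀ x : H, ∃ u, ⟪v, u⟫_ℂ = 0 ∧ x = ⟪v, x⟫_ℂ • v + u := fun x =>
      ⟨x - ⟪v, x⟫_ℂ • v, by rw [inner_sub_right, inner_smul_right, hvv, mul_one, sub_self],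
        by abel⟩
    obtain ⟨u, hu, hxu⟩ := hdec x
    obtain ⟨u', hu', hyu⟩ := hdec y
    rw [smul_apply, vectorFunctional_compactRankOne]
    conv_lhs => rw [hxu, compactRankOne_add_left, map_add, hzero' u y hu, add_zero,
      compactRankOne_smul_left, map_smul, hyu, compactRankOne_add_right, map_add, hzero u' v hu',
      add_zero, compactRankOne_smul_right, map_smul, hc]
    rw [Complex.star_def, inner_conj_symm, ← Complex.coe_smul]
    simp only [smul_eq_mul]
    ring

/-- The density operator of a functional on the compact operators. -/
theorem exists_density (φ : ClosedIdeal.compactOperators H →L[ℂ] ℂ) :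
    ∃ ρ : H →L[ℂ] H, ∀ x y, ⟪ρ y, x⟫_ℂ = φ (compactRankOne x y) := by
  let B : H →L⋆[ℂ] H →L[ℂ] ℂ := LinearMap.mkContinuous₂
    { toFun := fun y =>
        { toFun := fun x => φ (compactRankOne x y)
          map_add' := fun x x' => by rw [compactRankOne_add_left, map_add]
          map_smul' := fun c x => by rw [compactRankOne_smul_left, map_smul, RingHom.id_apply] }
      map_add' := fun y y' => LinearMap.ext fun x => by
        change φ (compactRankOne x (y + y')) = φ (compactRankOne x y) + φ (compactRankOne x y')
        rw [compactRankOne_add_right, map_add]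
      map_smul' := fun c y => LinearMap.ext fun x => by
        change φ (compactRankOne x (c • y)) = star c • φ (compactRankOne x y)
        rw [compactRankOne_smul_right, map_smul] } ‖φ‖ fun y x => by
      change ‖φ (compactRankOne x y)‖ ≤ _
      refine (φ.le_opNorm _).trans_eq ?_
      rw [norm_compactRankOne]
      ring
  exact ⟨InnerProductSpace.continuousLinearMapOfBilin B, fun x y =>
    InnerProductSpace.continuousLinearMapOfBilin_apply B y x⟩

/-- Every state of the compact operators is a countable sum of vector functionals: if `ρ` is its
density operator, take the vectors `√ρ eᵢ` for an orthonormal basis `eᵢ`. -/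
theorem isScattered_compactOperators : IsScattered (ClosedIdeal.compactOperators H) := by
  intro φ hφ
  obtain ⟨hpos, hnorm⟩ := mem_stateSpace_iff.1 hφ
  have hone : ∀ x : H, ‖x‖ = 1 → ∀ y,
      star (compactRankOne x y) * compactRankOne x y = compactRankOne y y := fun x hx y => by
    rw [star_compactRankOne, compactRankOne_mul, inner_self_eq_norm_sq_to_K, hx]
    simp
  -- a unit vector exists, since otherwise `φ` vanishes
  obtain ⟨v₀, hv₀⟩ : ∃ v : H, ‖v‖ = 1 := by
    by_contra! h
    have hH : Subsingleton H := by
      by_contra hns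
      rw [not_subsingleton_iff_nontrivial] at hns
      obtain ⟨v, hv⟩ := exists_norm_eq H zero_le_one
      exact h v hv
    have h0 : φ = 0 := functional_ext fun x y => by
      have : compactRankOne x y = 0 := by
        rw [Subsingleton.elim x ((0 : ℂ) • x), compactRankOne_smul_left, zero_smul]
      rw [this, map_zero, map_zero]
    rw [h0, norm_zero] at hnorm
    exact zero_ne_one hnorm
  obtain ⟨ρ, hρ⟩ := exists_density φ
  have hρpos : 0 ≤ ρ := by
    rw [ContinuousLinearMap.nonneg_iff_isPositive, ContinuousLinearMap.isPositive_iff_complex]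
    intro x
    have h1 : 0 ≤ ⟪ρ x, x⟫_ℂ := by
      rw [hρ, ← hone v₀ hv₀]
      exact hpos _
    exact ⟨(Complex.conj_eq_iff_re.1 h1.isSelfAdjoint), (Complex.nonneg_iff.1 h1).1⟩
  obtain ⟨R, hR⟩ : ∃ R, R = CFC.sqrt ρ := ⟨_, rfl⟩
  have hRR : R * R = ρ := hR ▸ CFC.sqrt_mul_sqrt_self ρ hρpos
  have hRsa : ∀ x y, ⟪R x, y⟫_ℂ = ⟪x, R y⟫_ℂ := by
    have h0 : IsSelfAdjoint R := hR ▸ IsSelfAdjoint.of_nonneg (CFC.sqrt_nonneg ρ)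
    intro x y
    conv_rhs => rw [← h0.adjoint_eq, ContinuousLinearMap.adjoint_inner_right]
  have hRρ : ∀ x y, ⟪R y, R x⟫_ℂ = φ (compactRankOne x y) := fun x y => by
    rw [← hRsa, ← hρ, ← hRR]
    rfl
  obtain ⟨w, b, -⟩ := exists_hilbertBasis ℂ H
  have hterm : ∀ i, ‖R (b i)‖ ^ 2 = (φ (compactRankOne (b i) (b i))).re := fun i => by
    rw [← hRρ, inner_self_eq_norm_sq_to_K]
    norm_cast
  have hsummable : Summable fun i => ‖R (b i)‖ ^ 2 := by
    refine summable_of_sum_le (c := 1) (fun i => sq_nonneg _) fun s => ?_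
    -- the sum is `φ` of a projection
    obtain ⟨P, hP⟩ : ∃ P, P = ∑ i ∈ s, compactRankOne (b i) (b i) := ⟨_, rfl⟩
    have hPP : star P * P = P := by
      rw [hP, star_sum, Finset.sum_mul_sum]
      refine Finset.sum_congr rfl fun i hi => ?_
      rw [Finset.sum_eq_single i]
      · rw [star_compactRankOne, compactRankOne_mul, inner_self_eq_norm_sq_to_K,
          b.orthonormal.1 i]
        simp
      · intro j _ hji
        rw [star_compactRankOne, compactRankOne_mul, b.orthonormal.2 hji.symm, zero_smul]
      · exact fun h => absurd hi h
    have hPn : ‖P‖ ≤ 1 := by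
      have h1 := CStarRing.norm_star_mul_self (x := P)
      rw [hPP] at h1
      by_contra! h2
      nlinarith
    calc ∑ i ∈ s, ‖R (b i)‖ ^ 2 = (φ P).re := by
          rw [hP, map_sum, Complex.re_sum]
          exact Finset.sum_congr rfl fun i _ => hterm i
      _ ≤ ‖φ P‖ := Complex.re_le_norm _
      _ ≤ ‖φ‖ * ‖P‖ := φ.le_opNorm _
      _ ≤ 1 := by rw [hnorm, one_mul]; exact hPn
  have hsum : HasSum (fun i => vectorFunctional (R (b i))) φ := by
    have h1 : Summable fun i => vectorFunctional (R (b i)) :=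
      Summable.of_norm_bounded hsummable fun i => norm_vectorFunctional_le _
    obtain ⟨φ', hφ'⟩ := h1
    have h2 : φ' = φ := by
      refine functional_ext fun x y => ?_
      have h3 : HasSum (fun i => vectorFunctional (R (b i)) (compactRankOne x y))
          (φ' (compactRankOne x y)) :=
        hφ'.mapL (ContinuousLinearMap.apply ℂ ℂ (compactRankOne x y))
      rw [← hRρ]
      refine h3.unique ?_
      have h4 := b.hasSum_inner_mul_inner (R y) (R x)
      refine h4.congr_fun fun i => ?_
      rw [vectorFunctional_compactRankOne, hRsa, ← hRsa y, mul_comm]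
    rwa [h2] at hφ'
  refine isAtomicFunctional_of_hasSum (fun i => ?_) hsum ?_ ⟨_, vectorFunctional_mem_pureStates hv₀⟩
  · by_cases h0 : R (b i) = 0
    · refine ⟨0, le_rfl, _, vectorFunctional_mem_pureStates hv₀, ?_⟩
      rw [h0, vectorFunctional_zero]
      exact (zero_smul ℝ (vectorFunctional v₀)).symm
    · have hn : ‖R (b i)‖ ≠ 0 := norm_ne_zero_iff.2 h0
      refine ⟨‖R (b i)‖ ^ 2, by positivity, vectorFunctional (‖R (b i)‖⁻¹ • R (b i)),
        vectorFunctional_mem_pureStates ?_, ?_⟩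
      · rw [norm_smul, norm_inv, norm_norm, inv_mul_cancel₀ hn]
      · rw [← vectorFunctional_smul, smul_inv_smul₀ hn]
  · refine hsummable.countable_support.mono fun i hi => Function.mem_support.2 fun h0 => hi ?_
    have h1 : R (b i) = 0 := by simpa using h0
    simp only [h1, vectorFunctional_zero]

theorem IsElementary.isScattered {J : Type u} [NonUnitalCStarAlgebra J] (hJ : IsElementary J) :
    IsScattered J := by
  obtain ⟨H, _, _, _, ⟨e⟩⟩ := hJ
  exact isScattered_compactOperators.of_equiv (f := e.toNonUnitalStarAlgHom)
    (g := e.symm.toNonUnitalStarAlgHom) e.apply_symm_apply e.symm_apply_apply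

end StatesOfCompacts

/-! ### The GNS construction and the Radon–Nikodym theorem -/

section GNS

variable {A : Type u} [NonUnitalCStarAlgebra A]

/-- The GNS representation of a positive functional `φ`, with its cyclic vector, together with
the Radon–Nikodym derivatives of the functionals dominated by `φ`. -/
theorem IsPositiveFunctional.exists_gns {φ : A →L[ℂ] ℂ} (hφ : IsPositiveFunctional φ) :
    ∃ (H : Type u) (_ : NormedAddCommGroup H) (_ : InnerProductSpace ℂ H) (_ : CompleteSpace H)
      (π : A →⋆ₙₐ[ℂ] (H →L[ℂ] H)) (ξ : H), DenseRange (fun a => π a ξ) ∧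
      (∀ a, ⟪ξ, π a ξ⟫_ℂ = φ a) ∧
      ∀ θ : A →L[ℂ] ℂ, IsPositiveFunctional θ → IsPositiveFunctional (φ - θ) →
        ∃ T : H →L[ℂ] H, 0 ≤ T ∧ ‖T‖ ≤ 1 ∧ ∀ a b, ⟪π a ξ, T (π b ξ)⟫_ℂ = θ (star a * b) := by
  let := CStarAlgebra.spectralOrder A
  have := CStarAlgebra.spectralOrderedRing A
  let f := hφ.toPositiveLinearMap
  have hnorm : ∀ a : A, ‖f.toPreGNS a‖ ^ 2 = (φ (star a * a)).re := fun a => by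
    have h4 := congrArg Complex.re (f.preGNS_norm_sq (f.toPreGNS a))
    rw [← Complex.ofReal_pow, Complex.ofReal_re] at h4
    exact h4
  let π := f.gnsNonUnitalStarAlgHom
  let Λ : A → f.GNS := fun a => ((f.toPreGNS a : f.PreGNS) : f.GNS)
  have hΛd : DenseRange Λ := UniformSpace.Completion.denseRange_coe (α := f.PreGNS)
  have hΛi : ∀ a b, ⟪Λ a, Λ b⟫_ℂ = φ (star a * b) := fun a b =>
    UniformSpace.Completion.inner_coe (f.toPreGNS a) (f.toPreGNS b)
  have hπΛ : ∀ a b, π a (Λ b) = Λ (a * b) := fun a b =>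
    f.gnsNonUnitalStarAlgHom_apply_coe
  -- the functional `Λ a ↦ φ a` is bounded, hence given by a vector `ξ`
  let g : f.PreGNS →L[ℂ] ℂ :=
    ((φ : A →ₗ[ℂ] ℂ) ∘ₗ f.ofPreGNS.toLinearMap).mkContinuous (√‖φ‖) fun a => by
      refine le_of_sq_le_sq ?_ (by positivity)
      rw [mul_pow, Real.sq_sqrt (norm_nonneg _)]
      have := hφ.norm_apply_sq_le (f.ofPreGNS a)
      rwa [← hnorm] at this
  let ξ : f.GNS := (InnerProductSpace.toDual ℂ f.GNS).symm g.fromCompletion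
  have hξ : ∀ a, ⟪ξ, Λ a⟫_ℂ = φ a := fun a => by
    rw [InnerProductSpace.toDual_symm_apply]
    exact g.fromCompletion_apply_coe (f.toPreGNS a)
  have hπξ : ∀ a, π a ξ = Λ a := fun a => by
    have h0 : (fun y => ⟪π a ξ, y⟫_ℂ) ∘ Λ = (fun y => ⟪Λ a, y⟫_ℂ) ∘ Λ → π a ξ = Λ a := fun h =>
      ext_inner_right ℂ fun y => congrFun (hΛd.equalizer (by fun_prop) (by fun_prop) h) y
    refine h0 (funext fun b => ?_)
    have h1 : ⟪π a ξ, Λ b⟫_ℂ = ⟪ξ, π (star a) (Λ b)⟫_ℂ := by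
      rw [StarHomClass.map_star, ContinuousLinearMap.star_eq_adjoint,
        ContinuousLinearMap.adjoint_inner_right]
    simp only [Function.comp_apply, h1, hπΛ, hξ, hΛi]
  refine ⟨f.GNS, inferInstance, inferInstance, inferInstance, π, ξ, ?_, ?_, ?_⟩
  · simpa only [hπξ] using hΛd
  · intro a
    rw [hπξ, hξ]
  · intro θ hθ hle
    let k := hθ.toPositiveLinearMap
    have hk : ∀ a : A, ‖k.toPreGNS a‖ ^ 2 = (θ (star a * a)).re := fun a => by
      have h4 := congrArg Complex.re (k.preGNS_norm_sq (k.toPreGNS a))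
      rw [← Complex.ofReal_pow, Complex.ofReal_re] at h4
      exact h4
    let V : f.PreGNS →L[ℂ] k.PreGNS :=
      (k.toPreGNS.toLinearMap ∘ₗ f.ofPreGNS.toLinearMap).mkContinuous 1 fun a => by
        refine le_of_sq_le_sq ?_ (by positivity)
        have h1 := hle.re_nonneg (f.ofPreGNS a)
        rw [sub_apply, Complex.sub_re, ← hnorm, ← hk] at h1
        rw [one_mul]
        exact sub_nonneg.1 h1
    let W : f.GNS →L[ℂ] k.GNS := V.completion
    have hW : ∀ a, W (Λ a) = ((k.toPreGNS a : k.PreGNS) : k.GNS) := fun a =>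
      ContinuousLinearMap.completion_apply_coe V (f.toPreGNS a)
    have hW1 : ‖W‖ ≤ 1 := by
      refine W.opNorm_le_bound zero_le_one fun x => ?_
      induction x using UniformSpace.Completion.induction_on with
      | hp => exact isClosed_le (by fun_prop) (by fun_prop)
      | ih a =>
        rw [ContinuousLinearMap.completion_apply_coe, UniformSpace.Completion.norm_coe,
          UniformSpace.Completion.norm_coe]
        exact LinearMap.mkContinuous_norm_le _ zero_le_one _ |> V.le_of_opNorm_le <| a
    refine ⟨ContinuousLinearMap.adjoint W ∘L W, ?_, ?_, fun a b => ?_⟩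
    · exact (ContinuousLinearMap.nonneg_iff_isPositive _).2
        (ContinuousLinearMap.isPositive_adjoint_comp_self W)
    · rw [ContinuousLinearMap.norm_adjoint_comp_self]
      exact mul_le_one₀ hW1 (norm_nonneg _) hW1
    · rw [ContinuousLinearMap.comp_apply, ContinuousLinearMap.adjoint_inner_right, hπξ, hπξ, hW, hW]
      exact UniformSpace.Completion.inner_coe (k.toPreGNS a) (k.toPreGNS b)

end GNS

/-! ### Order intervals below atomic functionals are totally bounded -/

/-- The inequality `s² ≤ ‖s‖ s` for a positive element `s`. -/
theorem mul_self_le_norm_smul {B : Type*} [CStarAlgebra B] [PartialOrder B] [StarOrderedRing B]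
    {s : B} (hs : 0 ≤ s) : s * s ≤ ‖s‖ • s := by
  have h1 : CFC.sqrt s * CFC.sqrt s = s := CFC.sqrt_mul_sqrt_self s hs
  have h2 : star (CFC.sqrt s) = CFC.sqrt s := (CFC.sqrt_nonneg s).isSelfAdjoint
  have h3 : star (CFC.sqrt s) * s * CFC.sqrt s ≤ ‖s‖ • (star (CFC.sqrt s) * CFC.sqrt s) :=
    CStarAlgebra.star_left_conjugate_le_norm_smul hs.isSelfAdjoint
  rw [h2, h1] at h3
  refine le_of_eq_of_le ?_ h3
  calc s * s = (CFC.sqrt s * CFC.sqrt s) * (CFC.sqrt s * CFC.sqrt s) := by rw [h1]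
    _ = CFC.sqrt s * (CFC.sqrt s * CFC.sqrt s) * CFC.sqrt s := by simp only [mul_assoc]
    _ = _ := by rw [h1]

section OrderInterval

variable {A : Type u} [NonUnitalCStarAlgebra A]

/-- A functional `σ` spans an extreme ray of the positive cone: every positive functional dominated
by a multiple of `σ` is a multiple of `σ`. -/
def IsExtremeRay (σ : A →L[ℂ] ℂ) : Prop :=
  ∀ (θ : A →L[ℂ] ℂ) (C : ℝ), IsPositiveFunctional θ → IsPositiveFunctional (C • σ - θ) →
    ∃ c : ℝ, θ = c • σ

theorem IsPositiveFunctional.eq_zero_of_neg {θ : A →L[ℂ] ℂ} (h : IsPositiveFunctional θ)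
    (h' : IsPositiveFunctional (-θ)) : θ = 0 := by
  have h1 := h.norm_add h'
  rw [add_neg_cancel, norm_zero, norm_neg] at h1
  exact norm_eq_zero.1 (by linarith [norm_nonneg θ])

theorem isExtremeRay_smul_of_mem_pureStates {ψ : A →L[ℂ] ℂ} (hψ : ψ ∈ pureStates A) (w : ℝ) :
    IsExtremeRay (w • ψ) := by
  intro θ C hθ hle
  obtain ⟨hst, hdom⟩ := mem_pureStates_iff.1 hψ
  rw [mem_stateSpace_iff] at hst
  rw [smul_smul] at hle
  rcases le_or_gt (C * w) 0 with h0 | h0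
  · have h1 : IsPositiveFunctional (-θ) := by
      have h2 := hle.add (hst.1.smul (neg_nonneg.2 h0))
      have h3 : (C * w) • ψ - θ + (-(C * w)) • ψ = -θ := by
        ext a
        simp only [add_apply, sub_apply, smul_apply, neg_apply, Complex.real_smul,
          Complex.ofReal_neg]
        ring
      rwa [h3] at h2
    exact ⟨0, by rw [hθ.eq_zero_of_neg h1]; exact (zero_smul ℝ (w • ψ)).symm⟩
  · have hw0 : w ≠ 0 := fun h => by simp [h] at h0
    have hpos : 0 ≤ (C * w)⁻¹ := inv_nonneg.2 h0.le
    obtain ⟨c, hc⟩ := hdom ((C * w)⁻¹ • θ) (hθ.smul hpos) (by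
      have h2 := hle.smul hpos
      rwa [smul_sub, inv_smul_smul₀ h0.ne'] at h2)
    refine ⟨C * w * c * w⁻¹, ?_⟩
    rw [mul_smul, inv_smul_smul₀ hw0, mul_smul, ← hc, smul_inv_smul₀ h0.ne']

variable {H : Type u} [NormedAddCommGroup H] [InnerProductSpace ℂ H] [CompleteSpace H]

/-- `T` is the Radon–Nikodym derivative of `θ` with respect to the vector functional of `ξ`. -/
def IsRNDeriv (π : A →⋆ₙₐ[ℂ] (H →L[ℂ] H)) (ξ : H) (θ : A →L[ℂ] ℂ) (T : H →L[ℂ] H) : Prop :=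
  ∀ a b, ⟪π a ξ, T (π b ξ)⟫_ℂ = θ (star a * b)

/-- The commutant of a representation. -/
noncomputable def repCommutant (π : A →⋆ₙₐ[ℂ] (H →L[ℂ] H)) : StarSubalgebra ℂ (H →L[ℂ] H) :=
  StarSubalgebra.centralizer ℂ (Set.range π)

variable {π : A →⋆ₙₐ[ℂ] (H →L[ℂ] H)} {ξ : H} {θ : A →L[ℂ] ℂ} {T : H →L[ℂ] H}

theorem rep_inner_left (π : A →⋆ₙₐ[ℂ] (H →L[ℂ] H)) (a : A) (x y : H) :
    ⟪π a x, y⟫_ℂ = ⟪x, π (star a) y⟫_ℂ := by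
  rw [StarHomClass.map_star, ContinuousLinearMap.star_eq_adjoint,
    ContinuousLinearMap.adjoint_inner_right]

theorem mem_repCommutant : T ∈ repCommutant π ↔ ∀ a, π a * T = T * π a := by
  rw [repCommutant, StarSubalgebra.mem_centralizer_iff]
  constructor
  · intro h a
    exact (h _ ⟨a, rfl⟩).1
  · rintro h _ ⟨a, rfl⟩
    refine ⟨h a, ?_⟩
    rw [← StarHomClass.map_star]
    exact h _

theorem rep_commutant_apply (hT : T ∈ repCommutant π) (a : A) (x : H) : T (π a x) = π a (T x) :=
  (DFunLike.congr_fun (mem_repCommutant.1 hT a) x).symm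

/-- An operator is determined by its matrix coefficients on a dense range. -/
theorem eq_of_inner_rep (hd : DenseRange fun a => π a ξ) {T S : H →L[ℂ] H}
    (h : ∀ a b, ⟪π a ξ, T (π b ξ)⟫_ℂ = ⟪π a ξ, S (π b ξ)⟫_ℂ) : T = S := by
  have h1 : ∀ b, T (π b ξ) = S (π b ξ) := fun b => by
    have h2 : (fun y => ⟪y, T (π b ξ)⟫_ℂ) ∘ (fun a => π a ξ)
        = (fun y => ⟪y, S (π b ξ)⟫_ℂ) ∘ fun a => π a ξ := funext fun a => h a b
    exact ext_inner_left ℂ fun y => congrFun (hd.equalizer (by fun_prop) (by fun_prop) h2) y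
  exact DFunLike.coe_injective (hd.equalizer T.continuous S.continuous (funext h1))

namespace IsRNDeriv

theorem unique (hd : DenseRange fun a => π a ξ) {S : H →L[ℂ] H} (hT : IsRNDeriv π ξ θ T)
    (hS : IsRNDeriv π ξ θ S) : T = S :=
  eq_of_inner_rep hd fun a b => (hT a b).trans (hS a b).symm

theorem add {θ' : A →L[ℂ] ℂ} {T' : H →L[ℂ] H} (hT : IsRNDeriv π ξ θ T)
    (hT' : IsRNDeriv π ξ θ' T') : IsRNDeriv π ξ (θ + θ') (T + T') := fun a b => by
  rw [add_apply, inner_add_right, hT, hT', add_apply]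

theorem sum {ι : Type*} (s : Finset ι) {θ : ι → A →L[ℂ] ℂ} {T : ι → H →L[ℂ] H}
    (hT : ∀ i, IsRNDeriv π ξ (θ i) (T i)) : IsRNDeriv π ξ (∑ i ∈ s, θ i) (∑ i ∈ s, T i) := by
  classical
  induction s using Finset.induction_on with
  | empty => intro a b; simp
  | insert i s hi ih =>
    rw [Finset.sum_insert hi, Finset.sum_insert hi]
    exact (hT i).add ih

theorem mem_repCommutant (hd : DenseRange fun a => π a ξ) (hT : IsRNDeriv π ξ θ T) :
    T ∈ repCommutant π := by
  rw [_root_.mem_repCommutant]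
  refine fun c => eq_of_inner_rep hd fun a b => ?_
  have h1 : ⟪π a ξ, π c (T (π b ξ))⟫_ℂ = ⟪π (star c * a) ξ, T (π b ξ)⟫_ℂ := by
    rw [map_mul, mul_apply_eq_comp, rep_inner_left π (star c), star_star]
  have h2 : π c (π b ξ) = π (c * b) ξ := by rw [map_mul, mul_apply_eq_comp]
  rw [mul_apply_eq_comp, mul_apply_eq_comp, h1, h2, hT, hT, star_mul, star_star, mul_assoc]

end IsRNDeriv

/-- Approximate units converge to the identity on a cyclic vector. -/
theorem tendsto_rep_cyclic (hd : DenseRange fun a => π a ξ) {l : Filter A}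
    (he : ∀ᶠ e in l, star e = e ∧ ‖e‖ ≤ 1) (ht : ∀ x, Tendsto (fun e => e * x) l (𝓝 x)) :
    Tendsto (fun e => π e ξ) l (𝓝 ξ) := by
  rw [Metric.tendsto_nhds]
  intro ε hε
  obtain ⟨a, ha⟩ := hd.exists_dist_lt ξ (by positivity : 0 < ε / 3)
  have h1 : ∀ᶠ e in l, dist (π (e * a) ξ) (π a ξ) < ε / 3 := by
    have h2 : Continuous fun x => π x ξ := π.continuous_of_cstar.clm_apply continuous_const
    exact Metric.tendsto_nhds.1 ((h2.tendsto a).comp (ht a)) _ (by positivity)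
  filter_upwards [he, h1] with e h2 h3
  have h4 : dist (π e ξ) (π (e * a) ξ) < ε / 3 := by
    rw [map_mul, mul_apply_eq_comp, dist_eq_norm, ← map_sub]
    refine lt_of_le_of_lt ((π e).le_opNorm _) ?_
    have h5 := (NonUnitalStarAlgHom.norm_apply_le π e).trans h2.2
    rw [dist_eq_norm] at ha
    nlinarith [norm_nonneg (ξ - π a ξ), norm_nonneg (π e)]
  calc dist (π e ξ) ξ ≤ dist (π e ξ) (π (e * a) ξ) + dist (π (e * a) ξ) (π a ξ) + dist (π a ξ) ξ :=
        dist_triangle4 _ _ _ _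
    _ < ε / 3 + ε / 3 + ε / 3 := by rw [dist_comm (π a ξ)]; gcongr
    _ = ε := by ring

theorem IsRNDeriv.inner_apply (hd : DenseRange fun a => π a ξ) (hT : IsRNDeriv π ξ θ T) (b : A) :
    ⟪ξ, T (π b ξ)⟫_ℂ = θ b := by
  obtain ⟨l, hl, he, ht⟩ := exists_approxUnit A
  have h1 : Tendsto (fun e => ⟪π e ξ, T (π b ξ)⟫_ℂ) l (𝓝 ⟪ξ, T (π b ξ)⟫_ℂ) :=
    (tendsto_rep_cyclic hd he fun x => (ht x).2).inner tendsto_const_nhds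
  have h2 : Tendsto (fun e => θ (e * b)) l (𝓝 (θ b)) :=
    (θ.continuous.tendsto b).comp (ht b).2
  refine tendsto_nhds_unique h1 (h2.congr' ?_)
  filter_upwards [he] with e h
  rw [hT, h.1]

/-- The norm of `Tξ` is controlled by the norm of the functional with density `T`. -/
theorem IsRNDeriv.norm_apply_sq_le (hd : DenseRange fun a => π a ξ) (hT : IsRNDeriv π ξ θ T)
    (h0 : 0 ≤ T) (h1 : ‖T‖ ≤ 1) : ‖T ξ‖ ^ 2 ≤ ‖θ‖ := by
  have h2 : ‖⟪ξ, T ξ⟫_ℂ‖ ≤ ‖θ‖ := by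
    obtain ⟨l, hl, he, ht⟩ := exists_approxUnit A
    have h1 : Tendsto (fun e => ‖⟪ξ, T (π e ξ)⟫_ℂ‖) l (𝓝 ‖⟪ξ, T ξ⟫_ℂ‖) :=
      (tendsto_const_nhds.inner
        ((T.continuous.tendsto ξ).comp (tendsto_rep_cyclic hd he fun x => (ht x).2))).norm
    refine le_of_tendsto h1 ?_
    filter_upwards [he] with e h
    rw [hT.inner_apply hd]
    exact (θ.le_opNorm e).trans (mul_le_of_le_one_right (norm_nonneg _) h.2)
  obtain ⟨R, rfl⟩ := CStarAlgebra.nonneg_iff_eq_star_mul_self.1 h0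
  have h3 : ⟪ξ, (star R * R) ξ⟫_ℂ = ((‖R ξ‖ ^ 2 : ℝ) : ℂ) := by
    rw [mul_apply_eq_comp, ContinuousLinearMap.star_eq_adjoint,
      ContinuousLinearMap.adjoint_inner_right, inner_self_eq_norm_sq_to_K]
    norm_cast
  rw [h3, Complex.norm_real, Real.norm_of_nonneg (sq_nonneg _)] at h2
  rw [CStarRing.norm_star_mul_self] at h1
  have h4 : ‖(star R * R) ξ‖ ≤ ‖R‖ * ‖R ξ‖ := by
    rw [mul_apply_eq_comp, ← norm_star R]
    exact (star R).le_opNorm _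
  have h5 := norm_nonneg ((star R * R) ξ)
  calc ‖(star R * R) ξ‖ ^ 2 ≤ (‖R‖ * ‖R ξ‖) ^ 2 := by gcongr
    _ = ‖R‖ * ‖R‖ * ‖R ξ‖ ^ 2 := by ring
    _ ≤ 1 * ‖R ξ‖ ^ 2 := by gcongr
    _ ≤ ‖θ‖ := by rw [one_mul]; exact h2

/-- An element `T` of the commutant is the Radon–Nikodym derivative of `a ↦ ⟪ξ, T π(a) ξ⟫`. -/
theorem exists_isRNDeriv (hT : T ∈ repCommutant π) (ξ : H) :
    ∃ θ : A →L[ℂ] ℂ, IsRNDeriv π ξ θ T := by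
  refine ⟨((innerSL ℂ ξ).comp (T.comp (ContinuousLinearMap.apply ℂ H ξ))).comp (homCLM π),
    fun a b => ?_⟩
  change ⟪π a ξ, T (π b ξ)⟫_ℂ = ⟪ξ, T (π (star a * b) ξ)⟫_ℂ
  rw [map_mul, mul_apply_eq_comp, rep_inner_left, rep_commutant_apply hT (star a)]

theorem IsRNDeriv.isPositiveFunctional (hT : IsRNDeriv π ξ θ T) (h0 : 0 ≤ T) :
    IsPositiveFunctional θ := fun a => by
  rw [← hT]
  exact ((ContinuousLinearMap.nonneg_iff_isPositive T).1 h0).inner_nonneg_right _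

/-- The density `S` of an extreme functional is a minimal element of the commutant:
`S T S` is a multiple of `S` for `T` in the commutant. -/
theorem exists_mul_mul_eq_smul_of_nonneg (hd : DenseRange fun a => π a ξ) {σ : A →L[ℂ] ℂ}
    (hσ : IsExtremeRay σ) {S : H →L[ℂ] H} (hS : IsRNDeriv π ξ σ S) (hS0 : 0 ≤ S)
    (hT : T ∈ repCommutant π) (hT0 : 0 ≤ T) : ∃ c : ℂ, S * T * S = c • S := by
  have hSc := hS.mem_repCommutant hd
  have hSs : star S = S := hS0.isSelfAdjoint
  obtain ⟨θ, hθ⟩ := exists_isRNDeriv (mul_mem (mul_mem hSc hT) hSc) ξ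
  have h1 : 0 ≤ S * T * S := by
    have h2 := star_left_conjugate_nonneg hT0 S
    rwa [hSs] at h2
  -- `S T S ≤ ‖T‖ S² ≤ ‖T‖ ‖S‖ S`
  have h2 : S * T * S ≤ (‖T‖ * ‖S‖) • S := by
    have h3 : star S * T * S ≤ ‖T‖ • (star S * S) :=
      CStarAlgebra.star_left_conjugate_le_norm_smul hT0.isSelfAdjoint
    rw [hSs] at h3
    refine h3.trans ?_
    rw [mul_smul]
    exact smul_le_smul_of_nonneg_left (mul_self_le_norm_smul hS0) (norm_nonneg T)
  have h3 : IsRNDeriv π ξ ((‖T‖ * ‖S‖) • σ - θ) ((‖T‖ * ‖S‖) • S - S * T * S) := fun a b => by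
    rw [sub_apply, inner_sub_right, hθ, sub_apply, smul_apply, smul_apply, ← hS a b,
      inner_smul_right_eq_smul]
  obtain ⟨c, hc⟩ := hσ θ _ (hθ.isPositiveFunctional h1)
    (h3.isPositiveFunctional (sub_nonneg.2 h2))
  refine ⟨c, eq_of_inner_rep hd fun a b => ?_⟩
  rw [hθ, hc, smul_apply, smul_apply, ← hS a b, inner_smul_right]
  exact Complex.real_smul

theorem exists_mul_mul_eq_smul (hd : DenseRange fun a => π a ξ) {σ : A →L[ℂ] ℂ}
    (hσ : IsExtremeRay σ) {S : H →L[ℂ] H} (hS : IsRNDeriv π ξ σ S) (hS0 : 0 ≤ S)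
    (hT : T ∈ repCommutant π) : ∃ c : ℂ, S * T * S = c • S := by
  have hsa : ∀ X ∈ repCommutant π, IsSelfAdjoint X → ∃ c : ℂ, S * X * S = c • S := by
    intro X hX hXs
    have h1 : 0 ≤ X + algebraMap ℝ (H →L[ℂ] H) ‖X‖ := by
      rw [← neg_le_iff_add_nonneg]
      exact hXs.neg_algebraMap_norm_le_self
    have h2 : algebraMap ℝ (H →L[ℂ] H) ‖X‖ = (‖X‖ : ℂ) • 1 := by
      rw [Algebra.algebraMap_eq_smul_one]
      exact (Complex.coe_smul _ _).symm
    rw [h2] at h1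
    obtain ⟨c, hc⟩ := exists_mul_mul_eq_smul_of_nonneg hd hσ hS hS0
      (add_mem hX (SMulMemClass.smul_mem _ (one_mem _))) h1
    obtain ⟨d, hdd⟩ := exists_mul_mul_eq_smul_of_nonneg hd hσ hS hS0 (one_mem (repCommutant π))
      zero_le_one
    refine ⟨c - ‖X‖ * d, ?_⟩
    rw [mul_add, add_mul, mul_smul_comm, smul_mul_assoc, hdd] at hc
    rw [sub_smul, ← hc, mul_smul, add_sub_cancel_right]
  have hst : star T ∈ repCommutant π := star_mem hT
  obtain ⟨c, hc⟩ := hsa (T + star T) (add_mem hT hst) (IsSelfAdjoint.add_star_self T)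
  obtain ⟨d, hdd⟩ := hsa (Complex.I • (T - star T)) (SMulMemClass.smul_mem _ (sub_mem hT hst)) (by
    rw [IsSelfAdjoint, star_smul, star_sub, star_star, Complex.star_def, Complex.conj_I, neg_smul,
      ← smul_neg, neg_sub])
  refine ⟨(1 / 2) * c - (Complex.I / 2) * d, ?_⟩
  have h1 : T = (1 / 2 : ℂ) • (T + star T) - (Complex.I / 2) • (Complex.I • (T - star T)) := by
    rw [smul_smul, show Complex.I / 2 * Complex.I = -(1 / 2 : ℂ) by
      rw [div_mul_eq_mul_div, Complex.I_mul_I]; ring]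
    module
  rw [sub_smul, mul_smul, mul_smul, ← hc, ← hdd]
  conv_lhs => rw [h1]
  simp only [mul_sub, sub_mul, mul_smul_comm, smul_mul_assoc]

/-- Between two minimal elements `S₁, S₂` of the commutant, `S₁ T S₂` ranges over a line. -/
theorem exists_forall_mul_mul_eq_smul (hd : DenseRange fun a => π a ξ) {σ₁ σ₂ : A →L[ℂ] ℂ}
    (hσ₁ : IsExtremeRay σ₁) (hσ₂ : IsExtremeRay σ₂) {S₁ S₂ : H →L[ℂ] H}
    (hS₁ : IsRNDeriv π ξ σ₁ S₁) (hS₂ : IsRNDeriv π ξ σ₂ S₂) (h₁ : 0 ≤ S₁) (h₂ : 0 ≤ S₂) :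
    ∃ X : H →L[ℂ] H, ∀ T ∈ repCommutant π, ∃ c : ℂ, S₁ * T * S₂ = c • X := by
  by_cases hall : ∀ T ∈ repCommutant π, S₁ * T * S₂ = 0
  · exact ⟨0, fun T hT => ⟨0, by rw [hall T hT, smul_zero]⟩⟩
  push Not at hall
  obtain ⟨T₀, hT₀, h0⟩ := hall
  refine ⟨S₁ * T₀ * S₂, fun T hT => ?_⟩
  have hc₁ := hS₁.mem_repCommutant hd
  have hc₂ := hS₂.mem_repCommutant hd
  obtain ⟨c, hc⟩ := exists_mul_mul_eq_smul hd hσ₁ hS₁ h₁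
    (mul_mem (mul_mem hT hc₂) (star_mem hT₀))
  obtain ⟨d, hdd⟩ := exists_mul_mul_eq_smul hd hσ₂ hS₂ h₂
    (mul_mem (mul_mem (star_mem hT₀) hc₁) hT₀)
  have hd0 : d ≠ 0 := by
    rintro rfl
    rw [zero_smul] at hdd
    obtain ⟨R, hR⟩ := CStarAlgebra.nonneg_iff_eq_star_mul_self.1 h₁
    have h3 : star (R * T₀ * S₂) * (R * T₀ * S₂) = 0 := by
      rw [← hdd, hR, star_mul, star_mul, h₂.isSelfAdjoint.star_eq]
      simp only [mul_assoc]
    rw [CStarRing.star_mul_self_eq_zero_iff] at h3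
    apply h0
    rw [hR, mul_assoc, mul_assoc, ← mul_assoc R, h3, mul_zero]
  refine ⟨d⁻¹ * c, ?_⟩
  have h4 : d • (S₁ * T * S₂) = c • (S₁ * T₀ * S₂) := by
    calc d • (S₁ * T * S₂) = S₁ * T * (d • S₂) := by rw [mul_smul_comm]
      _ = S₁ * (T * S₂ * star T₀) * S₁ * (T₀ * S₂) := by rw [← hdd]; simp only [mul_assoc]
      _ = c • (S₁ * T₀ * S₂) := by rw [hc, smul_mul_assoc, mul_assoc]
  rw [mul_smul, ← h4, inv_smul_smul₀ hd0]

/-- A sequence of positive functionals dominated by an atomic functional has terms of arbitrarily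
small distance. Compressed by the density of a finite sum of extreme functionals, the
Radon–Nikodym derivatives stay in a finite-dimensional space. -/
theorem exists_norm_sub_lt_of_hasSum {φ : A →L[ℂ] ℂ} (hφ : IsPositiveFunctional φ)
    {σ : ℕ → A →L[ℂ] ℂ} (hσ : ∀ i, IsPositiveFunctional (σ i)) (hσe : ∀ i, IsExtremeRay (σ i))
    (hsum : HasSum σ φ) {θ : ℕ → A →L[ℂ] ℂ} (hθ : ∀ n, IsPositiveFunctional (θ n))
    (hθφ : ∀ n, IsPositiveFunctional (φ - θ n)) {ε : ℝ} (hε : 0 < ε) :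
    ∃ n m, n < m ∧ ‖θ n - θ m‖ < ε := by
  obtain ⟨H, _, _, _, π, ξ, hd, hξ, hRN⟩ := hφ.exists_gns
  have htail : ∀ s : Finset ℕ, IsPositiveFunctional (φ - ∑ i ∈ s, σ i) := fun s a => by
    have h1 : HasSum (fun i => σ i (star a * a)) (φ (star a * a)) :=
      hsum.mapL (ContinuousLinearMap.apply ℂ ℂ (star a * a))
    rw [sub_apply, sum_apply, sub_nonneg]
    exact sum_le_hasSum s (fun i _ => hσ i a) h1
  have hpart : ∀ s : Finset ℕ, IsPositiveFunctional (∑ i ∈ s, σ i) := fun s a => by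
    rw [sum_apply]
    exact Finset.sum_nonneg fun i _ => hσ i a
  choose T hT0 hT1 hT using fun n => hRN (θ n) (hθ n) (hθφ n)
  choose S hS0 hS1 hS using fun i => hRN (σ i) (hσ i) (by simpa using htail {i})
  change ∀ n, IsRNDeriv π ξ (θ n) (T n) at hT
  change ∀ n, IsRNDeriv π ξ (σ n) (S n) at hS
  -- choose a partial sum whose density `Q` almost fixes `ξ`
  obtain ⟨δ, hδ, hδε⟩ : ∃ δ > 0, 4 * ‖ξ‖ * δ + ‖ξ‖ * δ < ε := by
    refine ⟨ε / (5 * ‖ξ‖ + 1), by positivity, ?_⟩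
    rw [← add_mul, ← mul_div_assoc, div_lt_iff₀ (by positivity)]
    nlinarith [norm_nonneg ξ]
  obtain ⟨s, hs⟩ : ∃ s : Finset ℕ, ‖φ - ∑ i ∈ s, σ i‖ < δ ^ 2 := by
    obtain ⟨s, hs⟩ := (Metric.tendsto_nhds.1 hsum (δ ^ 2) (by positivity)).exists
    exact ⟨s, by rwa [dist_comm, dist_eq_norm] at hs⟩
  obtain ⟨Q, hQ0, hQ1, hQ⟩ := hRN _ (hpart s) (htail s)
  obtain ⟨P, hP0, hP1, hP⟩ := hRN _ (htail s) (by rw [sub_sub_cancel]; exact hpart s)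
  change IsRNDeriv π ξ _ Q at hQ
  change IsRNDeriv π ξ _ P at hP
  have hQS : Q = ∑ i ∈ s, S i := hQ.unique hd (IsRNDeriv.sum s hS)
  have hφ1 : IsRNDeriv π ξ φ 1 := fun a b => by
    rw [one_apply_eq_self, rep_inner_left, ← hξ, map_mul, mul_apply_eq_comp]
  have hPQ : Q + P = 1 := by
    have h1 := hQ.add hP
    rw [add_sub_cancel] at h1
    exact h1.unique hd hφ1
  have hη : ‖P ξ‖ < δ := lt_of_pow_lt_pow_left₀ 2 hδ.le
    ((hP.norm_apply_sq_le hd hP0 hP1).trans_lt hs)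
  have hξQ : ξ = Q ξ + P ξ := by
    rw [← add_apply, hPQ, one_apply_eq_self]
  have hQc := hQ.mem_repCommutant hd
  -- the vectors `Q Tₙ Q ξ` stay in a finite-dimensional space
  choose X hX using fun ij : ℕ × ℕ =>
    exists_forall_mul_mul_eq_smul hd (hσe ij.1) (hσe ij.2) (hS ij.1) (hS ij.2) (hS0 _) (hS0 _)
  let E : Submodule ℂ H := Submodule.span ℂ ((fun ij => X ij ξ) '' (s ×ˢ s : Finset (ℕ × ℕ)))
  have : FiniteDimensional ℂ E :=
    FiniteDimensional.span_of_finite ℂ ((Finset.finite_toSet _).image _)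
  have : ProperSpace E := FiniteDimensional.proper ℂ E
  have hmem : ∀ n, Q (T n (Q ξ)) ∈ E := fun n => by
    have h1 : Q (T n (Q ξ)) = ∑ i ∈ s, ∑ j ∈ s, (S i * T n * S j) ξ := by
      have h2 : Q * T n * Q = ∑ i ∈ s, ∑ j ∈ s, S i * T n * S j := by
        rw [hQS, Finset.sum_mul, Finset.sum_mul_sum]
      change (Q * T n * Q) ξ = _
      rw [h2]
      simp only [sum_apply]
    rw [h1]
    refine Submodule.sum_mem _ fun i hi => Submodule.sum_mem _ fun j hj => ?_
    obtain ⟨c, hc⟩ := hX (i, j) (T n) ((hT n).mem_repCommutant hd)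
    rw [hc, smul_apply]
    exact Submodule.smul_mem _ _ (Submodule.subset_span ⟨(i, j), by simp [hi, hj], rfl⟩)
  have hbdd : ∀ n, (⟨_, hmem n⟩ : E) ∈ Metric.closedBall (0 : E) ‖ξ‖ := fun n => by
    rw [mem_closedBall_zero_iff, Submodule.coe_norm]
    calc ‖Q (T n (Q ξ))‖ ≤ 1 * (1 * (1 * ‖ξ‖)) := by
          refine Q.le_of_opNorm_le_of_le hQ1 ?_
          refine (T n).le_of_opNorm_le_of_le (hT1 n) ?_
          exact Q.le_of_opNorm_le hQ1 _
      _ = ‖ξ‖ := by ring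
  obtain ⟨z, -, k, hk, hlim⟩ := tendsto_subseq_of_bounded Metric.isBounded_closedBall hbdd
  obtain ⟨N, hN⟩ := Metric.cauchySeq_iff'.1 hlim.cauchySeq δ hδ
  refine ⟨k N, k (N + 1), hk (Nat.lt_succ_self N), lt_of_le_of_lt ?_ hδε⟩
  have hD : ‖Q ((T (k N) - T (k (N + 1))) (Q ξ))‖ ≤ δ := by
    have h1 := hN (N + 1) (Nat.le_succ N)
    rw [dist_comm, dist_eq_norm, Submodule.coe_norm] at h1
    rw [sub_apply, map_sub]
    exact h1.le
  have hDc : T (k N) - T (k (N + 1)) ∈ repCommutant π :=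
    sub_mem ((hT _).mem_repCommutant hd) ((hT _).mem_repCommutant hd)
  have hD2 : ‖T (k N) - T (k (N + 1))‖ ≤ 2 :=
    (norm_sub_le _ _).trans (by linarith [hT1 (k N), hT1 (k (N + 1))])
  have hDval : ∀ u, ⟪ξ, (T (k N) - T (k (N + 1))) (π u ξ)⟫_ℂ = (θ (k N) - θ (k (N + 1))) u := by
    intro u
    rw [sub_apply, inner_sub_right, (hT _).inner_apply hd, (hT _).inner_apply hd, sub_apply]
  generalize T (k N) - T (k (N + 1)) = D at hD hDc hD2 hDval
  refine ContinuousLinearMap.opNorm_le_bound _ (by positivity) fun u => ?_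
  rw [← hDval]
  have hu : ‖π u‖ ≤ ‖u‖ := NonUnitalStarAlgHom.norm_apply_le π u
  have hQξ : ‖Q ξ‖ ≤ ‖ξ‖ := (Q.le_of_opNorm_le hQ1 ξ).trans (one_mul _).le
  have hsplit : ⟪ξ, D (π u ξ)⟫_ℂ = ⟪ξ, D (π u (P ξ))⟫_ℂ + (⟪P ξ, D (π u (Q ξ))⟫_ℂ +
      ⟪ξ, π u (Q (D (Q ξ)))⟫_ℂ) := by
    have h1 : ⟪ξ, π u (Q (D (Q ξ)))⟫_ℂ = ⟪Q ξ, D (π u (Q ξ))⟫_ℂ := by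
      rw [← rep_commutant_apply hQc, ← rep_commutant_apply hDc]
      exact (((ContinuousLinearMap.nonneg_iff_isPositive Q).1 hQ0).isSymmetric _ _).symm
    have h2 : ⟪P ξ, D (π u (Q ξ))⟫_ℂ + ⟪Q ξ, D (π u (Q ξ))⟫_ℂ = ⟪ξ, D (π u (Q ξ))⟫_ℂ := by
      rw [← inner_add_left, add_comm (P ξ), ← hξQ]
    rw [h1, h2, ← inner_add_right, ← map_add, ← map_add, add_comm (P ξ), ← hξQ]
  have hDu : ∀ y, ‖D (π u y)‖ ≤ 2 * (‖u‖ * ‖y‖) := fun y =>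
    D.le_of_opNorm_le_of_le hD2 ((π u).le_of_opNorm_le hu y)
  have e1 : ‖⟪ξ, D (π u (P ξ))⟫_ℂ‖ ≤ ‖ξ‖ * (2 * (‖u‖ * δ)) := by
    refine (norm_inner_le_norm _ _).trans ?_
    gcongr
    exact (hDu _).trans (by gcongr)
  have e2 : ‖⟪P ξ, D (π u (Q ξ))⟫_ℂ‖ ≤ δ * (2 * (‖u‖ * ‖ξ‖)) := by
    refine (norm_inner_le_norm _ _).trans ?_
    gcongr
    exact (hDu _).trans (by gcongr)
  have e3 : ‖⟪ξ, π u (Q (D (Q ξ)))⟫_ℂ‖ ≤ ‖ξ‖ * (‖u‖ * δ) := by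
    refine (norm_inner_le_norm _ _).trans ?_
    gcongr
    exact (π u).le_of_opNorm_le_of_le hu hD
  rw [hsplit]
  calc _ ≤ ‖ξ‖ * (2 * (‖u‖ * δ)) + (δ * (2 * (‖u‖ * ‖ξ‖)) + ‖ξ‖ * (‖u‖ * δ)) :=
        (norm_add_le _ _).trans (add_le_add e1 ((norm_add_le _ _).trans (add_le_add e2 e3)))
    _ = (4 * ‖ξ‖ * δ + ‖ξ‖ * δ) * ‖u‖ := by ring

end OrderInterval

/-! ### States concentrated on a positive element -/

section States

/-- A positive element `a` of norm at most one lies in the ball with center `1 / 2` and radius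
`1 / 2`. -/
theorem norm_add_self_sub_one_le {B : Type*} [CStarAlgebra B] [PartialOrder B] [StarOrderedRing B]
    {a : B} (ha : 0 ≤ a) (ha1 : ‖a‖ ≤ 1) : ‖a + a - 1‖ ≤ 1 := by
  have hs : star (a + a - 1) = a + a - 1 := by
    rw [star_sub, star_add, ha.isSelfAdjoint.star_eq, star_one]
  have h1 : star (a + a - 1) * (a + a - 1) ≤ 1 := by
    have h2 : a * a ≤ a := by
      refine (mul_self_le_norm_smul ha).trans ?_
      calc ‖a‖ • a ≤ (1 : ℝ) • a := smul_le_smul_of_nonneg_right ha1 ha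
        _ = a := one_smul ℝ a
    rw [hs, ← sub_nonneg]
    have h3 : 1 - (a + a - 1) * (a + a - 1) = (4 : ℝ) • (a - a * a) := by
      have : (a + a - 1) * (a + a - 1) = 1 - (4 : ℝ) • (a - a * a) := by
        simp only [mul_sub, sub_mul, mul_add, add_mul, mul_one, one_mul]
        module
      rw [this, sub_sub_cancel]
    rw [h3]
    exact smul_nonneg (by norm_num) (sub_nonneg.2 h2)
  have h4 := (CStarAlgebra.norm_le_one_iff_of_nonneg _ (star_mul_self_nonneg _)).2 h1
  rw [CStarRing.norm_star_mul_self] at h4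
  nlinarith [norm_nonneg (a + a - 1)]

/-- A contractive functional with `f 1 = 1` is positive: by contractivity, the values on the
positive contractions lie in every disk that contains the unit interval and whose center has real
part `1 / 2`. -/
theorem isPositiveFunctional_of_norm_le_one {B : Type u} [CStarAlgebra B] {f : B →L[ℂ] ℂ}
    (hf : ‖f‖ ≤ 1) (h1 : f 1 = 1) : IsPositiveFunctional f := by
  let := CStarAlgebra.spectralOrder B
  have := CStarAlgebra.spectralOrderedRing B
  have : Nontrivial B := nontrivial_of_ne 1 0 fun h => by simp [h] at h1
  have key : ∀ a : B, 0 ≤ a → ‖a‖ ≤ 1 → 0 ≤ f a := by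
    intro a ha ha1
    have h2 := norm_add_self_sub_one_le ha ha1
    have hs : star (a + a - 1) = a + a - 1 := by
      rw [star_sub, star_add, ha.isSelfAdjoint.star_eq, star_one]
    have h3 : ∀ t : ℝ, ((f a).re + (f a).re - 1) ^ 2 + ((f a).im + (f a).im + t) ^ 2
        ≤ 1 + t ^ 2 := by
      intro t
      have h4 : ‖a + a - 1 + (t * Complex.I) • (1 : B)‖ ^ 2 ≤ 1 + t ^ 2 := by
        rw [sq, ← CStarRing.norm_star_mul_self]
        have h5 : star (a + a - 1 + (t * Complex.I) • (1 : B)) *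
            (a + a - 1 + (t * Complex.I) • (1 : B)) =
              (a + a - 1) * (a + a - 1) + ((t ^ 2 : ℝ) : ℂ) • (1 : B) := by
          rw [star_add, hs, star_smul, star_one, star_mul', Complex.star_def,
            Complex.conj_ofReal, Complex.conj_I]
          generalize a + a - 1 = c
          simp only [mul_add, add_mul, mul_smul_comm, smul_mul_assoc, mul_one, one_mul, smul_add,
            smul_smul]
          rw [show (t : ℂ) * Complex.I * (t * -Complex.I) = ((t ^ 2 : ℝ) : ℂ) by
            push_cast; linear_combination (-(t : ℂ) ^ 2) * Complex.I_sq]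
          module
        rw [h5]
        refine (norm_add_le _ _).trans ?_
        gcongr
        · exact (norm_mul_le _ _).trans (mul_le_one₀ h2 (norm_nonneg _) h2)
        · rw [norm_smul, Complex.norm_real, Real.norm_of_nonneg (sq_nonneg t)]
          exact mul_le_of_le_one_right (sq_nonneg t) CStarRing.norm_one.le
      have h6 : ‖f (a + a - 1 + (t * Complex.I) • (1 : B))‖ ^ 2 ≤ 1 + t ^ 2 := by
        refine le_trans ?_ h4
        gcongr
        exact (f.le_of_opNorm_le hf _).trans (one_mul _).le
      rw [map_add, map_sub, map_add, map_smul, h1, ← Complex.normSq_eq_norm_sq,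
        Complex.normSq_apply] at h6
      simp at h6
      nlinarith
    have him : (f a).im = 0 := by
      by_contra h0
      have h7 := h3 ((f a).im⁻¹)
      have h8 := h3 0
      have h9 : (f a).im * (f a).im⁻¹ = 1 := mul_inv_cancel₀ h0
      nlinarith [sq_nonneg ((f a).re + (f a).re - 1), sq_nonneg (f a).im]
    refine Complex.nonneg_iff.2 ⟨?_, him.symm⟩
    have h7 := h3 0
    nlinarith [sq_nonneg ((f a).im + (f a).im)]
  intro a
  by_cases h0 : a = 0
  · rw [h0, mul_zero, map_zero]
  have hn : 0 < ‖a‖ := norm_pos_iff.2 h0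
  have h2 := key (star ((‖a‖⁻¹ : ℝ) • a) * ((‖a‖⁻¹ : ℝ) • a)) (star_mul_self_nonneg _) (by
    rw [CStarRing.norm_star_mul_self, norm_smul, norm_inv, norm_norm, inv_mul_cancel₀ hn.ne',
      one_mul])
  have h3 : star a * a = (‖a‖ ^ 2 : ℝ) • (star ((‖a‖⁻¹ : ℝ) • a) * ((‖a‖⁻¹ : ℝ) • a)) := by
    rw [star_smul, star_trivial (‖a‖⁻¹), smul_mul_smul_comm, smul_smul]
    rw [show ‖a‖ ^ 2 * (‖a‖⁻¹ * ‖a‖⁻¹) = 1 by field_simp, one_smul]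
  rw [h3, ← Complex.coe_smul, map_smul]
  exact mul_nonneg (Complex.zero_le_real.2 (sq_nonneg _)) h2

/-- A positive element `e` of norm one carries a state `ψ` concentrated on `e`: the functional
`ψ` has `e` in its multiplicative domain, with value one there. -/
theorem exists_state_concentrated {A : Type u} [NonUnitalCStarAlgebra A] {e : A}
    (he : IsPositiveElement e) (he1 : ‖e‖ = 1) :
    ∃ ψ : A →L[ℂ] ℂ, IsPositiveFunctional ψ ∧ ‖ψ‖ ≤ 1 ∧ ψ e = 1 ∧ ∀ k, ψ k = ψ (k * e) := by
  let := CStarAlgebra.spectralOrder (Unitization ℂ A)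
  have := CStarAlgebra.spectralOrderedRing (Unitization ℂ A)
  obtain ⟨d, hd⟩ := he
  have h0 : (0 : Unitization ℂ A) ≤ (e : Unitization ℂ A) := by
    rw [hd, Unitization.inr_mul, Unitization.inr_star]
    exact star_mul_self_nonneg _
  have hn : ‖(e : Unitization ℂ A)‖ = 1 := by rw [Unitization.norm_inr, he1]
  obtain ⟨f, hf, hfe⟩ := exists_dual_vector'' ℂ (e : Unitization ℂ A)
  rw [hn] at hfe
  have hfe' : f (e : Unitization ℂ A) = 1 := by simpa using hfe
  have hf1 : f 1 = 1 := by
    have h2 : ‖f ((e : Unitization ℂ A) + e - 1)‖ ≤ 1 :=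
      (f.le_of_opNorm_le hf _).trans ((one_mul _).le.trans (norm_add_self_sub_one_le h0 hn.le))
    have h3 : ‖f 1‖ ≤ 1 :=
      (f.le_of_opNorm_le hf _).trans ((one_mul _).le.trans CStarRing.norm_one.le)
    rw [map_sub, map_add, hfe'] at h2
    have h4 : ‖f 1‖ ^ 2 ≤ 1 := pow_le_one₀ (norm_nonneg _) h3
    have h5 : ‖(1 : ℂ) + 1 - f 1‖ ^ 2 ≤ 1 := pow_le_one₀ (norm_nonneg _) h2
    rw [← Complex.normSq_eq_norm_sq, Complex.normSq_apply] at h4 h5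
    simp at h5
    refine Complex.ext ?_ ?_
    · rw [Complex.one_re]; nlinarith [sq_nonneg (f 1).im]
    · rw [Complex.one_im]; nlinarith [sq_nonneg (f 1).im, sq_nonneg ((f 1).re - 1)]
  have hfp := isPositiveFunctional_of_norm_le_one hf hf1
  refine ⟨f.comp (homCLM (Unitization.inrNonUnitalStarAlgHom ℂ A)), hfp.comp _,
    (norm_comp_homCLM_le f _).trans hf, hfe', fun k => ?_⟩
  change f (k : Unitization ℂ A) = f ((k * e : A) : Unitization ℂ A)
  rw [Unitization.inr_mul, ← sub_eq_zero, ← map_sub]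
  have h2 : (k : Unitization ℂ A) - k * e = star (star (k : Unitization ℂ A)) * (1 - e) := by
    rw [star_star, mul_sub, mul_one]
  have h3 := hfp.norm_sq_le (1 - (e : Unitization ℂ A)) (star (k : Unitization ℂ A))
  have h4 : (f (star (1 - (e : Unitization ℂ A)) * (1 - e))).re ≤ 0 := by
    have h5 : star (1 - (e : Unitization ℂ A)) * (1 - e) = 1 - e - e + e * e := by
      rw [star_sub, star_one, h0.isSelfAdjoint.star_eq]
      noncomm_ring
    have h6 : ‖f ((e : Unitization ℂ A) * e)‖ ≤ 1 := by
      refine (f.le_of_opNorm_le hf _).trans ((one_mul _).le.trans ((norm_mul_le _ _).trans ?_))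
      rw [hn, one_mul]
    rw [h5, map_add, map_sub, map_sub, hf1, hfe']
    have := (Complex.re_le_norm _).trans h6
    simp only [Complex.add_re, Complex.sub_re, Complex.one_re]
    linarith
  rw [h2]
  have h7 := hfp.re_nonneg (star (k : Unitization ℂ A))
  have h8 : ‖f (star (star (k : Unitization ℂ A)) * (1 - e))‖ ^ 2 ≤ 0 :=
    h3.trans (mul_nonpos_of_nonneg_of_nonpos h7 h4)
  exact norm_eq_zero.1 (pow_eq_zero_iff two_ne_zero |>.1 (le_antisymm h8 (sq_nonneg _)))

end States

/-! ### Dyadic trees of orthogonal positive elements -/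

section Tree

variable {A : Type u} [NonUnitalCStarAlgebra A]

/-- `x` lives under `b` if left multipliers acting on `b` as `1` or as `0` do the same on `x`. -/
def LivesUnder (b x : A) : Prop := ∀ k : A, (k * b = b → k * x = x) ∧ (k * b = 0 → k * x = 0)

/-- `χ` has mass `m` under `b` if it takes the value `m` at the left units of `b` and vanishes at
the left annihilators of `b`. -/
def HasMassUnder (b : A) (χ : A →L[ℂ] ℂ) (m : ℝ) : Prop :=
  ∀ k : A, (k * b = b → χ k = m) ∧ (k * b = 0 → χ k = 0)

theorem livesUnder_of_mem_cornerSubalgebra {b x : A} {hb : star b = b}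
    (hx : x ∈ cornerSubalgebra b hb) : LivesUnder b x := by
  refine fun k => ⟨fun h => ?_, fun h => ?_⟩
  · refine cornerSubalgebra_induction (P := fun x => k * x = x)
      (isClosed_eq (by fun_prop) (by fun_prop)) (fun z => ?_) hx
    rw [← mul_assoc, ← mul_assoc, h]
  · refine cornerSubalgebra_induction (P := fun x => k * x = 0)
      (isClosed_eq (by fun_prop) (by fun_prop)) (fun z => ?_) hx
    rw [← mul_assoc, ← mul_assoc, h, zero_mul, zero_mul]

theorem HasMassUnder.of_livesUnder {b x : A} {χ : A →L[ℂ] ℂ} {m : ℝ} (h : HasMassUnder x χ m)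
    (hx : LivesUnder b x) : HasMassUnder b χ m :=
  fun k => ⟨fun hk => (h k).1 ((hx k).1 hk), fun hk => (h k).2 ((hx k).2 hk)⟩

theorem HasMassUnder.smul {b : A} {χ : A →L[ℂ] ℂ} {m : ℝ} (h : HasMassUnder b χ m) (r : ℝ) :
    HasMassUnder b (r • χ) (r * m) := fun k =>
  ⟨fun hk => by rw [smul_apply, (h k).1 hk, Complex.real_smul, Complex.ofReal_mul],
    fun hk => by rw [smul_apply, (h k).2 hk, smul_zero]⟩

theorem HasMassUnder.add {b : A} {χ χ' : A →L[ℂ] ℂ} {m m' : ℝ} (h : HasMassUnder b χ m)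
    (h' : HasMassUnder b χ' m') : HasMassUnder b (χ + χ') (m + m') := fun k =>
  ⟨fun hk => by rw [add_apply, (h k).1 hk, (h' k).1 hk, Complex.ofReal_add],
    fun hk => by rw [add_apply, (h k).2 hk, (h' k).2 hk, add_zero]⟩

/-- The sum of two self-adjoint contractions with product zero is a contraction. -/
theorem norm_add_le_one_of_mul_eq_zero {x y : A} (hx : star x = x) (hy : star y = y)
    (hx1 : ‖x‖ ≤ 1) (hy1 : ‖y‖ ≤ 1) (hxy : x * y = 0) : ‖x + y‖ ≤ 1 := by
  have hyx : y * x = 0 := by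
    have := congrArg star hxy
    rwa [star_mul, hx, hy, star_zero] at this
  -- powers of `x + y` are `x ^ n + y ^ n`, so `‖x + y‖ ^ (2 ^ n) ≤ 2` for all `n`
  have key : ∀ n : ℕ, ∀ z w : A, star z = z → star w = w → ‖z‖ ≤ 1 → ‖w‖ ≤ 1 → z * w = 0 →
      w * z = 0 → ‖z + w‖ ^ 2 ^ n ≤ 2 := by
    intro n
    induction n with
    | zero =>
      intro z w _ _ hz hw _ _
      rw [pow_zero, pow_one]
      exact (norm_add_le _ _).trans (by linarith)
    | succ n ih =>
      intro z w hz hw hz1 hw1 hzw hwz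
      have h1 : ‖z + w‖ ^ 2 = ‖z * z + w * w‖ := by
        rw [sq, ← CStarRing.norm_star_mul_self, star_add, hz, hw]
        congr 1
        rw [mul_add, add_mul, add_mul, hzw, hwz, zero_add, add_zero]
      rw [pow_succ', pow_mul, h1]
      refine ih _ _ (by rw [star_mul, hz]) (by rw [star_mul, hw])
        ((norm_mul_le _ _).trans (mul_le_one₀ hz1 (norm_nonneg _) hz1))
        ((norm_mul_le _ _).trans (mul_le_one₀ hw1 (norm_nonneg _) hw1)) ?_ ?_
      · rw [mul_assoc, ← mul_assoc z w, hzw, zero_mul, mul_zero]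
      · rw [mul_assoc, ← mul_assoc w z, hwz, zero_mul, mul_zero]
  by_contra! hlt
  have h1 : Tendsto (fun n : ℕ => ‖x + y‖ ^ 2 ^ n) atTop atTop :=
    (tendsto_pow_atTop_atTop_of_one_lt hlt).comp (tendsto_pow_atTop_atTop_of_one_lt one_lt_two)
  obtain ⟨n, hn⟩ := (h1.eventually_gt_atTop 2).exists
  exact absurd (key n x y hx hy hx1 hy1 hxy hyx) (not_le.2 hn)

/-- A dyadic splitting: every node `b` of norm-one positive elements has two children
`l b` and `r b` living under `b`, separated by a self-adjoint contraction `sep b`. -/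
structure DyadicSplitting (ι : Type*) (A : Type u) [NonUnitalCStarAlgebra A] where
  /-- The positive element at a node. -/
  val : ι → A
  /-- The left child. -/
  l : ι → ι
  /-- The right child. -/
  r : ι → ι
  /-- The separating element. -/
  sep : ι → A
  isPositive : ∀ b, IsPositiveElement (val b)
  norm_val : ∀ b, ‖val b‖ = 1
  l_under : ∀ b, LivesUnder (val b) (val (l b))
  r_under : ∀ b, LivesUnder (val b) (val (r b))
  sep_under : ∀ b, LivesUnder (val b) (sep b)
  star_sep : ∀ b, star (sep b) = sep b
  norm_sep : ∀ b, ‖sep b‖ ≤ 1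
  sep_l : ∀ b, sep b * val (l b) = val (l b)
  sep_r : ∀ b, sep b * val (r b) = 0

theorem exists_dyadicSplitting (hA : ∀ p : A, ¬ IsMinimalOpenProjection p) :
    Nonempty (DyadicSplitting {b : A // IsPositiveElement b ∧ ‖b‖ = 1} A) := by
  have h := fun b : {b : A // IsPositiveElement b ∧ ‖b‖ = 1} =>
    exists_orthogonal_pair hA b.2.1.star_eq (norm_ne_zero_iff.1 (by rw [b.2.2]; exact one_ne_zero))
  choose x hx y hy k hk hxp hyp hx1 hy1 hks hk1 hkx hky using h
  exact ⟨{
    val := Subtype.val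
    l := fun b => ⟨x b, hxp b, hx1 b⟩
    r := fun b => ⟨y b, hyp b, hy1 b⟩
    sep := k
    isPositive := fun b => b.2.1
    norm_val := fun b => b.2.2
    l_under := fun b => livesUnder_of_mem_cornerSubalgebra (hx b)
    r_under := fun b => livesUnder_of_mem_cornerSubalgebra (hy b)
    sep_under := fun b => livesUnder_of_mem_cornerSubalgebra (hk b)
    star_sep := hks
    norm_sep := hk1
    sep_l := hkx
    sep_r := hky }⟩

namespace DyadicSplitting

variable {ι : Type*} (D : DyadicSplitting ι A)

/-- Replace the value at a node by the average of the values at its children. -/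
noncomputable def mean (g : ι → A →L[ℂ] ℂ) (b : ι) : A →L[ℂ] ℂ :=
  (1 / 2 : ℝ) • (g (D.l b) + g (D.r b))

/-- Half of the value at the left child. -/
noncomputable def left (g : ι → A →L[ℂ] ℂ) (b : ι) : A →L[ℂ] ℂ := (1 / 2 : ℝ) • g (D.l b)

/-- The sum of the separating elements of the descendants of a node in a given generation. -/
def sepSum : ℕ → ι → A
  | 0, b => D.sep b
  | n + 1, b => sepSum n (D.l b) + sepSum n (D.r b)

/-- Elements living under the two children of a node are orthogonal. -/
theorem mul_eq_zero {b : ι} {x y : A} (hx : LivesUnder (D.val (D.l b)) x)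
    (hxs : star x = x) (hy : LivesUnder (D.val (D.r b)) y) : x * y = 0 := by
  have h1 : x * D.sep b = x := by
    have := congrArg star ((hx _).1 (D.sep_l b))
    rwa [star_mul, hxs, D.star_sep] at this
  rw [← h1, mul_assoc, (hy _).2 (D.sep_r b), mul_zero]

theorem livesUnder_self (b : A) : LivesUnder b b := fun _ => ⟨id, id⟩

theorem mul_eq_zero' {b : ι} {x y : A} (hx : LivesUnder (D.val (D.l b)) x) (hxs : star x = x)
    (hy : LivesUnder (D.val (D.r b)) y) (hys : star y = y) : y * x = 0 := by
  have := congrArg star (D.mul_eq_zero hx hxs hy)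
  rwa [star_mul, hxs, hys, star_zero] at this

theorem sepSum_spec (n : ℕ) : ∀ b, LivesUnder (D.val b) (D.sepSum n b) ∧
    star (D.sepSum n b) = D.sepSum n b ∧ ‖D.sepSum n b‖ ≤ 1 := by
  induction n with
  | zero => exact fun b => ⟨D.sep_under b, D.star_sep b, D.norm_sep b⟩
  | succ n ih =>
    intro b
    obtain ⟨h1, h2, h3⟩ := ih (D.l b)
    obtain ⟨h4, h5, h6⟩ := ih (D.r b)
    refine ⟨fun k => ⟨fun hk => ?_, fun hk => ?_⟩, ?_, ?_⟩
    · rw [sepSum, mul_add, (h1 k).1 ((D.l_under b k).1 hk), (h4 k).1 ((D.r_under b k).1 hk)]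
    · rw [sepSum, mul_add, (h1 k).2 ((D.l_under b k).2 hk), (h4 k).2 ((D.r_under b k).2 hk),
        add_zero]
    · rw [sepSum, star_add, h2, h5]
    · exact norm_add_le_one_of_mul_eq_zero h2 h5 h3 h6 (D.mul_eq_zero h1 h2 h4)

variable {D} {g : ι → A →L[ℂ] ℂ} {m : ℝ}

theorem hasMassUnder_mean (hg : ∀ b, HasMassUnder (D.val b) (g b) m) (b : ι) :
    HasMassUnder (D.val b) (D.mean g b) m := by
  have h := (((hg (D.l b)).of_livesUnder (D.l_under b)).add
    ((hg (D.r b)).of_livesUnder (D.r_under b))).smul (1 / 2)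
  rwa [show (1 / 2 : ℝ) * (m + m) = m by ring] at h

theorem hasMassUnder_left (hg : ∀ b, HasMassUnder (D.val b) (g b) m) (b : ι) :
    HasMassUnder (D.val b) (D.left g b) (1 / 2 * m) :=
  ((hg (D.l b)).of_livesUnder (D.l_under b)).smul (1 / 2)

theorem iterate_mean_induction {P : ι → (A →L[ℂ] ℂ) → Prop}
    (hP : ∀ g : ι → A →L[ℂ] ℂ, (∀ b, P b (g b)) → ∀ b, P b (D.mean g b)) (hg : ∀ b, P b (g b))
    (n : ℕ) : ∀ b, P b (D.mean^[n] g b) := by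
  induction n with
  | zero => exact hg
  | succ n ih =>
    rw [Function.iterate_succ_apply']
    exact hP _ ih

/-- Averaging over `n` generations and testing on the sum of the separating elements of the `n`-th
generation amounts to testing on the separating element at every node of that generation. -/
theorem iterate_mean_apply_sepSum (hg : ∀ b, HasMassUnder (D.val b) (g b) m) {v : ℂ}
    (hv : ∀ b, g b (D.sep b) = v) (n : ℕ) : ∀ b, D.mean^[n] g b (D.sepSum n b) = v := by
  induction n with
  | zero => exact hv
  | succ n ih =>
    intro b
    have hm := iterate_mean_induction (P := fun b χ => HasMassUnder (D.val b) χ m)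
      (fun _ h => hasMassUnder_mean h) hg n
    obtain ⟨h1, h2, -⟩ := D.sepSum_spec n (D.l b)
    obtain ⟨h4, h5, -⟩ := D.sepSum_spec n (D.r b)
    have e1 : D.mean^[n] g (D.l b) (D.sepSum n (D.r b)) = 0 :=
      (hm (D.l b) _).2 (D.mul_eq_zero' (livesUnder_self _) (D.isPositive _).star_eq h4 h5)
    have e2 : D.mean^[n] g (D.r b) (D.sepSum n (D.l b)) = 0 :=
      (hm (D.r b) _).2 (D.mul_eq_zero h1 h2 (livesUnder_self _))
    rw [Function.iterate_succ_apply', mean, sepSum, smul_apply, add_apply, map_add, map_add, ih, ih,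
      e1, e2, Complex.real_smul]
    push_cast
    ring

theorem left_apply_sep (hg : ∀ b, HasMassUnder (D.val b) (g b) m) (b : ι) :
    D.left g b (D.sep b) = (1 / 2 * m : ℝ) := by
  rw [left, smul_apply, (hg _ _).1 (D.sep_l b), Complex.real_smul, Complex.ofReal_mul]

theorem mean_apply_sep (hg : ∀ b, HasMassUnder (D.val b) (g b) m) (b : ι) :
    D.mean g b (D.sep b) = (1 / 2 * m : ℝ) := by
  rw [mean, smul_apply, add_apply, (hg _ _).1 (D.sep_l b), (hg _ _).2 (D.sep_r b), add_zero,
    Complex.real_smul, Complex.ofReal_mul]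

theorem isPositiveFunctional_mean (hg : ∀ b, IsPositiveFunctional (g b)) (b : ι) :
    IsPositiveFunctional (D.mean g b) := ((hg _).add (hg _)).smul (by norm_num)

theorem isPositiveFunctional_left (hg : ∀ b, IsPositiveFunctional (g b)) (b : ι) :
    IsPositiveFunctional (D.left g b) := (hg _).smul (by norm_num)

theorem isPositiveFunctional_iterate_mean_sub {g' : ι → A →L[ℂ] ℂ}
    (hg : ∀ b, IsPositiveFunctional (g b - g' b)) (n : ℕ) (b : ι) :
    IsPositiveFunctional (D.mean^[n] g b - D.mean^[n] g' b) := by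
  induction n generalizing g g' with
  | zero => exact hg b
  | succ n ih =>
    refine ih fun b => ?_
    have h : D.mean g b - D.mean g' b = D.mean (fun b => g b - g' b) b := by
      ext a
      simp only [mean, sub_apply, smul_apply, add_apply, Complex.real_smul]
      ring
    rw [h]
    exact isPositiveFunctional_mean hg b

theorem norm_mean_le (hg : ∀ b, ‖g b‖ ≤ 1) (b : ι) : ‖D.mean g b‖ ≤ 1 := by
  rw [mean, norm_smul, Real.norm_of_nonneg (by norm_num)]
  have := norm_add_le (g (D.l b)) (g (D.r b))
  linarith [hg (D.l b), hg (D.r b)]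

end DyadicSplitting

/-- Contractive functionals converge pointwise along ultrafilters. -/
theorem exists_tendsto_ultrafilter {f : ℕ → A →L[ℂ] ℂ} (hf : ∀ n, ‖f n‖ ≤ 1) (𝒰 : Ultrafilter ℕ) :
    ∃ φ : A →L[ℂ] ℂ, ∀ a, Tendsto (fun n => f n a) 𝒰 (𝓝 (φ a)) := by
  have hc := WeakDual.isCompact_closedBall (𝕜 := ℂ) (E := A) 0 1
  obtain ⟨φ, -, hφ⟩ := hc.ultrafilter_le_nhds (𝒰.map fun n => StrongDual.toWeakDual (f n)) (by
    rw [Ultrafilter.coe_map, le_principal_iff]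
    refine mem_map.2 (univ_mem' fun n => ?_)
    change f n ∈ Metric.closedBall 0 1
    rw [mem_closedBall_zero_iff]
    exact hf n)
  exact ⟨WeakDual.toStrongDual φ, fun a => ((WeakDual.eval_continuous a).tendsto φ).comp hφ⟩

theorem isPositiveFunctional_of_tendsto {f : ℕ → A →L[ℂ] ℂ} {𝒰 : Filter ℕ} [𝒰.NeBot]
    {φ : A →L[ℂ] ℂ} (h : ∀ a, Tendsto (fun n => f n a) 𝒰 (𝓝 (φ a)))
    (hf : ∀ᶠ n in 𝒰, IsPositiveFunctional (f n)) : IsPositiveFunctional φ := fun a =>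
  ge_of_tendsto (h _) (hf.mono fun _ hn => hn a)

/-- Without minimal projections there is a positive functional which dominates a sequence of
functionals that is separated by contractions: the mass distribution of a dyadic tree, restricted
to the left halves of its generations. -/
theorem exists_separated_sequence [Nontrivial A] (hA : ∀ p : A, ¬ IsMinimalOpenProjection p) :
    ∃ (φ : A →L[ℂ] ℂ) (θ : ℕ → A →L[ℂ] ℂ) (u : ℕ → A), IsPositiveFunctional φ ∧
      (∀ n, IsPositiveFunctional (θ n)) ∧ (∀ n, IsPositiveFunctional (φ - θ n)) ∧
      (∀ n, ‖u n‖ ≤ 1) ∧ (∀ n, θ n (u n) = (1 / 2 : ℝ)) ∧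
      ∀ n m, n < m → θ m (u n) = (1 / 4 : ℝ) := by
  obtain ⟨D⟩ := exists_dyadicSplitting hA
  obtain ⟨b⟩ : Nonempty {b : A // IsPositiveElement b ∧ ‖b‖ = 1} := by
    obtain ⟨a, ha⟩ := exists_ne (0 : A)
    have hn := norm_ne_zero_iff.2 ha
    refine ⟨⟨star (‖a‖⁻¹ • a) * (‖a‖⁻¹ • a), ⟨_, rfl⟩, ?_⟩⟩
    rw [CStarRing.norm_star_mul_self, norm_smul, norm_inv, norm_norm, inv_mul_cancel₀ hn, one_mul]
  choose ψ hψ hψ1 hψe hψk using fun b => exists_state_concentrated (D.isPositive b) (D.norm_val b)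
  have hψm : ∀ b, HasMassUnder (D.val b) (ψ b) 1 := fun b k =>
    ⟨fun hk => by rw [hψk, hk, hψe, Complex.ofReal_one], fun hk => by rw [hψk, hk, map_zero]⟩
  -- `G N` averages over `N` generations, `Θ n N` only over the branches turning left at step `n`
  let G : ℕ → _ → A →L[ℂ] ℂ := fun N => D.mean^[N] ψ
  let Θ : ℕ → ℕ → _ → A →L[ℂ] ℂ := fun n N => D.mean^[n] (D.left (G N))
  have hGp : ∀ N b, IsPositiveFunctional (G N b) := fun N =>
    DyadicSplitting.iterate_mean_induction (P := fun _ => IsPositiveFunctional)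
      (fun _ h => DyadicSplitting.isPositiveFunctional_mean h) hψ N
  have hGm : ∀ N b, HasMassUnder (D.val b) (G N b) 1 := fun N =>
    DyadicSplitting.iterate_mean_induction (P := fun b χ => HasMassUnder (D.val b) χ 1)
      (fun _ h => DyadicSplitting.hasMassUnder_mean h) hψm N
  have hG1 : ∀ N b, ‖G N b‖ ≤ 1 := fun N =>
    DyadicSplitting.iterate_mean_induction (P := fun _ χ => ‖χ‖ ≤ 1)
      (fun _ h => DyadicSplitting.norm_mean_le h) hψ1 N
  have hΘp : ∀ n N b, IsPositiveFunctional (Θ n N b) := fun n N =>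
    DyadicSplitting.iterate_mean_induction (P := fun _ => IsPositiveFunctional)
      (fun _ h => DyadicSplitting.isPositiveFunctional_mean h)
      (DyadicSplitting.isPositiveFunctional_left (hGp N)) n
  have hΘm : ∀ n N b, HasMassUnder (D.val b) (Θ n N b) (1 / 2 * 1) := fun n N =>
    DyadicSplitting.iterate_mean_induction (P := fun b χ => HasMassUnder (D.val b) χ (1 / 2 * 1))
      (fun _ h => DyadicSplitting.hasMassUnder_mean h)
      (DyadicSplitting.hasMassUnder_left (hGm N)) n
  have hle : ∀ n N b, IsPositiveFunctional (G (n + (N + 1)) b - Θ n N b) := by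
    intro n N b
    have h1 : G (n + (N + 1)) = D.mean^[n] (D.mean (G N)) := by
      change D.mean^[n + (N + 1)] ψ = _
      rw [Function.iterate_add_apply, Function.iterate_succ_apply']
    rw [h1]
    refine DyadicSplitting.isPositiveFunctional_iterate_mean_sub (fun b => ?_) n b
    have h2 : D.mean (G N) b - D.left (G N) b = (1 / 2 : ℝ) • G N (D.r b) := by
      ext a
      simp only [DyadicSplitting.mean, DyadicSplitting.left, sub_apply, smul_apply, add_apply,
        Complex.real_smul]
      ring
    rw [h2]
    exact (hGp N _).smul (by norm_num)
  have hΘ1 : ∀ n N b, ‖Θ n N b‖ ≤ 1 := fun n N b => by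
    have h1 := (hΘp n N b).norm_add (hle n N b)
    rw [add_sub_cancel] at h1
    linarith [hG1 (n + (N + 1)) b, norm_nonneg (G (n + (N + 1)) b - Θ n N b)]
  have hsame : ∀ n N b, Θ n N b (D.sepSum n b) = (1 / 2 : ℝ) := fun n N b => by
    rw [DyadicSplitting.iterate_mean_apply_sepSum (DyadicSplitting.hasMassUnder_left (hGm N))
      (DyadicSplitting.left_apply_sep (hGm N)), mul_one]
  have hdiff : ∀ n m, n < m → ∀ N b, Θ m N b (D.sepSum n b) = (1 / 4 : ℝ) := fun n m hnm N b => by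
    obtain ⟨j, rfl⟩ := Nat.exists_eq_add_of_lt hnm
    have h1 : Θ (n + j + 1) N = D.mean^[n] (D.mean (Θ j N)) := by
      change D.mean^[n + j + 1] _ = _
      rw [add_assoc, Function.iterate_add_apply, Function.iterate_succ_apply']
    rw [h1, DyadicSplitting.iterate_mean_apply_sepSum
      (DyadicSplitting.hasMassUnder_mean (hΘm j N)) (DyadicSplitting.mean_apply_sep (hΘm j N))]
    norm_num
  obtain ⟨φ, hφ⟩ := exists_tendsto_ultrafilter (fun N => hG1 N b) (hyperfilter ℕ)
  choose θ hθ using fun n =>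
    exists_tendsto_ultrafilter (fun N => hΘ1 n (N - (n + 1)) b) (hyperfilter ℕ)
  refine ⟨φ, θ, fun n => D.sepSum n b,
    isPositiveFunctional_of_tendsto hφ (Eventually.of_forall fun N => hGp N b),
    fun n => isPositiveFunctional_of_tendsto (hθ n) (Eventually.of_forall fun N => hΘp _ _ b),
    fun n => ?_, fun n => (D.sepSum_spec n b).2.2, fun n => ?_, fun n m hnm => ?_⟩
  · refine isPositiveFunctional_of_tendsto (fun a => (hφ a).sub (hθ n a)) ?_
      (f := fun N => G N b - Θ n (N - (n + 1)) b)
    have h1 : ∀ᶠ N in (hyperfilter ℕ : Filter ℕ), n + 1 ≤ N :=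
      Nat.hyperfilter_le_atTop (eventually_ge_atTop (n + 1))
    filter_upwards [h1] with N hN
    have h2 := hle n (N - (n + 1)) b
    rwa [show n + (N - (n + 1) + 1) = N by omega] at h2
  · exact tendsto_nhds_unique (hθ n _) (by simp only [hsame]; exact tendsto_const_nhds)
  · exact tendsto_nhds_unique (hθ m _) (by simp only [hdiff n m hnm]; exact tendsto_const_nhds)

/-- Nonzero scattered algebras contain a minimal projection. -/
theorem IsScattered.exists_isMinimalOpenProjection [Nontrivial A] (hA : IsScattered A) :
    ∃ p : A, IsMinimalOpenProjection p := by
  by_contra! hmin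
  obtain ⟨φ, θ, u, hφ, hθ, hle, hu, hsame, hdiff⟩ := exists_separated_sequence hmin
  have h0 : ‖φ‖ ≠ 0 := fun h => by
    have h1 := hle 0
    rw [norm_eq_zero.1 h, zero_sub] at h1
    have h2 := hsame 0
    rw [(hθ 0).eq_zero_of_neg h1, zero_apply] at h2
    norm_num at h2
  obtain ⟨w, ψ, hw, hψ, hsum⟩ := hA (‖φ‖⁻¹ • φ) (mem_stateSpace_iff.2
    ⟨hφ.smul (by positivity), by rw [norm_smul, norm_inv, norm_norm, inv_mul_cancel₀ h0]⟩)
  have hsum' : HasSum (fun n => (‖φ‖ * w n) • ψ n) φ := by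
    have h1 := hsum.const_smul ‖φ‖
    simpa only [smul_smul, smul_inv_smul₀ h0] using h1
  obtain ⟨n, m, hnm, hlt⟩ := exists_norm_sub_lt_of_hasSum hφ
    (fun n => (mem_stateSpace_iff.1 (mem_pureStates_iff.1 (hψ n)).1).1.smul
      (mul_nonneg (norm_nonneg φ) (hw n)))
    (fun n => isExtremeRay_smul_of_mem_pureStates (hψ n) _) hsum' hθ hle
    (ε := 1 / 4) (by norm_num)
  have h1 : ‖(θ n - θ m) (u n)‖ ≤ ‖θ n - θ m‖ :=
    ((θ n - θ m).le_opNorm (u n)).trans (mul_le_of_le_one_right (norm_nonneg _) (hu n))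
  rw [sub_apply, hsame, hdiff n m hnm, ← Complex.ofReal_sub, Complex.norm_real] at h1
  norm_num at h1
  linarith

end Tree

/-! ### The equivalences -/

section Equivalences

theorem IsMinimalOpenProjection.of_mem_closedIdeal {D : Type u} [NonUnitalCStarAlgebra D]
    {J : ClosedIdeal D} {p : J} (hp : IsMinimalOpenProjection p) :
    IsMinimalOpenProjection (p : D) := by
  obtain ⟨h0, h1, h2, h3⟩ := isMinimalOpenProjection_iff.1 hp
  have h1' : (p : D) * p = p := congrArg Subtype.val h1
  refine isMinimalOpenProjection_iff.2 ⟨fun h => h0 (Subtype.ext h), h1', congrArg Subtype.val h2,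
    fun a => ?_⟩
  obtain ⟨c, hc⟩ := h3 ⟨p * a * p, J.mul_mem_left _ p.2⟩
  refine ⟨c, ?_⟩
  have h4 : (p : D) * (p * a * p) * p = c • (p : D) := congrArg Subtype.val hc
  rw [← h4]
  calc (p : D) * a * p = (p * p) * a * (p * p) := by rw [h1']
    _ = p * (p * a * p) * p := by simp only [mul_assoc]

theorem isGCRRep_iff {B : Type*} [NonUnitalSemiring B] [StarRing B] [Module ℂ B]
    {H : Type u} [NormedAddCommGroup H] [InnerProductSpace ℂ H] [CompleteSpace H]
    {π : B →⋆ₙₐ[ℂ] (H →L[ℂ] H)} :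
    IsGCRRep π ↔ ∃ b, π b ≠ 0 ∧ π b ∈ ClosedIdeal.compactOperators H := by
  rw [IsGCRRep, ne_eq, Set.eq_singleton_iff_unique_mem, not_and]
  constructor
  · intro h
    have h1 := h ⟨⟨0, map_zero π⟩, zero_mem (ClosedIdeal.compactOperators H)⟩
    push Not at h1
    obtain ⟨_, ⟨⟨b, rfl⟩, hb⟩, hb0⟩ := h1
    exact ⟨b, hb0, hb⟩
  · rintro ⟨b, hb0, hb⟩ - h
    exact hb0 (h _ ⟨⟨b, rfl⟩, hb⟩)

end Equivalences

theorem theorem3p1 (A : Type u) [NonUnitalCStarAlgebra A] :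
    List.TFAE [
      IsNowhereScattered A,
      ∀ I : ClosedIdeal A, IsAntiliminal I.Quotient,
      ∀ (I : ClosedIdeal A) (J : ClosedIdeal I.Quotient), Nontrivial J → ¬ IsTypeI J,
      ∀ (I : ClosedIdeal A) (J : ClosedIdeal I.Quotient), Nontrivial J → ¬ IsScattered J,
      ∀ (I : ClosedIdeal A) (J : ClosedIdeal I.Quotient), Nontrivial J → ¬ IsElementary J,
      ∀ (H : Type u) [NormedAddCommGroup H] [InnerProductSpace ℂ H] [CompleteSpace H]
        (π : A →⋆ₙₐ[ℂ] (H →L[ℂ] H)), π ≠ 0 → IsIrreducibleRep π → ¬ IsGCRRep π,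
      ∀ B : NonUnitalStarSubalgebra ℂ A, IsHereditary B →
        ∀ (H : Type u) [NormedAddCommGroup H] [InnerProductSpace ℂ H] [CompleteSpace H]
          (π : B →⋆ₙₐ[ℂ] (H →L[ℂ] H)), π ≠ 0 → IsIrreducibleRep π → ¬ FiniteDimensional ℂ H,
      ∀ B : NonUnitalStarSubalgebra ℂ A, IsHereditary B →
        ∀ (H : Type u) [NormedAddCommGroup H] [InnerProductSpace ℂ H] [CompleteSpace H]
          (π : B →⋆ₙₐ[ℂ] (H →L[ℂ] H)), π ≠ 0 → IsIrreducibleRep π →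
            Module.finrank ℂ H ≠ 1] := by
  tfae_have 1 → 2 := fun h I a ha => by
    by_contra h0
    exact not_isNowhereScattered_of_quotient (not_isNowhereScattered_of_isAbelianElement ha h0) h
  tfae_have 2 → 3 := fun h I J hJ hI => by
    obtain ⟨a, h0, ha⟩ := exists_isAbelianElement_of_isTypeI hI
    exact h0 (h I a ha)
  tfae_have 3 → 5 := fun h I J hJ hE => h I J hJ hE.isTypeI
  tfae_have 1 → 4 := fun h I J hJ hS => by
    obtain ⟨p, hp⟩ := hS.exists_isMinimalOpenProjection
    exact h I ⟨p, hp.of_mem_closedIdeal⟩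
  tfae_have 4 → 5 := fun h I J hJ hE => h I J hJ hE.isScattered
  tfae_have 5 → 1 := fun h => by
    by_contra h1
    obtain ⟨H, _, _, _, π, _, -, hπ⟩ := exists_irreducibleRep_rankOne h1
    obtain ⟨I, J, hJ, hE⟩ := exists_isElementary_of_rankOne π hπ
    exact h I J hJ hE
  tfae_have 1 → 6 := fun h H _ _ _ π _ _ hG => by
    obtain ⟨a, ha, hc⟩ := isGCRRep_iff.1 hG
    exact not_isNowhereScattered_of_compact π ha hc h
  tfae_have 6 → 1 := fun h => by
    by_contra h1
    obtain ⟨H, _, _, _, π, _, hirr, hπ⟩ := exists_irreducibleRep_rankOne h1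
    obtain ⟨x, hx⟩ := exists_ne (0 : H)
    obtain ⟨a, ha⟩ := hπ x x
    have ha0 : π a ≠ 0 := by
      rw [ha, ← norm_ne_zero_iff, InnerProductSpace.norm_rankOne]
      exact mul_ne_zero (norm_ne_zero_iff.2 hx) (norm_ne_zero_iff.2 hx)
    refine h H π (fun h0 => ha0 (by rw [h0]; rfl)) hirr (isGCRRep_iff.2 ⟨a, ha0, ?_⟩)
    rw [ha]
    exact (compactRankOne x x).2
  tfae_have 1 → 7 := fun h B hB H _ _ _ π hπ _ hfd =>
    not_isNowhereScattered_of_finiteDimensional B hB π hπ h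
  tfae_have 7 → 8 := fun h B hB H _ _ _ π hπ hirr hfr =>
    h B hB H π hπ hirr (Module.finite_of_finrank_eq_succ hfr)
  tfae_have 8 → 1 := fun h => by
    by_contra h1
    obtain ⟨B, hB, π, hπ⟩ := exists_hereditary_oneDimensional h1
    have hfr : Module.finrank ℂ (EuclideanSpace ℂ PUnit.{u + 1}) = 1 := by
      rw [finrank_euclideanSpace, Fintype.card_punit]
    exact h B hB _ π hπ (isIrreducibleRep_of_finrank_eq_one hfr π) hfr
  tfae_finish
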